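/- Let $M$ be a real analytic manifold, let $T>0$, and let $W\subseteq M$ be open. Let $\mathbb C TM=TM\otimes_{\mathbb R}\mathbb C$. For a complex vector field $Z$ and a complex tensor field $\alpha$ of type $(p,q)$ (a section of $(TM)^{\otimes p}\otimes(T^*M)^{\otimes q}\otimes\mathbb C$), the complex Lie derivative $\mathscr L_Z\alpha$ is the $\mathbb C$-bilinear extension of the usual Lie derivative, i.e. $\mathscr L_Z\alpha=\mathscr L_{\mathrm{Re} Z}\alpha+i\,\mathscr L_{\mathrm{Im} Z}\alpha$. A path $t\mapsto A_t$, $t\in[0,T]$, of (complex) vector fields or tensor fields on an open set $U$ is called piecewise real analytic if there is a partition $0=s_0<s_1<\dots<s_N=T$ such that on each $[s_i,s_{i+1})\times U$ the map $(t,x)\mapsto A_t(x)$ coincides with one that is jointly real analytic in $(t,x)$ on $[s_i,s_{i+1}]\times U$, including the end points of the time interval (jumps at the $s_i$ are allowed). A $C^1$ transport of $\alpha$ through $Z_\bullet$ on $[0,\tau]\times U$ is a path of tensors $\beta_t$, $t\in[0,\tau]$, on $U$ that is jointly $C^1$ in $(t,x)\in[0,\tau]\times U$ and satisfies $$\dot\beta_t=\mathscr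 L_{Z_t}\beta_t\quad (t\in[0,\tau]),\qquad \beta_0=\alpha\qquad\text{on }U .$$ Let $(Z_t)_{t\in[0,T]}$ be a piecewise real analytic path of complex vector fields on $W$ and let $\alpha$ be a real analytic complex tensor of type $(p,q)$ on $W$. (1) For every $p_0\in W$ there are an open neighborhood $U\subseteq W$ of $p_0$, a time $T_0\in(0,T]$ and a $C^1$ transport $(\alpha_t)_{t\in[0,T_0]}$ of $\alpha$ through $Z_\bullet$ on $[0,T_0]\times U$. The path $t\mapsto\alpha_t$ is piecewise real analytic and each $\alpha_t$ is a real analytic tensor on $U$. It is unique in the following senses: (a) every $C^1$ transport of $\alpha$ on $[0,T_0]\times U$ that is piecewise real analytic equals $\alpha_t$ on all of $[0,T_0]\times U$; (b) for every open neighborhood $U'\subseteq W$ of $p_0$ and every $T'\in(0,T]$ there are an open neighborhood $V\subseteq U\cap U'$ of $p_0$ and $T''\in(0,\min(T_0,T')]$ such that every $C^1$ transport of $\alpha$ on $[0,T']\times U'$ coincides with $\alpha_t$ on $[0,T'']\times V$. (2) If $M$ is compact and $W=M$, there are $T_0\in(0,T]$ and a $C^1$ transport $(\alpha_t)_{t\in[0,T_0]}$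 of $\alpha$ through $Z_\bullet$ on $[0,T_0]\times M$, which is piecewise real analytic in $t$ and such that each $\alpha_t$ is a real analytic tensor; and for every $T'\in(0,T_0]$ every $C^1$ transport of $\alpha$ on $[0,T']\times M$ coincides with $\alpha_t$ for all $t\in[0,T']$. -/

import Mathlib

open Set
open scoped Manifold ContDiff TensorProduct

noncomputable section

/-- The complex tensors of type `(p, q)` on a finite-dimensional real vector space `V`, that is
`(V^{⊗ p} ⊗ (V^*)^{⊗ q}) ⊗_ℝ ℂ`, realised as the real-multilinear maps
`(ω₁, …, ω_p, v₁, …, v_q) ↦ α(ω₁, …, ω_p)(v₁, …, v_q) ∈ ℂ` of `p` covectors and `q` vectors. -/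
abbrev CTensor (p q : ℕ) (V : Type*) [AddCommGroup V] [Module ℝ V] [TopologicalSpace V]
    [IsTopologicalAddGroup V] [ContinuousSMul ℝ V] : Type _ :=
  ContinuousMultilinearMap ℝ (fun _ : Fin p => V →L[ℝ] ℝ)
    (ContinuousMultilinearMap ℝ (fun _ : Fin q => V) ℂ)

namespace CTensor

/-- The pull-back of a tensor under an invertible linear map `B : V → V'`:
`(B^* α)(ω₁, …, ω_p, v₁, …, v_q) = α(ω₁ ∘ B⁻¹, …, ω_p ∘ B⁻¹, B v₁, …, B v_q)`. -/
def pullback {p q : ℕ}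
    {V : Type*} [AddCommGroup V] [Module ℝ V] [TopologicalSpace V]
    [IsTopologicalAddGroup V] [ContinuousSMul ℝ V]
    {V' : Type*} [AddCommGroup V'] [Module ℝ V'] [TopologicalSpace V']
    [IsTopologicalAddGroup V'] [ContinuousSMul ℝ V']
    (B : V →L[ℝ] V') (α : CTensor p q V') : CTensor p q V :=
  ((ContinuousMultilinearMap.compContinuousLinearMapL (fun _ : Fin q => B)
      ).compContinuousMultilinearMap α).compContinuousLinearMap
    (fun _ => ContinuousLinearMap.precomp ℝ B.inverse)

variable {p q : ℕ} {E : Type*} [NormedAddCommGroup E] [NormedSpace ℝ E]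

/-- The tensor `(ω, v) ↦ α(ω₁, …, ω_i ∘ L, …, ω_p, v₁, …, v_q)`. -/
def actCovector (L : E →L[ℝ] E) (i : Fin p) (α : CTensor p q E) : CTensor p q E :=
  α.compContinuousLinearMap
    (Function.update (fun _ => ContinuousLinearMap.id ℝ (E →L[ℝ] ℝ)) i
      (ContinuousLinearMap.precomp ℝ L))

/-- The tensor `(ω, v) ↦ α(ω₁, …, ω_p, v₁, …, L v_j, …, v_q)`. -/
def actVector (L : E →L[ℝ] E) (j : Fin q) (α : CTensor p q E) : CTensor p q E :=
  (ContinuousMultilinearMap.compContinuousLinearMapL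
    (Function.update (fun _ => ContinuousLinearMap.id ℝ E) j L)
    ).compContinuousMultilinearMap α

/-- The Lie derivative of a complex tensor field `A` along a real vector field `X` in linear
coordinates:
`(𝓛_X A)(ω, v) = (∂_X A)(ω, v) - ∑ i, A(…, ω_i ∘ DX, …, v) + ∑ j, A(ω, …, DX v_j, …)`. -/
def lieFlat (X : E → E) (A : E → CTensor p q E) (y : E) : CTensor p q E :=
  fderiv ℝ A y (X y)
    - ∑ i : Fin p, actCovector (fderiv ℝ X y) i (A y)
    + ∑ j : Fin q, actVector (fderiv ℝ X y) j (A y)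

end CTensor

/-- The real part of an element of the complexification `ℂ ⊗ V`, for `V` a real vector space. -/
def complexifiedRe {V : Type*} [AddCommGroup V] [Module ℝ V] (z : ℂ ⊗[ℝ] V) : V :=
  TensorProduct.lid ℝ V (LinearMap.rTensor V Complex.reLm z)

/-- The imaginary part of an element of the complexification `ℂ ⊗ V`. -/
def complexifiedIm {V : Type*} [AddCommGroup V] [Module ℝ V] (z : ℂ ⊗[ℝ] V) : V :=
  TensorProduct.lid ℝ V (LinearMap.rTensor V Complex.imLm z)

section Manifold

variable {p q : ℕ} {E : Type*} [NormedAddCommGroup E] [NormedSpace ℝ E]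
  {M : Type*} [TopologicalSpace M] [ChartedSpace E M]

/-- The part of the coordinate domain of the chart at `c` that corresponds to `U ⊆ M`. -/
def chartPart (E : Type*) [NormedAddCommGroup E] [NormedSpace ℝ E]
    {M : Type*} [TopologicalSpace M] [ChartedSpace E M] (c : M) (U : Set M) : Set E :=
  (extChartAt 𝓘(ℝ, E) c).target ∩ (extChartAt 𝓘(ℝ, E) c).symm ⁻¹' U

/-- The expression of a real vector field in the chart at `c`. -/
def vectorInChart (c : M) (X : (x : M) → TangentSpace 𝓘(ℝ, E) x) : E → E :=
  VectorField.mpullback 𝓘(ℝ, E) 𝓘(ℝ, E) (extChartAt 𝓘(ℝ, E) c).symm X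

/-- The expression of a complex vector field in the chart at `c`, as the pair of its
real and imaginary parts. -/
def complexVectorInChart (c : M) (Z : (x : M) → ℂ ⊗[ℝ] TangentSpace 𝓘(ℝ, E) x) : E → E × E :=
  fun y => (vectorInChart c (fun x => complexifiedRe (Z x)) y,
    vectorInChart c (fun x => complexifiedIm (Z x)) y)

/-- The expression of a complex tensor field in the chart at `c`. -/
def tensorInChart (c : M) (α : (x : M) → CTensor p q (TangentSpace 𝓘(ℝ, E) x)) :
    E → CTensor p q E :=
  fun y => CTensor.pullback
    (mfderiv 𝓘(ℝ, E) 𝓘(ℝ, E) (extChartAt 𝓘(ℝ, E) c).symm y :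
      E →L[ℝ] TangentSpace 𝓘(ℝ, E) ((extChartAt 𝓘(ℝ, E) c).symm y))
    (α ((extChartAt 𝓘(ℝ, E) c).symm y))

/-- The Lie derivative of a complex tensor field along a real vector field, computed at each
point `x` in the chart at `x`. -/
def realLieDerivative (X : (x : M) → TangentSpace 𝓘(ℝ, E) x)
    (α : (x : M) → CTensor p q (TangentSpace 𝓘(ℝ, E) x)) (x : M) :
    CTensor p q (TangentSpace 𝓘(ℝ, E) x) :=
  CTensor.pullback (mfderiv 𝓘(ℝ, E) 𝓘(ℝ, E) (extChartAt 𝓘(ℝ, E) x) x)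
    (CTensor.lieFlat (E := E) (vectorInChart x X) (tensorInChart x α) (extChartAt 𝓘(ℝ, E) x x))

/-- The complex Lie derivative: the `ℂ`-bilinear extension
`𝓛_Z α = 𝓛_{Re Z} α + i 𝓛_{Im Z} α` of the Lie derivative. -/
def complexLieDerivative (Z : (x : M) → ℂ ⊗[ℝ] TangentSpace 𝓘(ℝ, E) x)
    (α : (x : M) → CTensor p q (TangentSpace 𝓘(ℝ, E) x)) (x : M) :
    CTensor p q (TangentSpace 𝓘(ℝ, E) x) :=
  realLieDerivative (fun x => complexifiedRe (Z x)) α x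
    + Complex.I • realLieDerivative (fun x => complexifiedIm (Z x)) α x

/-- A complex tensor field is real analytic on `U`. -/
def IsAnalyticTensorOn (α : (x : M) → CTensor p q (TangentSpace 𝓘(ℝ, E) x)) (U : Set M) : Prop :=
  ∀ c : M, AnalyticOn ℝ (tensorInChart c α) (chartPart E c U)

/-- Piecewise analyticity of a time-dependent object on `[0, T] × U` whose expression at time `t` in
the chart at `c` is `f c t`: there is a partition `0 = s 0 < ⋯ < s N = T` such that on each
`[s i, s (i + 1)) × U` the object coincides with one that is jointly real analytic in `(t, x)` on
`[s i, s (i + 1)] × U`, up to and including the end points (jumps are allowed at the `s i`). -/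
def IsPiecewiseAnalyticOn {F : Type*} [NormedAddCommGroup F] [NormedSpace ℝ F]
    (f : M → ℝ → E → F) (T : ℝ) (U : Set M) : Prop :=
  ∃ (N : ℕ) (s : Fin (N + 1) → ℝ), StrictMono s ∧ s 0 = 0 ∧ s (Fin.last N) = T ∧
    ∀ (i : Fin N) (c : M), ∃ g : ℝ × E → F,
      AnalyticOn ℝ g (Icc (s i.castSucc) (s i.succ) ×ˢ chartPart E c U) ∧
      ∀ t ∈ Ico (s i.castSucc) (s i.succ), ∀ y ∈ chartPart E c U, f c t y = g (t, y)

/-- `β` is, on `[0, T] × U`, a transport of `α` through the path `Z` of complex vector fields: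
a `C¹` solution of `∂β_t/∂t = 𝓛_{Z_t} β_t`, `β_0 = α`. -/
structure IsTransportOn (Z : ℝ → (x : M) → ℂ ⊗[ℝ] TangentSpace 𝓘(ℝ, E) x)
    (α : (x : M) → CTensor p q (TangentSpace 𝓘(ℝ, E) x)) (U : Set M) (T : ℝ)
    (β : ℝ → (x : M) → CTensor p q (TangentSpace 𝓘(ℝ, E) x)) : Prop where
  contDiffOn : ∀ c : M, ContDiffOn ℝ 1 (fun z : ℝ × E => tensorInChart c (β z.1) z.2)
    (Icc 0 T ×ˢ chartPart E c U)
  initial : ∀ x ∈ U, β 0 x = α x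
  equation : ∀ t ∈ Icc 0 T, ∀ x ∈ U,
    HasDerivWithinAt (fun s => β s x) (complexLieDerivative (Z t) (β t) x) (Icc 0 T) t

end Manifold

end

/-
In a chart the transport equation `∂β/∂t = 𝓛_{Z_t} β` is a linear first-order system with analytic
coefficients. It has an analytic solution near every point by the Cauchy–Kovalevskaya theorem, which
is proved by the method of majorants: the time Taylor coefficients of the solution are computed
recursively, and a geometric majorant of the initial datum propagates through the recursion. The
existence time depends only on the coefficients and on the ratio of this majorant, not on its size.

Uniqueness among `C¹` solutions is Holmgren's argument. A solution with vanishing initial datum,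
extended by `0` to the past, acquires compact support in space when space-time is sheared by a
paraboloid. It is then orthogonal to every entire function, as one sees by pairing it with the
analytic solution of the adjoint problem which has this function as its final datum: entire data
have Taylor coefficients decaying faster than every geometric sequence, so all these adjoint
solutions exist for the same time. Entire functions are dense by the Stone–Weierstrass theorem.

The equation does not depend on the chart since the Lie derivative does not. On a compact manifold
finitely many local solutions have a common existence time, and agree on overlaps: local uniqueness
gives agreement for a short time, and analyticity in time carries it to the end.
-/

noncomputable section

section Majorants

open PowerSeries (coeff C derivative)
open scoped Nat PowerSeries

variable {G G' F F₁ F₂ : Type*} [NormedAddCommGroup G] [NormedSpace ℝ G]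
  [NormedAddCommGroup G'] [NormedSpace ℝ G'] [NormedAddCommGroup F] [NormedSpace ℝ F]
  [NormedAddCommGroup F₁] [NormedSpace ℝ F₁] [NormedAddCommGroup F₂] [NormedSpace ℝ F₂]

/-- The geometric power series `1 / (1 - R X)`, the model for all majorants used here. -/
def geomPowerSeries (R : ℝ) : ℝ⟦X⟧ := PowerSeries.mk fun m => R ^ m

theorem geomPowerSeries_eq_rescale (R : ℝ) :
    geomPowerSeries R = PowerSeries.rescale R (PowerSeries.mk 1) := by
  simp [geomPowerSeries, PowerSeries.rescale_mk]

theorem coeff_geomPowerSeries (R : ℝ) (m : ℕ) : coeff m (geomPowerSeries R) = R ^ m :=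
  PowerSeries.coeff_mk m _

theorem coeff_geomPowerSeries_pow_succ (R : ℝ) (d m : ℕ) :
    coeff m (geomPowerSeries R ^ (d + 1)) = (d + m).choose d * R ^ m := by
  rw [geomPowerSeries_eq_rescale, ← map_pow, PowerSeries.mk_one_pow_eq_mk_choose_add,
    PowerSeries.coeff_rescale, PowerSeries.coeff_mk, mul_comm]

theorem coeff_geomPowerSeries_pow_succ_le {R : ℝ} (hR : 0 ≤ R) (d m : ℕ) :
    coeff m (geomPowerSeries R ^ (d + 1)) ≤ 2 ^ d * (2 * R) ^ m := by
  rw [coeff_geomPowerSeries_pow_succ, mul_pow, ← mul_assoc, ← pow_add]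
  gcongr
  exact_mod_cast Nat.choose_le_two_pow (d + m) d

theorem derivative_geomPowerSeries_pow_succ (R : ℝ) (d : ℕ) :
    derivative ℝ (geomPowerSeries R ^ (d + 1)) = C ((d + 1) * R) * geomPowerSeries R ^ (d + 2) := by
  ext m
  have hchoose : ((d + (m + 1)).choose d * (m + 1) : ℝ) = (d + 1 + m).choose (d + 1) * (d + 1) := by
    have := Nat.choose_succ_right_eq (d + 1 + m) d
    rw [show d + 1 + m - d = m + 1 by omega] at this
    rw [show d + (m + 1) = d + 1 + m by ring]
    exact_mod_cast this.symm
  rw [PowerSeries.coeff_derivative, PowerSeries.coeff_C_mul, coeff_geomPowerSeries_pow_succ,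
    coeff_geomPowerSeries_pow_succ]
  linear_combination R ^ (m + 1) * hchoose

/-- On `S`, the function `f` is real analytic and its Taylor coefficients at every point are
bounded by the coefficients of the power series `a`, in the sense that `‖Dᵐf‖ ≤ m! aₘ`. -/
structure IsMajorizedOn (S : Set G) (f : G → F) (a : ℝ⟦X⟧) : Prop where
  analyticOnNhd : AnalyticOnNhd ℝ f S
  norm_iteratedFDeriv_le : ∀ x ∈ S, ∀ m : ℕ, ‖iteratedFDeriv ℝ m f x‖ ≤ m ! * coeff m a

namespace IsMajorizedOn

variable {S S' : Set G} {f : G → F} {a b : ℝ⟦X⟧}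

theorem mono_set (h : IsMajorizedOn S f a) (hS : S' ⊆ S) : IsMajorizedOn S' f a :=
  ⟨h.1.mono hS, fun x hx => h.2 x (hS hx)⟩

theorem mono (h : IsMajorizedOn S f a) (hab : ∀ m, coeff m a ≤ coeff m b) :
    IsMajorizedOn S f b :=
  ⟨h.1, fun x hx m => (h.2 x hx m).trans (by gcongr; exact hab m)⟩

theorem mono_geom {K K' R R' : ℝ} (h : IsMajorizedOn S f (C K * geomPowerSeries R))
    (hK' : 0 ≤ K') (hR : 0 ≤ R) (hKK' : K ≤ K') (hRR' : R ≤ R') :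
    IsMajorizedOn S f (C K' * geomPowerSeries R') :=
  h.mono fun m => by
    simp only [PowerSeries.coeff_C_mul, coeff_geomPowerSeries]
    gcongr

theorem mono_geom_pow {K R R' : ℝ} {d : ℕ}
    (h : IsMajorizedOn S f (C K * geomPowerSeries R ^ (d + 1))) (hK : 0 ≤ K) (hR : 0 ≤ R)
    (hRR' : R ≤ R') : IsMajorizedOn S f (C K * geomPowerSeries R' ^ (d + 1)) :=
  h.mono fun m => by
    simp only [PowerSeries.coeff_C_mul, coeff_geomPowerSeries_pow_succ]
    gcongr

theorem coeff_nonneg (h : IsMajorizedOn S f a) {x : G} (hx : x ∈ S) (m : ℕ) : 0 ≤ coeff m a :=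
  nonneg_of_mul_nonneg_right ((norm_nonneg _).trans (h.2 x hx m)) (by positivity)

theorem norm_le (h : IsMajorizedOn S f a) {x : G} (hx : x ∈ S) : ‖f x‖ ≤ coeff 0 a := by
  simpa [norm_iteratedFDeriv_zero] using h.2 x hx 0

theorem norm_fderiv_le (h : IsMajorizedOn S f a) {x : G} (hx : x ∈ S) :
    ‖fderiv ℝ f x‖ ≤ coeff 1 a := by
  simpa [norm_iteratedFDeriv_one] using h.2 x hx 1

theorem norm_le_geom {K R : ℝ} (h : IsMajorizedOn S f (C K * geomPowerSeries R)) {x : G}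
    (hx : x ∈ S) : ‖f x‖ ≤ K := by
  simpa only [PowerSeries.coeff_C_mul, coeff_geomPowerSeries, pow_zero, mul_one] using h.norm_le hx

theorem norm_fderiv_le_geom {K R : ℝ} (h : IsMajorizedOn S f (C K * geomPowerSeries R)) {x : G}
    (hx : x ∈ S) : ‖fderiv ℝ f x‖ ≤ K * R := by
  simpa only [PowerSeries.coeff_C_mul, coeff_geomPowerSeries, pow_one] using h.norm_fderiv_le hx

theorem const (c : F) : IsMajorizedOn S (fun _ => c) (C ‖c‖) := by
  refine ⟨fun _ _ => analyticAt_const, fun x _ m => ?_⟩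
  rcases m with _ | m
  · simp
  · simp [iteratedFDeriv_const_of_ne (Nat.succ_ne_zero m)]

theorem clm (L : G →L[ℝ] F) {c d : ℝ} (hc : ∀ x ∈ S, ‖L x‖ ≤ c) (hd : ‖L‖ ≤ d) :
    IsMajorizedOn S L (C c + C d * PowerSeries.X) := by
  refine ⟨fun x _ => L.analyticAt x, fun x hx m => ?_⟩
  rcases m with _ | m
  · simpa using hc x hx
  rw [← norm_iteratedFDeriv_fderiv, show fderiv ℝ L = fun _ => L from funext fun _ => L.fderiv]
  rcases m with _ | m
  · simpa using hd
  · simp [iteratedFDeriv_const_of_ne (Nat.succ_ne_zero m)]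

theorem clm_geom (L : G →L[ℝ] F) {c R : ℝ} (hR : 0 ≤ R) (hc : ∀ x ∈ S, ‖L x‖ ≤ c)
    (hL : ‖L‖ ≤ c * R) (hc0 : 0 ≤ c) : IsMajorizedOn S L (C c * geomPowerSeries R) :=
  (clm L hc hL).mono fun m => by
    rw [map_add, PowerSeries.coeff_C_mul, PowerSeries.coeff_C_mul, coeff_geomPowerSeries]
    rcases m with _ | _ | m
    · simp
    · simp
    · simp only [PowerSeries.coeff_C, PowerSeries.coeff_X, Nat.add_eq_zero_iff, one_ne_zero,
        and_false, if_false, Nat.add_eq_right, add_zero, mul_zero]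
      positivity

theorem add [CompleteSpace F] {g : G → F} (hf : IsMajorizedOn S f a) (hg : IsMajorizedOn S g b) :
    IsMajorizedOn S (fun x => f x + g x) (a + b) := by
  refine ⟨hf.1.add hg.1, fun x hx m => ?_⟩
  have hadd : iteratedFDeriv ℝ m (fun x => f x + g x) x
      = iteratedFDeriv ℝ m f x + iteratedFDeriv ℝ m g x :=
    iteratedFDeriv_add_apply (hf.1 x hx).contDiffAt (hg.1 x hx).contDiffAt
  rw [hadd, map_add, mul_add]
  exact (norm_add_le _ _).trans (add_le_add (hf.2 x hx m) (hg.2 x hx m))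

theorem const_smul [CompleteSpace F] (c : ℝ) (hf : IsMajorizedOn S f a) :
    IsMajorizedOn S (fun x => c • f x) (C |c| * a) := by
  refine ⟨fun x hx => (hf.1 x hx).const_smul, fun x hx m => ?_⟩
  have hsmul : iteratedFDeriv ℝ m (fun x => c • f x) x = c • iteratedFDeriv ℝ m f x :=
    iteratedFDeriv_const_smul_apply (hf.1 x hx).contDiffAt
  rw [hsmul, norm_smul, PowerSeries.coeff_C_mul, Real.norm_eq_abs, mul_left_comm]
  gcongr
  exact hf.2 x hx m

theorem clm_comp [CompleteSpace F] (L : F →L[ℝ] F₁) (hf : IsMajorizedOn S f a) :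
    IsMajorizedOn S (fun x => L (f x)) (C ‖L‖ * a) := by
  refine ⟨L.comp_analyticOnNhd hf.1, fun x hx m => ?_⟩
  rw [PowerSeries.coeff_C_mul, mul_left_comm]
  refine (L.norm_iteratedFDeriv_comp_left (hf.1 x hx).contDiffAt le_top).trans ?_
  gcongr
  exact hf.2 x hx m

theorem comp_clm (hS : IsOpen S) (L : G' →L[ℝ] G) (hL : ‖L‖ ≤ 1) (hf : IsMajorizedOn S f a) :
    IsMajorizedOn (L ⁻¹' S) (fun x => f (L x)) a := by
  refine ⟨fun x hx => (hf.1 _ hx).comp (L.analyticAt x), fun x hx m => ?_⟩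
  have hS' : IsOpen (L ⁻¹' S) := hS.preimage L.continuous
  have hcomp := L.iteratedFDerivWithin_comp_right (n := ω) (i := m)
    (hf.1.contDiffOn hS.uniqueDiffOn) hS.uniqueDiffOn hS'.uniqueDiffOn hx le_top
  rw [iteratedFDerivWithin_of_isOpen _ hS hx, iteratedFDerivWithin_of_isOpen _ hS' hx] at hcomp
  calc ‖iteratedFDeriv ℝ m (f ∘ L) x‖
      ≤ ‖iteratedFDeriv ℝ m f (L x)‖ * ∏ _i : Fin m, ‖L‖ := by
        rw [hcomp]; exact ContinuousMultilinearMap.norm_compContinuousLinearMap_le _ _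
    _ ≤ ‖iteratedFDeriv ℝ m f (L x)‖ :=
        mul_le_of_le_one_right (norm_nonneg _) (by simpa using pow_le_one₀ (norm_nonneg _) hL)
    _ ≤ m ! * coeff m a := hf.2 _ hx m

theorem bilinear [CompleteSpace F] (hS : IsOpen S) (B : F →L[ℝ] F₁ →L[ℝ] F₂) (hB : ‖B‖ ≤ 1)
    {g : G → F₁} (hf : IsMajorizedOn S f a) (hg : IsMajorizedOn S g b) :
    IsMajorizedOn S (fun x => B (f x) (g x)) (a * b) := by
  refine ⟨fun x hx => (B.analyticAt_bilinear _).comp₂ (hf.1 x hx) (hg.1 x hx), fun x hx m => ?_⟩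
  have hleibniz := B.norm_iteratedFDerivWithin_le_of_bilinear_of_le_one (N := ω) (n := m)
    (hf.1.contDiffOn hS.uniqueDiffOn) (hg.1.contDiffOn hS.uniqueDiffOn)
    hS.uniqueDiffOn hx le_top hB
  simp only [iteratedFDerivWithin_of_isOpen _ hS hx] at hleibniz
  refine hleibniz.trans ?_
  rw [PowerSeries.coeff_mul, Finset.Nat.sum_antidiagonal_eq_sum_range_succ_mk, Finset.mul_sum]
  refine Finset.sum_le_sum fun i hi => ?_
  have hchoose : ((m.choose i : ℝ)) * i ! * (m - i)! = m ! := by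
    exact_mod_cast Nat.choose_mul_factorial_mul_factorial
      (Nat.lt_succ_iff.1 (Finset.mem_range.1 hi))
  have ha : 0 ≤ coeff i a := hf.coeff_nonneg hx i
  calc _ ≤ (m.choose i : ℝ) * (i ! * coeff i a) * ((m - i)! * coeff (m - i) b) := by
        gcongr
        · exact hf.2 x hx i
        · exact hg.2 x hx _
    _ = (m.choose i : ℝ) * i ! * (m - i)! * (coeff i a * coeff (m - i) b) := by ring
    _ = _ := by rw [hchoose]

theorem clm_apply [CompleteSpace F₂] (hS : IsOpen S) {L : G → F₁ →L[ℝ] F₂} {g : G → F₁}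
    (hL : IsMajorizedOn S L a) (hg : IsMajorizedOn S g b) :
    IsMajorizedOn S (fun x => L x (g x)) (a * b) :=
  bilinear hS (ContinuousLinearMap.id ℝ (F₁ →L[ℝ] F₂)) ContinuousLinearMap.norm_id_le hL hg

theorem mul {g h : G → ℝ} (hS : IsOpen S) (hg : IsMajorizedOn S g a) (hh : IsMajorizedOn S h b) :
    IsMajorizedOn S (fun x => g x * h x) (a * b) :=
  bilinear hS (ContinuousLinearMap.mul ℝ ℝ) (ContinuousLinearMap.opNorm_mul_le ℝ ℝ) hg hh

theorem smul {g : G → ℝ} (hS : IsOpen S) (hg : IsMajorizedOn S g a) (hf : IsMajorizedOn S f b) :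
    IsMajorizedOn S (fun x => g x • f x) (a * b) :=
  bilinear hS (ContinuousLinearMap.lsmul ℝ ℝ) ContinuousLinearMap.opNorm_lsmul_le hg hf

theorem pow {g : G → ℝ} (hS : IsOpen S) (hg : IsMajorizedOn S g a) (k : ℕ) :
    IsMajorizedOn S (fun x => g x ^ k) (a ^ k) := by
  induction k with
  | zero => simpa using const (S := S) (G := G) (1 : ℝ)
  | succ k ih => simpa only [pow_succ] using ih.mul hS hg

theorem fderiv [CompleteSpace F] (hf : IsMajorizedOn S f a) :
    IsMajorizedOn S (fderiv ℝ f) (derivative ℝ a) := by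
  refine ⟨hf.1.fderiv, fun x hx m => ?_⟩
  rw [norm_iteratedFDeriv_fderiv, PowerSeries.coeff_derivative]
  refine (hf.2 x hx (m + 1)).trans (le_of_eq ?_)
  rw [Nat.factorial_succ]
  push_cast
  ring

end IsMajorizedOn

end Majorants

section TaylorSeries

open PowerSeries (coeff C)
open scoped Nat NNReal ENNReal

variable {G F : Type*} [NormedAddCommGroup G] [NormedSpace ℝ G] [NormedAddCommGroup F]
  [NormedSpace ℝ F] {f : G → F} {x : G}

theorem norm_iteratedFDeriv_le_of_hasFPowerSeriesOnBall [CompleteSpace F]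
    {p : FormalMultilinearSeries ℝ G F} {r : ℝ≥0∞} (h : HasFPowerSeriesOnBall f p x r) (m : ℕ) :
    ‖iteratedFDeriv ℝ m f x‖ ≤ m ! * ‖p m‖ := by
  refine ContinuousMultilinearMap.opNorm_le_bound (by positivity) fun v => ?_
  rw [h.iteratedFDeriv_eq_sum_of_completeSpace]
  calc _ ≤ ∑ _τ : Equiv.Perm (Fin m), ‖p m‖ * ∏ i, ‖v i‖ := by
        refine norm_sum_le_of_le _ fun τ _ => ((p m).le_opNorm _).trans_eq ?_
        rw [Equiv.prod_comp τ fun i => ‖v i‖]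
    _ = m ! * ‖p m‖ * ∏ i, ‖v i‖ := by
        rw [Finset.sum_const, Finset.card_univ, Fintype.card_perm, Fintype.card_fin, nsmul_eq_mul,
          mul_assoc]

theorem exists_norm_changeOrigin_mul_pow_le (p : FormalMultilinearSeries ℝ G F) {r : ℝ≥0}
    (hr : (r + r : ℝ≥0∞) < p.radius) :
    ∃ K : ℝ, ∀ y : G, ‖y‖₊ ≤ r → ∀ m, ‖p.changeOrigin y m‖ * r ^ m ≤ K := by
  have hsum := p.changeOriginSeries_summable_aux₁ hr
  refine ⟨((∑' s : Σ k l : ℕ, { s : Finset (Fin (k + l)) // s.card = l },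
    ‖p (s.1 + s.2.1)‖₊ * r ^ s.2.1 * r ^ s.1 : ℝ≥0) : ℝ), fun y hy m => ?_⟩
  have hyr : (‖y‖₊ : ℝ≥0∞) < p.radius :=
    ((ENNReal.coe_le_coe.2 hy).trans le_self_add).trans_lt hr
  have hsum_m := (NNReal.summable_sigma.1 hsum).1 m
  have hrow : (∑' s : Σ l : ℕ, { s : Finset (Fin (m + l)) // s.card = l },
      ‖p (m + s.1)‖₊ * ‖y‖₊ ^ s.1) * r ^ m
      ≤ ∑' s : Σ l : ℕ, { s : Finset (Fin (m + l)) // s.card = l },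
        ‖p (m + s.1)‖₊ * r ^ s.1 * r ^ m := by
    rw [← NNReal.tsum_mul_right]
    exact Summable.tsum_le_tsum (fun s => by gcongr)
      (NNReal.summable_of_le (fun s => by gcongr) hsum_m) hsum_m
  have htotal : ∑' s : Σ l : ℕ, { s : Finset (Fin (m + l)) // s.card = l },
        ‖p (m + s.1)‖₊ * r ^ s.1 * r ^ m ≤
      ∑' s : Σ k l : ℕ, { s : Finset (Fin (k + l)) // s.card = l },
        ‖p (s.1 + s.2.1)‖₊ * r ^ s.2.1 * r ^ s.1 := by
    rw [hsum.tsum_sigma' (NNReal.summable_sigma.1 hsum).1]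
    exact (NNReal.summable_sigma.1 hsum).2.le_tsum m (fun _ _ => zero_le)
  have hle : ‖p.changeOrigin y m‖₊ * r ^ m ≤ _ :=
    le_trans (by gcongr; exact p.nnnorm_changeOrigin_le m hyr) (hrow.trans htotal)
  exact_mod_cast hle

theorem exists_isMajorizedOn_ball_of_analyticAt [CompleteSpace F] (hf : AnalyticAt ℝ f x) :
    ∃ r > 0, ∃ R > 0, ∃ K > 0,
      IsMajorizedOn (Metric.ball x r) f (C K * geomPowerSeries R) := by
  obtain ⟨p, ρ, hp⟩ := hf
  obtain ⟨r, hr0, hr⟩ : ∃ r : ℝ≥0, 0 < r ∧ (r + r : ℝ≥0∞) < ρ := by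
    obtain ⟨s, hs0, hs⟩ := ENNReal.lt_iff_exists_nnreal_btwn.1 hp.r_pos
    refine ⟨s / 2, by simpa using hs0, ?_⟩
    rwa [← ENNReal.coe_add, add_halves]
  obtain ⟨K, hK⟩ := exists_norm_changeOrigin_mul_pow_le p (hr.trans_le hp.r_le)
  have hrpos : (0 : ℝ) < r := hr0
  have hrρ : (r : ℝ≥0∞) < ρ := le_self_add.trans_lt hr
  refine ⟨r, hrpos, (r : ℝ)⁻¹, by positivity, max K 1, by positivity,
    hp.analyticOnNhd.mono ?_, fun y hy m => ?_⟩
  · rw [← Metric.eball_coe]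
    exact Metric.eball_subset_eball hrρ.le
  · have hyr : ‖y - x‖₊ < r := by
      rw [mem_ball_iff_norm] at hy
      exact_mod_cast hy
    have hy' := norm_iteratedFDeriv_le_of_hasFPowerSeriesOnBall
      (hp.changeOrigin ((ENNReal.coe_lt_coe.2 hyr).trans hrρ)) m
    rw [add_sub_cancel] at hy'
    refine hy'.trans ?_
    rw [PowerSeries.coeff_C_mul, coeff_geomPowerSeries]
    gcongr
    rw [inv_pow, ← div_eq_mul_inv, le_div_iff₀ (by positivity)]
    exact (hK _ hyr.le m).trans (le_max_left _ _)

/-- The Taylor series of `f` at `x`, as a formal multilinear series: Mathlib's `ftaylorSeries` is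
the family of the derivatives of `f`, without the factors `1 / m!`. -/
def scaledTaylorSeries (f : G → F) (x : G) : FormalMultilinearSeries ℝ G F :=
  fun m => (m ! : ℝ)⁻¹ • iteratedFDeriv ℝ m f x

theorem norm_scaledTaylorSeries (f : G → F) (x : G) (m : ℕ) :
    ‖scaledTaylorSeries f x m‖ = (m ! : ℝ)⁻¹ * ‖iteratedFDeriv ℝ m f x‖ := by
  rw [scaledTaylorSeries, norm_smul, norm_inv, Real.norm_natCast]

theorem hasFPowerSeriesAt_scaledTaylorSeries [CompleteSpace F] (hf : AnalyticAt ℝ f x) :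
    HasFPowerSeriesAt f (scaledTaylorSeries f x) x := by
  obtain ⟨p, r, hp⟩ := hf
  refine ⟨r, hp.r_le.trans (FormalMultilinearSeries.radius_le_of_le fun m => ?_), hp.r_pos,
    fun hy => hp.hasSum_iteratedFDeriv hy⟩
  rw [norm_scaledTaylorSeries, inv_mul_le_iff₀ (by positivity)]
  exact norm_iteratedFDeriv_le_of_hasFPowerSeriesOnBall hp m

theorem hasFPowerSeriesOnBall_of_le_radius [CompleteSpace F]
    {p : FormalMultilinearSeries ℝ G F} {r : ℝ} (hr : 0 < r)
    (hf : AnalyticOnNhd ℝ f (Metric.ball x r)) (hp : HasFPowerSeriesAt f p x)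
    (hpr : ENNReal.ofReal r ≤ p.radius) : HasFPowerSeriesOnBall f p x (ENNReal.ofReal r) := by
  have hr' : 0 < ENNReal.ofReal r := ENNReal.ofReal_pos.2 hr
  have hsum : HasFPowerSeriesOnBall (fun y => p.sum (y - x)) p x (ENNReal.ofReal r) := by
    simpa using ((p.hasFPowerSeriesOnBall (hr'.trans_le hpr)).mono hr' hpr).comp_sub x
  have hball : Metric.eball x (ENNReal.ofReal r) = Metric.ball x r := Metric.eball_ofReal
  have hnear : (fun y => p.sum (y - x)) =ᶠ[nhds x] f := by
    filter_upwards [hsum.hasFPowerSeriesAt.eventually_hasSum_sub, hp.eventually_hasSum_sub]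
      with y h₁ h₂ using h₁.unique h₂
  exact hsum.congr (hball ▸ AnalyticOnNhd.eqOn_of_preconnected_of_eventuallyEq
    (hball ▸ hsum.analyticOnNhd) hf (convex_ball x r).isPreconnected (Metric.mem_ball_self hr)
    hnear)

end TaylorSeries

section MajorizedSeries

open PowerSeries (C)
open scoped Nat

variable {G F : Type*} [NormedAddCommGroup G] [NormedSpace ℝ G] [NormedAddCommGroup F]
  [NormedSpace ℝ F] {S : Set G} {x : G} {u : ℕ → ℝ} {R : ℝ}

theorem ofReal_le_radius_tsum {p : ℕ → FormalMultilinearSeries ℝ G F} {r : ℝ} (hr : 0 < r)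
    (hrR : r * R ≤ 1) (hR : 0 ≤ R) (hu : Summable u) (hp : ∀ k m, ‖p k m‖ ≤ u k * R ^ m) :
    ENNReal.ofReal r ≤
      FormalMultilinearSeries.radius (𝕜 := ℝ) (E := G) (F := F) fun m => ∑' k, p k m := by
  have hu0 : ∀ k, 0 ≤ u k := fun k => by simpa using (norm_nonneg _).trans (hp k 0)
  refine FormalMultilinearSeries.le_radius_of_bound (r := r.toNNReal) _ (∑' k, u k) fun m => ?_
  rw [Real.coe_toNNReal _ hr.le]
  calc _ ≤ (∑' k, u k) * R ^ m * r ^ m := by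
        gcongr
        rw [← tsum_mul_right]
        exact tsum_of_norm_bounded (hu.mul_right (R ^ m)).hasSum fun k => hp k m
    _ = (∑' k, u k) * (r * R) ^ m := by rw [mul_pow]; ring
    _ ≤ ∑' k, u k :=
        mul_le_of_le_one_right (tsum_nonneg hu0) (pow_le_one₀ (by positivity) hrR)

theorem hasFPowerSeriesOnBall_tsum [CompleteSpace F] {f : ℕ → G → F}
    {p : ℕ → FormalMultilinearSeries ℝ G F} {r : ℝ} (hr : 0 < r) (hrR : r * R < 1) (hR : 0 ≤ R)
    (hf : ∀ k, HasFPowerSeriesOnBall (f k) (p k) x (ENNReal.ofReal r))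
    (hu : Summable u) (hp : ∀ k m, ‖p k m‖ ≤ u k * R ^ m) :
    HasFPowerSeriesOnBall (fun y => ∑' k, f k y) (fun m => ∑' k, p k m) x (ENNReal.ofReal r) := by
  have hu0 : ∀ k, 0 ≤ u k := fun k => by simpa using (norm_nonneg _).trans (hp k 0)
  refine ⟨ofReal_le_radius_tsum hr hrR.le hR hu hp, ENNReal.ofReal_pos.2 hr, fun {y} hy => ?_⟩
  have hy' : ‖y‖ < r := by
    rwa [Metric.eball_ofReal, mem_ball_zero_iff] at hy
  have hterm : ∀ k m, ‖p k m fun _ => y‖ ≤ u k * (r * R) ^ m := fun k m => by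
    calc _ ≤ ‖p k m‖ * ‖y‖ ^ m := by
          simpa using (p k m).le_opNorm fun _ => y
      _ ≤ u k * R ^ m * r ^ m := by
          gcongr
          · exact mul_nonneg (hu0 k) (by positivity)
          · exact hp k m
      _ = _ := by rw [mul_pow]; ring
  have hsum : Summable fun z : ℕ × ℕ => p z.1 z.2 fun _ => y :=
    Summable.of_norm_bounded (hu.mul_of_nonneg
      (summable_geometric_of_lt_one (by positivity) hrR) hu0 fun m => by positivity)
      fun z => hterm z.1 z.2
  have hdouble : HasSum (fun z : ℕ × ℕ => p z.1 z.2 fun _ => y) (∑' k, f k (x + y)) := by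
    rw [(hsum.hasSum.prod_fiberwise fun k => (hf k).hasSum hy).tsum_eq]
    exact hsum.hasSum
  refine ((Equiv.prodComm ℕ ℕ).hasSum_iff.2 hdouble).prod_fiberwise fun m => ?_
  exact (ContinuousMultilinearMap.apply ℝ (fun _ : Fin m => G) F fun _ => y).hasSum
    (Summable.of_norm_bounded (hu.mul_right (R ^ m)) fun k => hp k m).hasSum

namespace IsMajorizedOn

variable {f : ℕ → G → F}

theorem norm_scaledTaylorSeries_le {f : G → F} {c : ℝ}
    (hf : IsMajorizedOn S f (C c * geomPowerSeries R)) (hx : x ∈ S) (m : ℕ) :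
    ‖scaledTaylorSeries f x m‖ ≤ c * R ^ m := by
  rw [norm_scaledTaylorSeries, inv_mul_le_iff₀ (by positivity)]
  simpa only [PowerSeries.coeff_C_mul, coeff_geomPowerSeries] using hf.2 x hx m

variable [CompleteSpace F]

theorem hasFPowerSeriesOnBall {f : G → F} {c r : ℝ}
    (hf : IsMajorizedOn S f (C c * geomPowerSeries R)) (hr : 0 < r) (hR : 0 ≤ R) (hrR : r * R ≤ 1)
    (hS : Metric.ball x r ⊆ S) :
    HasFPowerSeriesOnBall f (scaledTaylorSeries f x) x (ENNReal.ofReal r) := by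
  have hx : x ∈ S := hS (Metric.mem_ball_self hr)
  have hc : 0 ≤ c := by simpa using (norm_nonneg _).trans (hf.norm_scaledTaylorSeries_le hx 0)
  refine hasFPowerSeriesOnBall_of_le_radius hr (hf.1.mono hS)
    (hasFPowerSeriesAt_scaledTaylorSeries (hf.1 x hx))
    (FormalMultilinearSeries.le_radius_of_bound (r := r.toNNReal) _ c fun m => ?_)
  rw [Real.coe_toNNReal _ hr.le]
  calc _ ≤ c * R ^ m * r ^ m := by gcongr; exact hf.norm_scaledTaylorSeries_le hx m
    _ = c * (r * R) ^ m := by rw [mul_pow]; ring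
    _ ≤ c := mul_le_of_le_one_right hc (pow_le_one₀ (by positivity) hrR)

theorem analyticOnNhd_tsum (hS : IsOpen S) (hR : 0 ≤ R) (hu : Summable u)
    (hf : ∀ k, IsMajorizedOn S (f k) (C (u k) * geomPowerSeries R)) :
    AnalyticOnNhd ℝ (fun x => ∑' k, f k x) S := by
  intro x hx
  obtain ⟨ε, hε, hεS⟩ := Metric.isOpen_iff.1 hS x hx
  set r : ℝ := min ε (R + 1)⁻¹
  have hr : 0 < r := by positivity
  have hrR : r * R < 1 := by
    calc r * R ≤ (R + 1)⁻¹ * R := by gcongr; exact min_le_right _ _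
      _ < 1 := by rw [inv_mul_lt_iff₀ (by positivity)]; linarith
  exact (hasFPowerSeriesOnBall_tsum hr hrR hR
    (fun k => (hf k).hasFPowerSeriesOnBall hr hR hrR.le
      ((Metric.ball_subset_ball (min_le_left _ _)).trans hεS)) hu
    fun k m => (hf k).norm_scaledTaylorSeries_le hx m).analyticAt

theorem summable (hu : Summable u) (hf : ∀ k, IsMajorizedOn S (f k) (C (u k) * geomPowerSeries R))
    (hx : x ∈ S) : Summable fun k => f k x :=
  Summable.of_norm_bounded hu fun k => (hf k).norm_le_geom hx

theorem hasSum_fderiv (hS : IsOpen S) (hu : Summable u)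
    (hf : ∀ k, IsMajorizedOn S (f k) (C (u k) * geomPowerSeries R)) (hx : x ∈ S) :
    HasSum (fun k => _root_.fderiv ℝ (f k) x) (_root_.fderiv ℝ (fun y => ∑' k, f k y) x) := by
  obtain ⟨r, hr, hrS⟩ := Metric.isOpen_iff.1 hS x hx
  have hderiv : HasFDerivAt (fun y => ∑' k, f k y) (∑' k, _root_.fderiv ℝ (f k) x) x :=
    hasFDerivAt_tsum_of_isPreconnected (hu.mul_right R) Metric.isOpen_ball
      (convex_ball x r).isPreconnected
      (fun k y hy => ((hf k).1 y (hrS hy)).differentiableAt.hasFDerivAt)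
      (fun k y hy => (hf k).norm_fderiv_le_geom (hrS hy)) (Metric.mem_ball_self hr)
      (summable hu hf hx) (Metric.mem_ball_self hr)
  rw [hderiv.fderiv]
  exact (Summable.of_norm_bounded (hu.mul_right R) fun k => (hf k).norm_fderiv_le_geom hx).hasSum

end IsMajorizedOn

end MajorizedSeries

section CauchyKovalevskaya

open PowerSeries (coeff C derivative)
open scoped Nat

variable {G F : Type*} [NormedAddCommGroup G] [NormedSpace ℝ G] [NormedAddCommGroup F]
  [NormedSpace ℝ F]

/-- The first order differential operator `f ↦ P(Df) + B f`. -/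
def firstOrderOp (P : G → (G →L[ℝ] F) →L[ℝ] F) (B : G → F →L[ℝ] F) (f : G → F) : G → F :=
  fun y => P y (fderiv ℝ f y) + B y (f y)

/-- The `k`-th term of the series `exp (t A) f`, for the operator `A = firstOrderOp P B` and the
time `t = z.1`, evaluated at the point `z.2`. -/
def expTerm (P : G → (G →L[ℝ] F) →L[ℝ] F) (B : G → F →L[ℝ] F) (f : G → F) (k : ℕ) (z : ℝ × G) : F :=
  z.1 ^ k • ((k ! : ℝ)⁻¹ • ((firstOrderOp P B)^[k] f) z.2)

variable {P : G → (G →L[ℝ] F) →L[ℝ] F} {B : G → F →L[ℝ] F} {S : Set G} {K R c : ℝ} {f : G → F}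

theorem fderiv_expTerm {z : ℝ × G} {k : ℕ}
    (h : DifferentiableAt ℝ ((firstOrderOp P B)^[k] f) z.2) :
    fderiv ℝ (expTerm P B f k) z (1, 0)
        = (k * z.1 ^ (k - 1) : ℝ) • ((k ! : ℝ)⁻¹ • ((firstOrderOp P B)^[k] f) z.2) ∧
      (fderiv ℝ (expTerm P B f k) z).comp (.inr ℝ ℝ G)
        = z.1 ^ k • ((k ! : ℝ)⁻¹ • fderiv ℝ ((firstOrderOp P B)^[k] f) z.2) := by
  have hpow : HasFDerivAt (fun z : ℝ × G => z.1 ^ k) _ z :=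
    (ContinuousLinearMap.fst ℝ ℝ G).hasFDerivAt.pow k
  have hiter : HasFDerivAt (fun z : ℝ × G => (k ! : ℝ)⁻¹ • ((firstOrderOp P B)^[k] f) z.2) _ z :=
    (h.hasFDerivAt.comp z hasFDerivAt_snd).const_smul _
  have hterm : HasFDerivAt (expTerm P B f k) _ z := hpow.smul hiter
  rw [hterm.fderiv]
  constructor
  · simp
  · ext v
    simp

theorem fderiv_expTerm_succ {z : ℝ × G} {k : ℕ}
    (h : ∀ j, DifferentiableAt ℝ ((firstOrderOp P B)^[j] f) z.2) :
    fderiv ℝ (expTerm P B f (k + 1)) z (1, 0)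
      = P z.2 ((fderiv ℝ (expTerm P B f k) z).comp (.inr ℝ ℝ G)) + B z.2 (expTerm P B f k z) := by
  have hk : ((k + 1 : ℕ) * z.1 ^ (k + 1 - 1) : ℝ) * ((k + 1)! : ℝ)⁻¹
      = z.1 ^ k * (k ! : ℝ)⁻¹ := by
    rw [Nat.factorial_succ]
    push_cast
    field_simp
  rw [(fderiv_expTerm (h _)).1, (fderiv_expTerm (h _)).2, Function.iterate_succ_apply', expTerm,
    firstOrderOp, smul_smul, hk, map_smul, map_smul, map_smul, map_smul, ← smul_add, ← smul_add,
    smul_smul]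

theorem coeff_geomPowerSeries_pow_le_pow_succ (hR : 0 ≤ R) (d m : ℕ) :
    coeff m (geomPowerSeries R ^ (d + 1)) ≤ coeff m (geomPowerSeries R ^ (d + 2)) := by
  rw [coeff_geomPowerSeries_pow_succ, coeff_geomPowerSeries_pow_succ]
  gcongr
  rw [show d + 1 + m = d + m + 1 by ring, Nat.choose_succ_succ]
  exact Nat.le_add_right _ _

variable [CompleteSpace F]

namespace IsMajorizedOn

theorem firstOrderOp (hS : IsOpen S) (hK : 0 ≤ K) (hR : 1 ≤ R)
    (hP : IsMajorizedOn S P (C K * geomPowerSeries R))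
    (hB : IsMajorizedOn S B (C K * geomPowerSeries R)) (hc : 0 ≤ c) {d : ℕ}
    (hf : IsMajorizedOn S f (C c * geomPowerSeries R ^ (d + 1))) :
    IsMajorizedOn S (firstOrderOp P B f)
      (C (c * (K * R * (d + 2))) * geomPowerSeries R ^ (d + 3)) := by
  have hR0 : 0 ≤ R := zero_le_one.trans hR
  refine ((hP.clm_apply hS hf.fderiv).add (hB.clm_apply hS hf)).mono fun m => ?_
  have hderiv : C K * geomPowerSeries R * derivative ℝ (C c * geomPowerSeries R ^ (d + 1))
      = C (K * c * ((d + 1) * R)) * geomPowerSeries R ^ (d + 3) := by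
    rw [Derivation.leibniz, derivative_geomPowerSeries_pow_succ, PowerSeries.derivative_C,
      smul_zero, add_zero, smul_eq_mul, map_mul C (K * c), map_mul C K]
    ring
  have hzeroth : C K * geomPowerSeries R * (C c * geomPowerSeries R ^ (d + 1))
      = C (K * c) * geomPowerSeries R ^ (d + 2) := by
    rw [map_mul]; ring
  have hmono : coeff m (geomPowerSeries R ^ (d + 2)) ≤ coeff m (geomPowerSeries R ^ (d + 3)) :=
    coeff_geomPowerSeries_pow_le_pow_succ hR0 (d + 1) m
  rw [hderiv, hzeroth, map_add, PowerSeries.coeff_C_mul, PowerSeries.coeff_C_mul,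
    PowerSeries.coeff_C_mul]
  calc _ ≤ K * c * ((d + 1) * R) * coeff m (geomPowerSeries R ^ (d + 3))
        + K * c * R * coeff m (geomPowerSeries R ^ (d + 3)) := by
        refine add_le_add le_rfl ?_
        exact mul_le_mul (le_mul_of_one_le_right (by positivity) hR) hmono
          (by rw [coeff_geomPowerSeries_pow_succ]; positivity) (by positivity)
    _ = _ := by ring

theorem iterate_firstOrderOp (hS : IsOpen S) (hK : 0 ≤ K) (hR : 1 ≤ R)
    (hP : IsMajorizedOn S P (C K * geomPowerSeries R))
    (hB : IsMajorizedOn S B (C K * geomPowerSeries R)) (hc : 0 ≤ c)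
    (hf : IsMajorizedOn S f (C c * geomPowerSeries R)) (k : ℕ) :
    IsMajorizedOn S ((_root_.firstOrderOp P B)^[k] f)
      (C (c * (2 * K * R) ^ k * k !) * geomPowerSeries R ^ (2 * k + 1)) := by
  induction k with
  | zero => simpa using hf
  | succ k ih =>
    have : 0 ≤ R := zero_le_one.trans hR
    rw [Function.iterate_succ_apply']
    convert firstOrderOp hS hK hR hP hB (by positivity) ih using 3
    · rw [Nat.factorial_succ]
      push_cast
      ring
    · ring

theorem expTerm (hS : IsOpen S) (hK : 0 ≤ K) (hR : 1 ≤ R)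
    (hP : IsMajorizedOn S P (C K * geomPowerSeries R))
    (hB : IsMajorizedOn S B (C K * geomPowerSeries R)) (hc : 0 ≤ c)
    (hf : IsMajorizedOn S f (C c * geomPowerSeries R)) {δ : ℝ} (hδ : 0 < δ) (hδR : R ≤ δ⁻¹)
    (k : ℕ) :
    IsMajorizedOn (Ioo (-δ) δ ×ˢ S) (expTerm P B f k)
      (C (c * (16 * K * R * δ) ^ k) * geomPowerSeries (2 * δ⁻¹)) := by
  have hR0 : 0 ≤ R := zero_le_one.trans hR
  have hopen : IsOpen (Ioo (-δ) δ ×ˢ S) := isOpen_Ioo.prod hS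
  have htime : IsMajorizedOn (Ioo (-δ) δ ×ˢ S) (fun z : ℝ × G => z.1)
      (C δ * geomPowerSeries δ⁻¹) := by
    refine clm_geom (ContinuousLinearMap.fst ℝ ℝ G) (by positivity) (fun z hz => ?_) ?_ hδ.le
    · exact abs_le.2 ⟨hz.1.1.le, hz.1.2.le⟩
    · rw [mul_inv_cancel₀ hδ.ne']
      exact ContinuousLinearMap.norm_fst_le ..
  have hspace : IsMajorizedOn (Ioo (-δ) δ ×ˢ S)
      (fun z : ℝ × G => (k ! : ℝ)⁻¹ • ((_root_.firstOrderOp P B)^[k] f) z.2)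
      (C |(k ! : ℝ)⁻¹| * (C (c * (2 * K * R) ^ k * k !) * geomPowerSeries δ⁻¹ ^ (2 * k + 1))) := by
    refine ((((iterate_firstOrderOp hS hK hR hP hB hc hf k).mono_geom_pow (by positivity) hR0
      hδR).const_smul (k ! : ℝ)⁻¹).comp_clm hS (.snd ℝ ℝ G)
      (ContinuousLinearMap.norm_snd_le ..)).mono_set fun z hz => hz.2
  have hconst : c * (2 * K * R * δ) ^ k
      = δ ^ k * (|(k ! : ℝ)⁻¹| * (c * (2 * K * R) ^ k * k !)) := by
    rw [abs_of_pos (by positivity), mul_pow _ δ]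
    field_simp
  have hprod : (C δ * geomPowerSeries δ⁻¹) ^ k * (C |(k ! : ℝ)⁻¹| *
      (C (c * (2 * K * R) ^ k * k !) * geomPowerSeries δ⁻¹ ^ (2 * k + 1)))
      = C (c * (2 * K * R * δ) ^ k) * geomPowerSeries δ⁻¹ ^ (3 * k + 1) := by
    rw [hconst, map_mul C (δ ^ k), map_mul C |(k ! : ℝ)⁻¹|, map_pow, mul_pow]
    ring
  refine (smul hopen (htime.pow hopen k) hspace).mono fun m => ?_
  rw [hprod, PowerSeries.coeff_C_mul, PowerSeries.coeff_C_mul, coeff_geomPowerSeries]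
  calc _ ≤ c * (2 * K * R * δ) ^ k * (2 ^ (3 * k) * (2 * δ⁻¹) ^ m) := by
        gcongr
        exact coeff_geomPowerSeries_pow_succ_le (by positivity) _ _
    _ = c * (2 ^ 3 * (2 * K * R * δ)) ^ k * (2 * δ⁻¹) ^ m := by
        rw [mul_pow (2 ^ 3), ← pow_mul]; ring
    _ = _ := by ring

end IsMajorizedOn

theorem exists_hasFDerivAt_firstOrderOp (hS : IsOpen S) (hK : 0 < K) (hR : 1 ≤ R)
    (hP : IsMajorizedOn S P (C K * geomPowerSeries R))
    (hB : IsMajorizedOn S B (C K * geomPowerSeries R)) :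
    ∃ δ > 0, ∀ (f : G → F) (c : ℝ), 0 ≤ c → IsMajorizedOn S f (C c * geomPowerSeries R) →
      ∃ w : ℝ × G → F, AnalyticOnNhd ℝ w (Ioo (-δ) δ ×ˢ S) ∧ (∀ y ∈ S, w (0, y) = f y) ∧
        ∀ z ∈ Ioo (-δ) δ ×ˢ S, fderiv ℝ w z (1, 0)
          = P z.2 ((fderiv ℝ w z).comp (.inr ℝ ℝ G)) + B z.2 (w z) := by
  have hR0 : 0 < R := zero_lt_one.trans_le hR
  set δ : ℝ := min R⁻¹ (32 * K * R)⁻¹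
  have hδ : 0 < δ := by positivity
  have hδR : R ≤ δ⁻¹ := (le_inv_comm₀ hR0 hδ).2 (min_le_left _ _)
  have hδK : 16 * K * R * δ ≤ 1 / 2 := by
    calc 16 * K * R * δ ≤ 16 * K * R * (32 * K * R)⁻¹ := by gcongr; exact min_le_right _ _
      _ = 1 / 2 := by field_simp; norm_num
  refine ⟨δ, hδ, fun f c hc hf => ?_⟩
  have hopen : IsOpen (Ioo (-δ) δ ×ˢ S) := isOpen_Ioo.prod hS
  have hterm := IsMajorizedOn.expTerm hS hK.le hR hP hB hc hf hδ hδR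
  have hsummable : Summable fun k => c * (16 * K * R * δ) ^ k :=
    (summable_geometric_of_lt_one (by positivity) (by linarith)).mul_left _
  refine ⟨fun z => ∑' k, expTerm P B f k z,
    IsMajorizedOn.analyticOnNhd_tsum hopen (by positivity) hsummable hterm, fun y _ => ?_,
    fun z hz => ?_⟩
  · simp only
    rw [tsum_eq_single 0 fun k hk => by simp [expTerm, hk]]
    simp [expTerm]
  · have hdiff : ∀ k, DifferentiableAt ℝ ((firstOrderOp P B)^[k] f) z.2 := fun k =>
      ((IsMajorizedOn.iterate_firstOrderOp hS hK.le hR hP hB hc hf k).1 z.2 hz.2).differentiableAt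
    have hfderiv := IsMajorizedOn.hasSum_fderiv hopen hsummable hterm hz
    have htime : HasSum (fun k => fderiv ℝ (expTerm P B f (k + 1)) z (1, 0)) _ :=
      (hasSum_nat_add_iff' 1).2 ((ContinuousLinearMap.apply ℝ F ((1, 0) : ℝ × G)).hasSum hfderiv)
    have hspace := (((P z.2).comp (.precomp F (.inr ℝ ℝ G))).hasSum hfderiv).add
      ((B z.2).hasSum (IsMajorizedOn.summable hsummable hterm hz).hasSum)
    rw [funext fun k => fderiv_expTerm_succ hdiff] at htime
    have hzero : fderiv ℝ (expTerm P B f 0) z (1, 0) = 0 := by simp [(fderiv_expTerm (hdiff 0)).1]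
    simpa [hzero] using htime.unique hspace

end CauchyKovalevskaya

section EvolutionEquation

open PowerSeries (C)

section AnalyticOperators

variable {H E F G : Type*} [NormedAddCommGroup H] [NormedSpace ℝ H]
  [NormedAddCommGroup E] [NormedSpace ℝ E] [NormedAddCommGroup F] [NormedSpace ℝ F]
  [NormedAddCommGroup G] [NormedSpace ℝ G]

theorem analyticAt_clm_comp {f : H → F →L[ℝ] G} {g : H → E →L[ℝ] F} {x : H}
    (hf : AnalyticAt ℝ f x) (hg : AnalyticAt ℝ g x) :
    AnalyticAt ℝ (fun y => (f y).comp (g y)) x :=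
  AnalyticAt.comp₂ (h := fun z : (F →L[ℝ] G) × (E →L[ℝ] F) => z.1.comp z.2)
    ((ContinuousLinearMap.compL ℝ E F G).analyticAt_bilinear _) hf hg

theorem analyticAt_clm_apply {f : H → F →L[ℝ] G} {g : H → F} {x : H}
    (hf : AnalyticAt ℝ f x) (hg : AnalyticAt ℝ g x) :
    AnalyticAt ℝ (fun y => f y (g y)) x :=
  AnalyticAt.comp₂ (h := fun z : (F →L[ℝ] G) × F => z.1 z.2)
    ((ContinuousLinearMap.id ℝ (F →L[ℝ] G)).analyticAt_bilinear _) hf hg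

end AnalyticOperators

variable {E F : Type*} [NormedAddCommGroup E] [NormedSpace ℝ E] [NormedAddCommGroup F]
  [NormedSpace ℝ F] {P : ℝ × E → (E →L[ℝ] F) →L[ℝ] F} {B : ℝ × E → F →L[ℝ] F} {t₀ : ℝ} {x₀ : E}

/-- The time derivative and the space derivatives of `w` satisfy `∂_t w = P(∂_x w) + B w` at `z`. -/
def SolvesEvolutionAt (P : ℝ × E → (E →L[ℝ] F) →L[ℝ] F) (B : ℝ × E → F →L[ℝ] F) (w : ℝ × E → F)
    (z : ℝ × E) : Prop :=
  fderiv ℝ w z (1, 0) = P z ((fderiv ℝ w z).comp (.inr ℝ ℝ E)) + B z (w z)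

/-- The coefficient of the autonomous equation `∂_τ w = (P(∂_x) - ∂_t) w + B w`, in which the time
`t` has become a space variable: a solution `w (τ, (t, x))` restricts to the solution
`u (t, x) = w (t - s, (t, x))` of `∂_t u = P(∂_x u) + B u`. -/
def suspendedCoeff (P : ℝ × E → (E →L[ℝ] F) →L[ℝ] F) (z : ℝ × E) : ((ℝ × E) →L[ℝ] F) →L[ℝ] F :=
  (P z).comp (.precomp F (.inr ℝ ℝ E)) - .apply ℝ F ((1, 0) : ℝ × E)

theorem analyticAt_suspendedCoeff {z : ℝ × E} (hP : AnalyticAt ℝ P z) :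
    AnalyticAt ℝ (suspendedCoeff P) z :=
  (analyticAt_clm_comp hP analyticAt_const).sub analyticAt_const

theorem analyticAt_sub_fst_prodMk (s : ℝ) (z : ℝ × E) :
    AnalyticAt ℝ (fun z : ℝ × E => (z.1 - s, z)) z :=
  (analyticAt_fst.sub analyticAt_const).prod analyticAt_id

theorem solvesEvolutionAt_of_suspendedCoeff {w : ℝ × (ℝ × E) → F} {s : ℝ} {z : ℝ × E}
    (hw : DifferentiableAt ℝ w (z.1 - s, z))
    (h : fderiv ℝ w (z.1 - s, z) (1, 0) = suspendedCoeff P z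
      ((fderiv ℝ w (z.1 - s, z)).comp (.inr ℝ ℝ (ℝ × E))) + B z (w (z.1 - s, z))) :
    SolvesEvolutionAt P B (fun z => w (z.1 - s, z)) z := by
  set L := fderiv ℝ w (z.1 - s, z)
  have hderiv : HasFDerivAt (fun z : ℝ × E => w (z.1 - s, z))
      (L.comp ((ContinuousLinearMap.fst ℝ ℝ E).prod (.id ℝ (ℝ × E)))) z :=
    HasFDerivAt.comp (g := w) z hw.hasFDerivAt
      (((ContinuousLinearMap.fst ℝ ℝ E).hasFDerivAt.sub_const s).prodMk (hasFDerivAt_id z))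
  have htime : L.comp ((ContinuousLinearMap.fst ℝ ℝ E).prod (.id ℝ (ℝ × E))) (1, 0)
      = L (1, 0) + L (0, ((1, 0) : ℝ × E)) := by
    rw [← map_add]; simp
  have hspace : (L.comp ((ContinuousLinearMap.fst ℝ ℝ E).prod (.id ℝ (ℝ × E)))).comp
      (.inr ℝ ℝ E) = (L.comp (.inr ℝ ℝ (ℝ × E))).comp (.inr ℝ ℝ E) := by
    ext v; simp
  rw [SolvesEvolutionAt, hderiv.fderiv, htime, hspace, h]
  simp only [suspendedCoeff, sub_apply, ContinuousLinearMap.comp_apply,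
    ContinuousLinearMap.apply_apply, ContinuousLinearMap.precomp_apply,
    ContinuousLinearMap.inr_apply]
  abel

theorem sub_fst_prodMk_mem {E : Type*} [PseudoMetricSpace E] {x₀ : E} {δ r s : ℝ} (hδr : δ ≤ r)
    (hs : s ∈ Ioo (t₀ - δ) (t₀ + δ)) {z : ℝ × E}
    (hz : z ∈ Ioo (t₀ - δ) (t₀ + δ) ×ˢ Metric.ball x₀ r) :
    (z.1 - s, z) ∈ Ioo (-(2 * δ)) (2 * δ) ×ˢ Metric.ball (t₀, x₀) r := by
  obtain ⟨⟨hz₁, hz₂⟩, hx⟩ := hz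
  obtain ⟨hs₁, hs₂⟩ := hs
  refine ⟨⟨by linarith, by linarith⟩, ?_⟩
  rw [← ball_prod_same]
  refine ⟨?_, hx⟩
  rw [Real.ball_eq_Ioo]
  exact ⟨by linarith, by linarith⟩

theorem exists_solvesEvolutionAt [CompleteSpace F] (hP : AnalyticAt ℝ P (t₀, x₀))
    (hB : AnalyticAt ℝ B (t₀, x₀)) :
    ∃ r₀ > 0, ∃ R₀ > 0, ∀ r > 0, r ≤ r₀ → ∀ R ≥ R₀, ∃ δ > 0, ∀ (f : E → F) (c : ℝ), 0 ≤ c →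
      IsMajorizedOn (Metric.ball x₀ r) f (C c * geomPowerSeries R) →
      ∀ s ∈ Ioo (t₀ - δ) (t₀ + δ), ∃ u : ℝ × E → F,
        AnalyticOnNhd ℝ u (Ioo (t₀ - δ) (t₀ + δ) ×ˢ Metric.ball x₀ r) ∧
        (∀ x ∈ Metric.ball x₀ r, u (s, x) = f x) ∧
        ∀ z ∈ Ioo (t₀ - δ) (t₀ + δ) ×ˢ Metric.ball x₀ r, SolvesEvolutionAt P B u z := by
  obtain ⟨r₁, hr₁, R₁, hR₁, K₁, hK₁, hPm⟩ :=
    exists_isMajorizedOn_ball_of_analyticAt (analyticAt_suspendedCoeff hP)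
  obtain ⟨r₂, hr₂, R₂, hR₂, K₂, -, hBm⟩ := exists_isMajorizedOn_ball_of_analyticAt hB
  refine ⟨min r₁ r₂, by positivity, max 1 (max R₁ R₂), by positivity, fun r hr hr0 R hR => ?_⟩
  obtain ⟨hr0₁, hr0₂⟩ := le_min_iff.1 hr0
  obtain ⟨hR1, hRR⟩ := max_le_iff.1 hR
  obtain ⟨hRR₁, hRR₂⟩ := max_le_iff.1 hRR
  obtain ⟨δ, hδ, hsol⟩ := exists_hasFDerivAt_firstOrderOp (S := Metric.ball (t₀, x₀) r)
    (K := max K₁ K₂) Metric.isOpen_ball (by positivity) hR1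
    ((hPm.mono_set (Metric.ball_subset_ball hr0₁)).mono_geom (by positivity) hR₁.le
      (le_max_left _ _) hRR₁)
    ((hBm.mono_set (Metric.ball_subset_ball hr0₂)).mono_geom (by positivity) hR₂.le
      (le_max_right _ _) hRR₂)
  refine ⟨min (δ / 2) r, by positivity, fun f c hc hf s hs => ?_⟩
  obtain ⟨w, hwa, hw0, hwe⟩ := hsol (fun z => f z.2) c hc
    ((hf.comp_clm Metric.isOpen_ball (.snd ℝ ℝ E)
      (ContinuousLinearMap.norm_snd_le ..)).mono_set fun z hz => by
        rw [← ball_prod_same] at hz; exact hz.2)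
  have hmem : ∀ z ∈ Ioo (t₀ - min (δ / 2) r) (t₀ + min (δ / 2) r) ×ˢ Metric.ball x₀ r,
      (z.1 - s, z) ∈ Ioo (-δ) δ ×ˢ Metric.ball (t₀, x₀) r := fun z hz => by
    have hδ' : 2 * min (δ / 2) r ≤ δ := by linarith [min_le_left (δ / 2) r]
    have hz' := sub_fst_prodMk_mem (min_le_right _ _) hs hz
    exact ⟨Ioo_subset_Ioo (neg_le_neg hδ') hδ' hz'.1, hz'.2⟩
  refine ⟨fun z => w (z.1 - s, z), fun z hz => ?_, fun x hx => ?_, fun z hz => ?_⟩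
  · exact AnalyticAt.comp (g := w) (hwa _ (hmem z hz)) (analyticAt_sub_fst_prodMk s z)
  · simpa using hw0 (s, x) (hmem (s, x) ⟨hs, hx⟩).2
  · exact solvesEvolutionAt_of_suspendedCoeff (hwa _ (hmem z hz)).differentiableAt
      (hwe _ (hmem z hz))

end EvolutionEquation

section CompactlySupportedPairings

open MeasureTheory

variable {E V : Type*} [NormedAddCommGroup E] [NormedAddCommGroup V] [MeasurableSpace E]
  [BorelSpace E] {μ : Measure E} [IsFiniteMeasureOnCompacts μ]

theorem integrable_of_continuousOn_of_eq_zero_off {g : E → V} {O K : Set E} (hO : IsOpen O)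
    (hK : IsCompact K) (hKO : K ⊆ O) (hg : ContinuousOn g O) (h0 : ∀ x ∉ K, g x = 0) :
    Integrable g μ := by
  have hsupp : tsupport g ⊆ K :=
    closure_minimal (fun x hx => by_contra fun hxK => hx (h0 x hxK)) hK.isClosed
  exact (hg.continuous_of_tsupport_subset hO (hsupp.trans hKO)).integrable_of_hasCompactSupport
    (HasCompactSupport.intro hK h0)

theorem hasDerivAt_integral_of_eq_zero_off [NormedSpace ℝ E] [FiniteDimensional ℝ E]
    {h h' : ℝ × E → ℝ} {O K : Set E} {a b : ℝ}
    (hO : IsOpen O) (hK : IsCompact K) (hKO : K ⊆ O)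
    (hc : ContinuousOn h (Ioo a b ×ˢ O)) (hc' : ContinuousOn h' (Ioo a b ×ˢ O))
    (h0 : ∀ s ∈ Ioo a b, ∀ x ∉ K, h (s, x) = 0) (h0' : ∀ s ∈ Ioo a b, ∀ x ∉ K, h' (s, x) = 0)
    (hd : ∀ s ∈ Ioo a b, ∀ x, HasDerivAt (fun s => h (s, x)) (h' (s, x)) s) {s : ℝ}
    (hs : s ∈ Ioo a b) :
    HasDerivAt (fun s => ∫ x, h (s, x) ∂μ) (∫ x, h' (s, x) ∂μ) s := by
  obtain ⟨ε, hε, hεs⟩ : ∃ ε > 0, Icc (s - ε) (s + ε) ⊆ Ioo a b := by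
    obtain ⟨ε, hε, h⟩ := Metric.nhds_basis_closedBall.mem_iff.1 (isOpen_Ioo.mem_nhds hs)
    exact ⟨ε, hε, by rwa [← Real.closedBall_eq_Icc]⟩
  have hslice : ∀ {g : ℝ × E → ℝ}, ContinuousOn g (Ioo a b ×ˢ O) → ∀ s' ∈ Ioo a b,
      ContinuousOn (fun x => g (s', x)) O := fun hg s' hs' =>
    hg.comp (by fun_prop) fun x hx => ⟨hs', hx⟩
  obtain ⟨C, hC⟩ := (isCompact_Icc.prod hK).exists_bound_of_continuousOn
    (hc'.mono (prod_mono hεs hKO))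
  have hint : ∀ s' ∈ Ioo a b, Integrable (fun x => h (s', x)) μ := fun s' hs' =>
    integrable_of_continuousOn_of_eq_zero_off hO hK hKO (hslice hc s' hs') (h0 s' hs')
  refine (hasDerivAt_integral_of_dominated_loc_of_deriv_le (F := fun s x => h (s, x))
    (F' := fun s x => h' (s, x)) (bound := K.indicator fun _ => C) (s := Icc (s - ε) (s + ε))
    (Icc_mem_nhds (by linarith) (by linarith)) ?_ (hint s hs) ?_ ?_ ?_ ?_).2
  · filter_upwards [isOpen_Ioo.mem_nhds hs] with s' hs' using (hint s' hs').aestronglyMeasurable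
  · exact (integrable_of_continuousOn_of_eq_zero_off (μ := μ) hO hK hKO (hslice hc' s hs)
      (h0' s hs)).aestronglyMeasurable
  · refine Filter.Eventually.of_forall fun x s' hs' => ?_
    by_cases hx : x ∈ K
    · rw [indicator_of_mem hx]; exact hC (s', x) ⟨hs', hx⟩
    · rw [indicator_of_notMem hx, h0' s' (hεs hs') x hx, norm_zero]
  · exact (integrable_indicator_iff hK.measurableSet).2
      (integrableOn_const hK.measure_lt_top.ne)
  · exact Filter.Eventually.of_forall fun x s' hs' => hd s' (hεs hs') x

end CompactlySupportedPairings

section EntireFunctions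

open MeasureTheory
open PowerSeries (C)

variable {E : Type*} [NormedAddCommGroup E] [NormedSpace ℝ E]

/-- The Taylor coefficients of `q`, uniformly on `S`, decay faster than any geometric sequence.
These are the initial data for which the solutions of an evolution equation have a common domain of
existence. -/
def IsEntireOn (S : Set E) (q : E → ℝ) : Prop :=
  ∀ R > 0, ∃ c ≥ 0, IsMajorizedOn S q (C c * geomPowerSeries R)

namespace IsEntireOn

variable {S : Set E} {q q' : E → ℝ}

theorem const (c : ℝ) : IsEntireOn S fun _ => c := fun R hR =>
  ⟨‖c‖, norm_nonneg _, (IsMajorizedOn.const c).mono fun m => by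
    rw [PowerSeries.coeff_C_mul, coeff_geomPowerSeries, PowerSeries.coeff_C]
    split_ifs with h
    · simp [h]
    · positivity⟩

theorem add (hq : IsEntireOn S q) (hq' : IsEntireOn S q') : IsEntireOn S fun x => q x + q' x :=
  fun R hR => by
    obtain ⟨c, hc, h⟩ := hq R hR
    obtain ⟨c', hc', h'⟩ := hq' R hR
    refine ⟨c + c', add_nonneg hc hc', ?_⟩
    rw [map_add, add_mul]
    exact h.add h'

theorem mul (hS : IsOpen S) (hq : IsEntireOn S q) (hq' : IsEntireOn S q') :
    IsEntireOn S fun x => q x * q' x := fun R hR => by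
  obtain ⟨c, hc, h⟩ := hq (R / 2) (by positivity)
  obtain ⟨c', hc', h'⟩ := hq' (R / 2) (by positivity)
  refine ⟨2 * (c * c'), by positivity, (h.mul hS h').mono fun m => ?_⟩
  have hprod : C c * geomPowerSeries (R / 2) * (C c' * geomPowerSeries (R / 2))
      = C (c * c') * geomPowerSeries (R / 2) ^ (1 + 1) := by rw [map_mul]; ring
  rw [hprod, PowerSeries.coeff_C_mul, PowerSeries.coeff_C_mul, coeff_geomPowerSeries]
  calc _ ≤ c * c' * (2 ^ 1 * (2 * (R / 2)) ^ m) := by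
        gcongr
        exact coeff_geomPowerSeries_pow_succ_le (by positivity) _ _
    _ = _ := by rw [mul_div_cancel₀ R two_ne_zero]; ring

theorem clm (hS : Bornology.IsBounded S) (L : E →L[ℝ] ℝ) : IsEntireOn S L := fun R hR => by
  obtain ⟨M, hM⟩ := hS.exists_norm_le
  have hbound : ∀ x ∈ S, ‖L x‖ ≤ ‖L‖ * |M| := fun x hx =>
    (L.le_opNorm x).trans (by gcongr; exact (hM x hx).trans (le_abs_self M))
  refine ⟨‖L‖ * |M| + ‖L‖ * R⁻¹, by positivity, .clm_geom L hR.le (fun x hx => ?_) ?_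
    (by positivity)⟩
  · exact (hbound x hx).trans (le_add_of_nonneg_right (by positivity))
  · rw [add_mul, inv_mul_cancel_right₀ hR.ne']
    exact le_add_of_nonneg_left (by positivity)

theorem continuousOn (hq : IsEntireOn S q) : ContinuousOn q S := by
  obtain ⟨c, -, hqm⟩ := hq 1 one_pos
  exact hqm.1.continuousOn

/-- The restrictions to `K` of the functions which are entire on `S`, as an algebra to which the
Stone–Weierstrass theorem applies. -/
def restrictSubalgebra (hS : IsOpen S) (K : Set E) : Subalgebra ℝ C(K, ℝ) where
  carrier := {f | ∃ q : E → ℝ, IsEntireOn S q ∧ ∀ x : K, f x = q x}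
  mul_mem' := by
    rintro f f' ⟨q, hq, hf⟩ ⟨q', hq', hf'⟩
    exact ⟨_, hq.mul hS hq', fun x => by simp [hf, hf']⟩
  add_mem' := by
    rintro f f' ⟨q, hq, hf⟩ ⟨q', hq', hf'⟩
    exact ⟨_, hq.add hq', fun x => by simp [hf, hf']⟩
  algebraMap_mem' := fun c => ⟨_, .const c, fun _ => rfl⟩

theorem separatesPoints_restrictSubalgebra (hS : IsOpen S) (hSb : Bornology.IsBounded S)
    (K : Set E) : (restrictSubalgebra hS K).SeparatesPoints := by
  intro x y hxy
  obtain ⟨L, hL⟩ := SeparatingDual.exists_separating_of_ne (R := ℝ)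
    (fun h => hxy (Subtype.ext h) : (x : E) ≠ y)
  exact ⟨fun z : K => L z, ⟨⟨fun z : K => L z, by fun_prop⟩,
    ⟨L, clm hSb L, fun _ => rfl⟩, rfl⟩, hL⟩

theorem exists_abs_sub_le {g : E → ℝ} {K : Set E} (hg : Continuous g) (hK : IsCompact K)
    (hS : IsOpen S) (hSb : Bornology.IsBounded S) {ε : ℝ} (hε : 0 < ε) :
    ∃ q, IsEntireOn S q ∧ ∀ x ∈ K, |g x - q x| ≤ ε := by
  have : CompactSpace K := isCompact_iff_compactSpace.1 hK
  obtain ⟨⟨f, q, hq, hf⟩, hfε⟩ :=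
    ContinuousMap.exists_mem_subalgebra_near_continuousMap_of_separatesPoints _
      (separatesPoints_restrictSubalgebra hS hSb K) ⟨fun x : K => g x, by fun_prop⟩ ε hε
  refine ⟨q, hq, fun x hx => ?_⟩
  have hle := (ContinuousMap.norm_coe_le_norm _ (⟨x, hx⟩ : K)).trans hfε.le
  rw [ContinuousMap.sub_apply, Real.norm_eq_abs, abs_sub_comm] at hle
  simpa [hf] using hle

variable [MeasurableSpace E] [BorelSpace E] {μ : Measure E} [IsFiniteMeasureOnCompacts μ]
  {g : E → ℝ} {K : Set E}

theorem integral_mul_self_le (hg : Continuous g) (hK : IsCompact K) (hS : IsOpen S) (hKS : K ⊆ S)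
    (hSb : Bornology.IsBounded S) (h0 : ∀ x ∉ K, g x = 0)
    (hint : ∀ q, IsEntireOn S q → ∫ x, q x * g x ∂μ = 0) {ε : ℝ} (hε : 0 < ε) :
    ∫ x, g x * g x ∂μ ≤ ε * ∫ x, |g x| ∂μ := by
  have hcs : HasCompactSupport g := HasCompactSupport.intro hK h0
  have hgg : Integrable (fun x => g x * g x) μ :=
    (hg.mul hg).integrable_of_hasCompactSupport hcs.mul_left
  obtain ⟨q, hq, hgq⟩ := exists_abs_sub_le hg hK hS hSb hε
  have hqg : Integrable (fun x => q x * g x) μ :=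
    integrable_of_continuousOn_of_eq_zero_off hS hK hKS (hq.continuousOn.mul hg.continuousOn)
      fun x hx => by simp [h0 x hx]
  have hle : ∀ x, |g x * g x - q x * g x| ≤ ε * |g x| := by
    intro x
    by_cases hx : x ∈ K
    · rw [← sub_mul, abs_mul]
      gcongr
      exact hgq x hx
    · simp [h0 x hx]
  calc ∫ x, g x * g x ∂μ = ∫ x, (g x * g x - q x * g x) ∂μ := by
        rw [integral_sub hgg hqg, hint q hq, sub_zero]
    _ ≤ ∫ x, ε * |g x| ∂μ :=
        integral_mono (hgg.sub hqg) ((hg.integrable_of_hasCompactSupport hcs).abs.const_mul ε)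
          fun x => (le_abs_self _).trans (hle x)
    _ = _ := integral_const_mul _ _

theorem eq_zero_of_integral_mul_eq_zero [μ.IsOpenPosMeasure] (hg : Continuous g)
    (hK : IsCompact K) (hS : IsOpen S) (hKS : K ⊆ S) (hSb : Bornology.IsBounded S)
    (h0 : ∀ x ∉ K, g x = 0) (hint : ∀ q, IsEntireOn S q → ∫ x, q x * g x ∂μ = 0) : g = 0 := by
  have hcs : HasCompactSupport g := HasCompactSupport.intro hK h0
  have hgg : Integrable (fun x => g x * g x) μ :=
    (hg.mul hg).integrable_of_hasCompactSupport hcs.mul_left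
  have hzero : ∫ x, g x * g x ∂μ = 0 := by
    refine le_antisymm (le_of_forall_pos_le_add fun ε hε => ?_)
      (integral_nonneg fun x => mul_self_nonneg _)
    set J := ∫ x, |g x| ∂μ
    have : 0 ≤ J := integral_nonneg fun x => abs_nonneg _
    calc _ ≤ ε / (J + 1) * J := integral_mul_self_le hg hK hS hKS hSb h0 hint (by positivity)
      _ ≤ 0 + ε := by
        rw [zero_add, div_mul_eq_mul_div, div_le_iff₀ (by positivity)]
        nlinarith
  have hae := (integral_eq_zero_iff_of_nonneg (fun x => mul_self_nonneg (g x)) hgg).1 hzero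
  funext x
  exact mul_self_eq_zero.1 (congrFun (((hg.mul hg).ae_eq_iff_eq μ continuous_zero).1 hae) x)

end IsEntireOn

end EntireFunctions

section Duality

set_option maxSynthPendingDepth 3

open MeasureTheory

variable {E : Type*} [NormedAddCommGroup E] [NormedSpace ℝ E]
  {F : Type*} [NormedAddCommGroup F] [NormedSpace ℝ F]

/-- The coefficient of the derivative in the direction `e` in the principal part `P`, relative to
a basis in which `l` is the coordinate dual to `e`. -/
def principalCoeff (P : ℝ × E → (E →L[ℝ] F) →L[ℝ] F) (l : E →L[ℝ] ℝ) (z : ℝ × E) : F →L[ℝ] F :=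
  (P z).comp (ContinuousLinearMap.smulRightL ℝ E F l)

theorem analyticAt_principalCoeff {P : ℝ × E → (E →L[ℝ] F) →L[ℝ] F} {z : ℝ × E}
    (hP : AnalyticAt ℝ P z) (l : E →L[ℝ] ℝ) : AnalyticAt ℝ (principalCoeff P l) z :=
  analyticAt_clm_comp hP analyticAt_const

/-- `W` is continuously differentiable on `J × E` and vanishes outside `J × K`. -/
structure IsC1SupportedOn (J : Set ℝ) (K : Set E) (W : ℝ × E → F) : Prop where
  differentiableAt : ∀ z ∈ J ×ˢ univ, DifferentiableAt ℝ W z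
  continuousOn_fderiv : ContinuousOn (fderiv ℝ W) (J ×ˢ univ)
  eq_zero : ∀ s ∈ J, ∀ x ∉ K, W (s, x) = 0

namespace IsC1SupportedOn

variable {J : Set ℝ} {K : Set E} {W : ℝ × E → F}

theorem continuousOn (hW : IsC1SupportedOn J K W) : ContinuousOn W (J ×ˢ univ) := fun z hz =>
  (hW.differentiableAt z hz).continuousAt.continuousWithinAt

theorem fderiv_eq_zero (hW : IsC1SupportedOn J K W) (hJ : IsOpen J) (hK : IsClosed K) {s : ℝ}
    (hs : s ∈ J) {x : E} (hx : x ∉ K) : fderiv ℝ W (s, x) = 0 := by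
  have : W =ᶠ[nhds (s, x)] fun _ => 0 := by
    filter_upwards [(hJ.prod hK.isOpen_compl).mem_nhds (show (s, x) ∈ J ×ˢ Kᶜ from ⟨hs, hx⟩)]
      with y hy using hW.eq_zero y.1 hy.1 y.2 hy.2
  rw [this.fderiv_eq, fderiv_const_apply]

theorem hasFDerivAt_slice (hW : IsC1SupportedOn J K W) {s : ℝ} (hs : s ∈ J) (x : E) :
    HasFDerivAt (fun x => W (s, x)) ((fderiv ℝ W (s, x)).comp (ContinuousLinearMap.inr ℝ ℝ E)) x :=
  (hW.differentiableAt (s, x) ⟨hs, mem_univ x⟩).hasFDerivAt.comp x (hasFDerivAt_prodMk_right s x)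

theorem continuous_slice (hW : IsC1SupportedOn J K W) {s : ℝ} (hs : s ∈ J) :
    Continuous fun x => W (s, x) :=
  continuous_iff_continuousAt.2 fun x => (hW.hasFDerivAt_slice hs x).continuousAt

theorem continuous_fderiv_slice (hW : IsC1SupportedOn J K W) {s : ℝ} (hs : s ∈ J) :
    Continuous fun x => fderiv ℝ W (s, x) :=
  hW.continuousOn_fderiv.comp_continuous (by fun_prop) fun x => ⟨hs, mem_univ x⟩

theorem integral_fderiv_pairing_eq_zero [MeasurableSpace E] [BorelSpace E] [FiniteDimensional ℝ E]
    {μ : Measure E} [μ.IsAddHaarMeasure] (hW : IsC1SupportedOn J K W) (hJ : IsOpen J) {O : Set E}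
    (hO : IsOpen O) (hK : IsCompact K) (hKO : K ⊆ O) {s : ℝ} (hs : s ∈ J)
    {v : E → F →L[ℝ] ℝ} (hv : ContDiffOn ℝ 1 v O) (e : E) :
    Integrable (fun x => fderiv ℝ v x e (W (s, x)) + v x (fderiv ℝ W (s, x) (0, e))) μ ∧
      ∫ x, (fderiv ℝ v x e (W (s, x)) + v x (fderiv ℝ W (s, x) (0, e))) ∂μ = 0 := by
  have hWs := (hW.continuous_slice hs).continuousOn (s := O)
  have hWs' := (hW.continuous_fderiv_slice hs).continuousOn (s := O)
  have hsupp : tsupport (fun x => W (s, x)) ⊆ K :=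
    closure_minimal (fun x hx => by_contra fun hxK => hx (hW.eq_zero s hs x hxK)) hK.isClosed
  have hint : Integrable (fun x => v x (W (s, x))) μ :=
    integrable_of_continuousOn_of_eq_zero_off hO hK hKO (hv.continuousOn.clm_apply hWs)
      fun x hx => by rw [hW.eq_zero s hs x hx, map_zero]
  have hint_left : Integrable (fun x => fderiv ℝ v x e (W (s, x))) μ :=
    integrable_of_continuousOn_of_eq_zero_off hO hK hKO
      (((hv.continuousOn_fderiv_of_isOpen hO le_rfl).clm_apply continuousOn_const).clm_apply hWs)
      fun x hx => by rw [hW.eq_zero s hs x hx, map_zero]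
  have hint_right : Integrable (fun x => v x (fderiv ℝ W (s, x) (0, e))) μ :=
    integrable_of_continuousOn_of_eq_zero_off hO hK hKO
      (hv.continuousOn.clm_apply (hWs'.clm_apply continuousOn_const))
      fun x hx => by rw [hW.fderiv_eq_zero hJ hK.isClosed hs hx, zero_apply, map_zero]
  have hparts : ∫ x, v x (fderiv ℝ W (s, x) (0, e)) ∂μ = -∫ x, fderiv ℝ v x e (W (s, x)) ∂μ := by
    simpa using integral_bilinear_hasFDerivAt_right_eq_neg_left_of_integrable
      (B := ContinuousLinearMap.id ℝ (F →L[ℝ] ℝ)) hint_left (by simpa using hint_right) hint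
      (fun x hx => ((hv.differentiableOn one_ne_zero).differentiableAt
        (hO.mem_nhds (hKO (hsupp hx)))).hasFDerivAt)
      fun x _ => hW.hasFDerivAt_slice hs x
  refine ⟨hint_left.add hint_right, ?_⟩
  rw [integral_add hint_left hint_right, hparts, add_neg_cancel]

theorem hasDerivAt_integral_pairing [MeasurableSpace E] [BorelSpace E] [FiniteDimensional ℝ E]
    {μ : Measure E} [IsFiniteMeasureOnCompacts μ] {a c : ℝ}
    (hW : IsC1SupportedOn (Ioo a c) K W) {O : Set E}
    (hO : IsOpen O) (hK : IsCompact K) (hKO : K ⊆ O) {u : ℝ × E → (F →L[ℝ] ℝ)}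
    (hu : ContDiffOn ℝ 1 u (Ioo a c ×ˢ O)) {s : ℝ} (hs : s ∈ Ioo a c) :
    HasDerivAt (fun s => ∫ x, u (s, x) (W (s, x)) ∂μ)
      (∫ x, (fderiv ℝ u (s, x) (1, 0) (W (s, x)) + u (s, x) (fderiv ℝ W (s, x) (1, 0))) ∂μ) s := by
  have hJO : IsOpen (Ioo a c ×ˢ O) := isOpen_Ioo.prod hO
  have hsub : Ioo a c ×ˢ O ⊆ Ioo a c ×ˢ univ := prod_mono le_rfl (subset_univ _)
  have h0 : ∀ s ∈ Ioo a c, ∀ x ∉ K, u (s, x) (W (s, x)) = 0 := fun s hs x hx => by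
    rw [hW.eq_zero s hs x hx, map_zero]
  have h0' : ∀ s ∈ Ioo a c, ∀ x ∉ K,
      fderiv ℝ u (s, x) (1, 0) (W (s, x)) + u (s, x) (fderiv ℝ W (s, x) (1, 0)) = 0 :=
    fun s hs x hx => by
      rw [hW.eq_zero s hs x hx, hW.fderiv_eq_zero isOpen_Ioo hK.isClosed hs hx, zero_apply,
        map_zero, map_zero, add_zero]
  refine hasDerivAt_integral_of_eq_zero_off (h := fun z => u z (W z))
    (h' := fun z => fderiv ℝ u z (1, 0) (W z) + u z (fderiv ℝ W z (1, 0))) hO hK hKO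
    (hu.continuousOn.clm_apply (hW.continuousOn.mono hsub)) (.add ?_ ?_) h0 h0'
    (fun s hs x => ?_) hs
  · exact ((hu.continuousOn_fderiv_of_isOpen hJO le_rfl).clm_apply continuousOn_const).clm_apply
      (hW.continuousOn.mono hsub)
  · exact hu.continuousOn.clm_apply ((hW.continuousOn_fderiv.mono hsub).clm_apply
      continuousOn_const)
  by_cases hx : x ∈ O
  · have hline : HasDerivAt (fun s : ℝ => (s, x)) ((1, 0) : ℝ × E) s :=
      (hasDerivAt_id s).prodMk (hasDerivAt_const s x)
    exact (((hu.differentiableOn one_ne_zero).differentiableAt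
      (hJO.mem_nhds ⟨hs, hx⟩)).hasFDerivAt.comp_hasDerivAt s hline).clm_apply
      ((hW.differentiableAt _ ⟨hs, mem_univ x⟩).hasFDerivAt.comp_hasDerivAt s hline)
  · have hxK : x ∉ K := fun h => hx (hKO h)
    rw [h0' s hs x hxK]
    refine (hasDerivAt_const s (0 : ℝ)).congr_of_eventuallyEq ?_
    filter_upwards [isOpen_Ioo.mem_nhds hs] with s' hs' using h0 s' hs' x hxK

end IsC1SupportedOn

variable [FiniteDimensional ℝ E] {ι : Type*} [Fintype ι] {P : ℝ × E → (E →L[ℝ] F) →L[ℝ] F}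
  {B : ℝ × E → F →L[ℝ] F}

/-- The coordinate functionals of a basis of a finite-dimensional space. -/
def basisCoord (b : Module.Basis ι ℝ E) (i : ι) : E →L[ℝ] ℝ :=
  (b.coord i).toContinuousLinearMap

theorem apply_eq_sum_principalCoeff (P : ℝ × E → (E →L[ℝ] F) →L[ℝ] F)
    (b : Module.Basis ι ℝ E) (z : ℝ × E) (L : E →L[ℝ] F) :
    P z L = ∑ i, principalCoeff P (basisCoord b i) z (L (b i)) := by
  have h : L = ∑ i, ContinuousLinearMap.smulRightL ℝ E F (basisCoord b i) (L (b i)) := by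
    ext v
    conv_lhs => rw [← b.sum_repr v, map_sum]
    rw [sum_apply]
    exact Finset.sum_congr rfl fun i _ => by simp [basisCoord]
  conv_lhs => rw [h, map_sum]
  rfl

/-- The principal part of the adjoint equation. -/
def adjointPrincipal (P : ℝ × E → (E →L[ℝ] F) →L[ℝ] F)
    (b : Module.Basis ι ℝ E) (z : ℝ × E) : (E →L[ℝ] (F →L[ℝ] ℝ)) →L[ℝ] (F →L[ℝ] ℝ) :=
  ∑ i, ((ContinuousLinearMap.compL ℝ F F ℝ).flip (principalCoeff P (basisCoord b i) z)).comp
    (ContinuousLinearMap.apply ℝ (F →L[ℝ] ℝ) (b i))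

/-- The zeroth order part of the adjoint equation. -/
def adjointZeroth (P : ℝ × E → (E →L[ℝ] F) →L[ℝ] F)
    (B : ℝ × E → F →L[ℝ] F) (b : Module.Basis ι ℝ E) (z : ℝ × E) :
    (F →L[ℝ] ℝ) →L[ℝ] (F →L[ℝ] ℝ) :=
  (ContinuousLinearMap.compL ℝ F F ℝ).flip
    (∑ i, fderiv ℝ (principalCoeff P (basisCoord b i)) z (0, b i) - B z)

theorem analyticAt_adjointPrincipal {z : ℝ × E} (hP : AnalyticAt ℝ P z)
    (b : Module.Basis ι ℝ E) : AnalyticAt ℝ (adjointPrincipal P b) z :=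
  Finset.analyticAt_fun_sum _ fun _ _ => analyticAt_clm_comp
    (analyticAt_clm_apply analyticAt_const (analyticAt_principalCoeff hP _)) analyticAt_const

theorem analyticAt_adjointZeroth [CompleteSpace F] {z : ℝ × E} (hP : AnalyticAt ℝ P z)
    (hB : AnalyticAt ℝ B z) (b : Module.Basis ι ℝ E) : AnalyticAt ℝ (adjointZeroth P B b) z :=
  analyticAt_clm_apply analyticAt_const <| .sub (Finset.analyticAt_fun_sum _ fun _ _ =>
    analyticAt_clm_apply (analyticAt_principalCoeff hP _).fderiv analyticAt_const) hB

theorem SolvesEvolutionAt.deriv_pairing_eq_sum (b : Module.Basis ι ℝ E) {u : ℝ × E → (F →L[ℝ] ℝ)}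
    {W : ℝ × E → F} {s : ℝ} {x : E} (hP : DifferentiableAt ℝ P (s, x))
    (hu : DifferentiableAt ℝ u (s, x))
    (hue : SolvesEvolutionAt (adjointPrincipal P b) (adjointZeroth P B b) u (s, x))
    (hWe : SolvesEvolutionAt P B W (s, x)) :
    fderiv ℝ u (s, x) (1, 0) (W (s, x)) + u (s, x) (fderiv ℝ W (s, x) (1, 0)) =
      ∑ i, (fderiv ℝ (fun y => (u (s, y)).comp (principalCoeff P (basisCoord b i) (s, y))) x (b i)
          (W (s, x)) + (u (s, x)).comp (principalCoeff P (basisCoord b i) (s, x))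
          (fderiv ℝ W (s, x) (0, b i))) := by
  have hslice := hasFDerivAt_prodMk_right (𝕜 := ℝ) s x
  have hder : ∀ i, fderiv ℝ (fun y => (u (s, y)).comp (principalCoeff P (basisCoord b i) (s, y))) x
      (b i) = (fderiv ℝ u (s, x) (0, b i)).comp (principalCoeff P (basisCoord b i) (s, x))
        + (u (s, x)).comp (fderiv ℝ (principalCoeff P (basisCoord b i)) (s, x) (0, b i)) := by
    intro i
    have hA : DifferentiableAt ℝ (principalCoeff P (basisCoord b i)) (s, x) :=
      hP.clm_comp (differentiableAt_const _)
    have h : HasFDerivAt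
        (fun y => (u (s, y)).comp (principalCoeff P (basisCoord b i) (s, y))) _ x :=
      (hu.hasFDerivAt.comp x hslice).clm_comp (hA.hasFDerivAt.comp x hslice)
    rw [h.fderiv]
    ext f
    simp [add_comm]
  rw [hue, hWe, apply_eq_sum_principalCoeff P b]
  simp only [hder, adjointPrincipal, adjointZeroth, sub_apply, sum_apply,
    ContinuousLinearMap.comp_apply, ContinuousLinearMap.apply_apply,
    ContinuousLinearMap.inr_apply, add_apply, ContinuousLinearMap.flip_apply,
    ContinuousLinearMap.compL_apply, map_add, map_sub, map_sum, Finset.sum_add_distrib]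
  ring

theorem integral_pairing_eq [MeasurableSpace E] [BorelSpace E] {μ : Measure E}
    [μ.IsAddHaarMeasure] (b : Module.Basis ι ℝ E) {O K : Set E} {a c : ℝ} (hO : IsOpen O)
    (hK : IsCompact K) (hKO : K ⊆ O) (hP : ContDiffOn ℝ 1 P (Ioo a c ×ˢ O))
    {u : ℝ × E → (F →L[ℝ] ℝ)} (hu : ContDiffOn ℝ 1 u (Ioo a c ×ˢ O))
    (hue : ∀ z ∈ Ioo a c ×ˢ O,
      SolvesEvolutionAt (adjointPrincipal P b) (adjointZeroth P B b) u z)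
    {W : ℝ × E → F} (hW : IsC1SupportedOn (Ioo a c) K W)
    (hWe : ∀ z ∈ Ioo a c ×ˢ O, SolvesEvolutionAt P B W z) {s t : ℝ} (hs : s ∈ Ioo a c)
    (ht : t ∈ Ioo a c) :
    ∫ x, u (s, x) (W (s, x)) ∂μ = ∫ x, u (t, x) (W (t, x)) ∂μ := by
  have hJO : IsOpen (Ioo a c ×ˢ O) := isOpen_Ioo.prod hO
  have hzero : ∀ s ∈ Ioo a c, ∫ x, (fderiv ℝ u (s, x) (1, 0) (W (s, x))
      + u (s, x) (fderiv ℝ W (s, x) (1, 0))) ∂μ = 0 := by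
    intro s hs
    have hflux := fun i => hW.integral_fderiv_pairing_eq_zero (μ := μ) isOpen_Ioo hO hK hKO hs
      (v := fun y => (u (s, y)).comp (principalCoeff P (basisCoord b i) (s, y)))
      ((hu.clm_comp (hP.clm_comp contDiffOn_const)).comp (by fun_prop) fun y hy => ⟨hs, hy⟩) (b i)
    have hsum : ∀ x, fderiv ℝ u (s, x) (1, 0) (W (s, x)) + u (s, x) (fderiv ℝ W (s, x) (1, 0)) =
        ∑ i, (fderiv ℝ (fun y => (u (s, y)).comp (principalCoeff P (basisCoord b i) (s, y))) x
          (b i) (W (s, x)) + (u (s, x)).comp (principalCoeff P (basisCoord b i) (s, x))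
          (fderiv ℝ W (s, x) (0, b i))) := by
      intro x
      by_cases hx : x ∈ O
      · have hnhds := hJO.mem_nhds (show (s, x) ∈ Ioo a c ×ˢ O from ⟨hs, hx⟩)
        exact (hue _ ⟨hs, hx⟩).deriv_pairing_eq_sum b
          ((hP.differentiableOn one_ne_zero).differentiableAt hnhds)
          ((hu.differentiableOn one_ne_zero).differentiableAt hnhds) (hWe _ ⟨hs, hx⟩)
      · have hxK : x ∉ K := fun h => hx (hKO h)
        simp [hW.eq_zero s hs x hxK, hW.fderiv_eq_zero isOpen_Ioo hK.isClosed hs hxK]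
    simp only [hsum]
    rw [integral_finsetSum _ fun i _ => (hflux i).1]
    exact Finset.sum_eq_zero fun i _ => (hflux i).2
  have hderiv := fun s hs => hW.hasDerivAt_integral_pairing (μ := μ) hO hK hKO hu (s := s) hs
  exact isOpen_Ioo.is_const_of_deriv_eq_zero isPreconnected_Ioo
    (fun s hs => (hderiv s hs).differentiableAt.differentiableWithinAt)
    (fun s hs => (hderiv s hs).deriv.trans (hzero s hs)) hs ht

theorem integral_dual_eq_zero [MeasurableSpace E] [BorelSpace E] {μ : Measure E}
    [μ.IsAddHaarMeasure] (b : Module.Basis ι ℝ E) {O K : Set E} {a c : ℝ} (hO : IsOpen O)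
    (hK : IsCompact K) (hKO : K ⊆ O) (hP : ContDiffOn ℝ 1 P (Ioo a c ×ˢ O))
    {u : ℝ × E → (F →L[ℝ] ℝ)} (hu : ContDiffOn ℝ 1 u (Ioo a c ×ˢ O))
    (hue : ∀ z ∈ Ioo a c ×ˢ O,
      SolvesEvolutionAt (adjointPrincipal P b) (adjointZeroth P B b) u z)
    {W : ℝ × E → F} (hW : IsC1SupportedOn (Ioo a c) K W)
    (hWe : ∀ z ∈ Ioo a c ×ˢ O, SolvesEvolutionAt P B W z) {s t : ℝ} (hs : s ∈ Ioo a c)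
    (ht : t ∈ Ioo a c) (hWt : ∀ x, W (t, x) = 0) {v : E → F →L[ℝ] ℝ}
    (hv : ∀ x ∈ O, u (s, x) = v x) : ∫ x, v x (W (s, x)) ∂μ = 0 := by
  have hpair := integral_pairing_eq (μ := μ) b hO hK hKO hP hu hue hW hWe hs ht
  simp only [hWt, map_zero, integral_zero] at hpair
  rw [← hpair]
  refine integral_congr_ae (Filter.Eventually.of_forall fun x => ?_)
  by_cases hx : x ∈ O
  · simp only [hv x hx]
  · simp only [hW.eq_zero s hs x fun h => hx (hKO h), map_zero]

theorem exists_forall_eq_zero_of_solvesEvolutionAt [CompleteSpace F] {t₀ : ℝ} {x₀ : E}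
    (hP : AnalyticAt ℝ P (t₀, x₀)) (hB : AnalyticAt ℝ B (t₀, x₀)) :
    ∃ r₀ > 0, ∀ r > 0, r ≤ r₀ → ∃ δ₀ > 0, ∀ δ > 0, δ ≤ δ₀ → ∀ W : ℝ × E → F,
      IsC1SupportedOn (Ioo (t₀ - δ) (t₀ + δ)) (Metric.closedBall x₀ (r / 2)) W →
      (∀ x, W (t₀, x) = 0) →
      (∀ z ∈ Ioo (t₀ - δ) (t₀ + δ) ×ˢ Metric.ball x₀ r, SolvesEvolutionAt P B W z) →
      ∀ s ∈ Ioo (t₀ - δ) (t₀ + δ), ∀ x, W (s, x) = 0 := by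
  let _ : MeasurableSpace E := borel E
  have : BorelSpace E := ⟨rfl⟩
  set b := Module.finBasis ℝ E
  obtain ⟨r₁, hr₁, R, hR, hCK⟩ := exists_solvesEvolutionAt (analyticAt_adjointPrincipal hP b)
    (analyticAt_adjointZeroth hP hB b)
  obtain ⟨r₂, hr₂, hPa⟩ := Metric.eventually_nhds_iff_ball.1 hP.eventually_analyticAt
  refine ⟨min r₁ r₂, by positivity, fun r hr hr0 => ?_⟩
  obtain ⟨δ₁, hδ₁, hsol⟩ := hCK r hr (hr0.trans (min_le_left _ _)) R le_rfl
  refine ⟨min δ₁ r₂, by positivity, fun δ hδ hδδ W hW hWt hWe s hs x => ?_⟩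
  obtain ⟨hδ1, hδ2⟩ := le_min_iff.1 hδδ
  have hsub : Ioo (t₀ - δ) (t₀ + δ) ⊆ Ioo (t₀ - δ₁) (t₀ + δ₁) :=
    Ioo_subset_Ioo (by linarith) (by linarith)
  have hPc : ContDiffOn ℝ 1 P (Ioo (t₀ - δ) (t₀ + δ) ×ˢ Metric.ball x₀ r) := by
    refine fun z hz => (hPa z ?_).contDiffAt.contDiffWithinAt
    rw [← ball_prod_same, Real.ball_eq_Ioo]
    exact ⟨Ioo_subset_Ioo (by linarith) (by linarith) hz.1,
      Metric.ball_subset_ball (hr0.trans (min_le_right _ _)) hz.2⟩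
  have hKO : Metric.closedBall x₀ (r / 2) ⊆ Metric.ball x₀ r :=
    Metric.closedBall_subset_ball (by linarith)
  have hK : IsCompact (Metric.closedBall x₀ (r / 2)) := isCompact_closedBall _ _
  -- It suffices that each `l ∘ W (s, ·)` is orthogonal to the entire functions `q`; this is the
  -- pairing of `W` with the adjoint solution which equals `q • l` at time `s`.
  refine SeparatingDual.eq_zero_of_forall_dual_eq_zero (R := ℝ) fun l => congrFun
    (IsEntireOn.eq_zero_of_integral_mul_eq_zero (μ := Measure.addHaar)
      (g := fun x => l (W (s, x))) (l.continuous.comp (hW.continuous_slice hs)) hK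
      Metric.isOpen_ball hKO Metric.isBounded_ball
      (fun x hx => by rw [hW.eq_zero s hs x hx, map_zero]) fun q hq => ?_) x
  obtain ⟨c, hc, hqm⟩ := hq R hR
  have hql : IsMajorizedOn (Metric.ball x₀ r) (fun x => q x • l)
      (PowerSeries.C (‖l‖ * c) * geomPowerSeries R) := by
    refine (hqm.clm_comp (ContinuousLinearMap.toSpanSingleton ℝ l)).mono fun m => ?_
    rw [ContinuousLinearMap.norm_toSpanSingleton, map_mul PowerSeries.C, mul_assoc]
  obtain ⟨u, hua, hus, hue⟩ := hsol (fun x => q x • l) (‖l‖ * c) (by positivity) hql s (hsub hs)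
  have hsubprod := prod_mono hsub (le_refl (Metric.ball x₀ r))
  exact integral_dual_eq_zero b Metric.isOpen_ball hK hKO hPc
    (hua.contDiffOn_of_completeSpace.mono hsubprod) (fun z hz => hue z (hsubprod hz)) hW hWe hs
    ⟨by linarith, by linarith⟩ hWt hus

end Duality

section Holmgren

set_option maxSynthPendingDepth 3

open Filter Topology

section TimeMaps

variable {E F : Type*} {t₀ t₁ : ℝ} {U : Set E}

/-- The shear of space-time which moves the graph of `t₀ + ρ` to the hyperplane at time `t₀`. -/
def shear (ρ : E → ℝ) (z : ℝ × E) : ℝ × E :=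
  (z.1 - ρ z.2, z.2)

/-- The map which moves all times before `t₀` to `t₀`. -/
def clampTime (t₀ : ℝ) (z : ℝ × E) : ℝ × E :=
  (max z.1 t₀, z.2)

theorem continuous_clampTime [TopologicalSpace E] : Continuous (clampTime t₀ : ℝ × E → ℝ × E) := by
  unfold clampTime
  fun_prop

theorem norm_clampTime_sub_le [SeminormedAddCommGroup E] (y z : ℝ × E) :
    ‖clampTime t₀ y - clampTime t₀ z‖ ≤ ‖y - z‖ := by
  rw [Prod.norm_def, Prod.norm_def]
  exact max_le_max (abs_max_sub_max_le_abs _ _ _) le_rfl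

theorem clampTime_mem (ht : t₀ < t₁) {z : ℝ × E} (hz : z ∈ Iio t₁ ×ˢ U) :
    clampTime t₀ z ∈ Icc t₀ t₁ ×ˢ U :=
  ⟨⟨le_max_right _ _, max_le hz.1.le ht.le⟩, hz.2⟩

theorem clampTime_of_le {z : ℝ × E} (hz : t₀ ≤ z.1) : clampTime t₀ z = z :=
  Prod.ext (max_eq_left hz) rfl

theorem clampTime_of_ge {z : ℝ × E} (hz : z.1 ≤ t₀) : clampTime t₀ z = (t₀, z.2) :=
  Prod.ext (max_eq_right hz) rfl

theorem tendsto_clampTime [TopologicalSpace E] (hU : IsOpen U) (ht : t₀ < t₁) {z : ℝ × E}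
    (hz : z ∈ Iio t₁ ×ˢ U) :
    Tendsto (clampTime t₀) (𝓝 z) (𝓝[Icc t₀ t₁ ×ˢ U] (clampTime t₀ z)) :=
  tendsto_nhdsWithin_iff.2 ⟨continuous_clampTime.continuousAt, by
    filter_upwards [(isOpen_Iio.prod hU).mem_nhds hz] with y hy using clampTime_mem ht hy⟩

open scoped Classical in
/-- The solution `w` in sheared coordinates, cut off outside the sublevel set `{ρ < ε}`. Since `w`
vanishes in the past, the cut-off is invisible at times close to `t₀`. -/
def shearedSolution (ρ : E → ℝ) (ε : ℝ) [Zero F] (w : ℝ × E → F) (z : ℝ × E) : F :=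
  if ρ z.2 < ε then w (shear ρ z) else 0

theorem shearedSolution_of_lt [Zero F] {ρ : E → ℝ} {ε : ℝ} {w : ℝ × E → F} {z : ℝ × E}
    (hz : ρ z.2 < ε) :
    shearedSolution ρ ε w z = w (shear ρ z) :=
  if_pos hz

end TimeMaps

variable {E : Type*} [NormedAddCommGroup E] [NormedSpace ℝ E]
  {F : Type*} [NormedAddCommGroup F] [NormedSpace ℝ F]

/-- An analytic function with a well at `x₀`, whose sublevel sets shrink to `x₀`. Its translated
graphs are the noncharacteristic hypersurfaces sweeping out a neighborhood in the proof of
Holmgren's theorem. -/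
structure IsAnalyticWell (x₀ : E) (ρ : E → ℝ) : Prop where
  analyticAt : ∀ x, AnalyticAt ℝ ρ x
  nonneg : ∀ x, 0 ≤ ρ x
  apply_self : ρ x₀ = 0
  exists_lt_imp_mem : ∀ U ∈ 𝓝 x₀, ∃ ε > 0, ∀ x, ρ x < ε → x ∈ U

theorem exists_isAnalyticWell [FiniteDimensional ℝ E] (x₀ : E) : ∃ ρ, IsAnalyticWell x₀ ρ := by
  refine ⟨fun x => ‖toEuclidean (x - x₀)‖ ^ 2, fun x => ?_, fun x => by positivity, by simp,
    fun U hU => ?_⟩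
  · have h : ContDiff ℝ ω fun x : E => ‖toEuclidean (x - x₀)‖ ^ 2 :=
      ContDiff.norm_sq ℝ (toEuclidean.contDiff.comp (contDiff_id.sub contDiff_const))
    exact h.contDiffAt.analyticAt
  · have hnhds : (fun v => x₀ + toEuclidean.symm v) ⁻¹' U ∈
        𝓝 (0 : EuclideanSpace ℝ (Fin (Module.finrank ℝ E))) :=
      ContinuousAt.preimage_mem_nhds (by fun_prop) (by simpa using hU)
    obtain ⟨ε, hε, hεU⟩ := Metric.mem_nhds_iff.1 hnhds
    refine ⟨ε ^ 2, by positivity, fun x hx => ?_⟩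
    simpa using hεU (mem_ball_zero_iff.2 (lt_of_pow_lt_pow_left₀ 2 hε.le hx))

namespace IsAnalyticWell

variable {x₀ : E} {ρ : E → ℝ}

theorem continuous (hρ : IsAnalyticWell x₀ ρ) : Continuous ρ :=
  continuous_iff_continuousAt.2 fun x => (hρ.analyticAt x).continuousAt

theorem differentiable (hρ : IsAnalyticWell x₀ ρ) : Differentiable ℝ ρ := fun x =>
  (hρ.analyticAt x).differentiableAt

theorem continuous_fderiv (hρ : IsAnalyticWell x₀ ρ) : Continuous (fderiv ℝ ρ) :=
  continuous_iff_continuousAt.2 fun x => (hρ.analyticAt x).fderiv.continuousAt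

theorem fderiv_eq_zero (hρ : IsAnalyticWell x₀ ρ) : fderiv ℝ ρ x₀ = 0 :=
  IsLocalMin.fderiv_eq_zero (Eventually.of_forall fun x => hρ.apply_self.trans_le (hρ.nonneg x))

end IsAnalyticWell

/-- The derivative of `shear ρ`. -/
def shearDeriv (ρ : E → ℝ) (z : ℝ × E) : (ℝ × E) →L[ℝ] (ℝ × E) :=
  (ContinuousLinearMap.fst ℝ ℝ E - (fderiv ℝ ρ z.2).comp (ContinuousLinearMap.snd ℝ ℝ E)).prod
    (ContinuousLinearMap.snd ℝ ℝ E)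

theorem hasFDerivAt_shear {ρ : E → ℝ} (hρ : Differentiable ℝ ρ) (z : ℝ × E) :
    HasFDerivAt (shear ρ) (shearDeriv ρ z) z :=
  ((ContinuousLinearMap.fst ℝ ℝ E).hasFDerivAt.sub
    ((hρ z.2).hasFDerivAt.comp z (ContinuousLinearMap.snd ℝ ℝ E).hasFDerivAt)).prodMk
    (ContinuousLinearMap.snd ℝ ℝ E).hasFDerivAt

theorem continuous_shearDeriv {ρ : E → ℝ} (hρ : Continuous (fderiv ℝ ρ)) :
    Continuous (shearDeriv ρ) := by
  have h : shearDeriv ρ = fun z => (ContinuousLinearMap.inl ℝ ℝ E).comp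
      (ContinuousLinearMap.fst ℝ ℝ E - (fderiv ℝ ρ z.2).comp (ContinuousLinearMap.snd ℝ ℝ E))
      + (ContinuousLinearMap.inr ℝ ℝ E).comp (ContinuousLinearMap.snd ℝ ℝ E) := by
    funext z
    ext v <;> simp [shearDeriv]
  rw [h]
  exact (continuous_const.clm_comp (continuous_const.sub
    ((hρ.comp continuous_snd).clm_comp continuous_const))).add continuous_const

theorem analyticAt_shear {ρ : E → ℝ} {z : ℝ × E} (hρ : AnalyticAt ℝ ρ z.2) :
    AnalyticAt ℝ (shear ρ) z :=
  (analyticAt_fst.sub (hρ.comp_of_eq analyticAt_snd rfl)).prod analyticAt_snd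

/-- The coefficient of the time derivative which the principal part `P` contributes after the
change of variables `shear ρ`. -/
def shearCoeff (P : ℝ × E → (E →L[ℝ] F) →L[ℝ] F) (ρ : E → ℝ) (z : ℝ × E) : F →L[ℝ] F :=
  (P (shear ρ z)).comp (ContinuousLinearMap.smulRightL ℝ E F (fderiv ℝ ρ z.2))

/-- The inverse of the coefficient of the time derivative in the sheared equation, with the junk
value `0` where that coefficient is not invertible. -/
def shearInverse (P : ℝ × E → (E →L[ℝ] F) →L[ℝ] F) (ρ : E → ℝ) (z : ℝ × E) : F →L[ℝ] F :=
  Ring.inverse (1 - shearCoeff P ρ z)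

variable {P : ℝ × E → (E →L[ℝ] F) →L[ℝ] F} {B : ℝ × E → F →L[ℝ] F} {t₀ t₁ : ℝ} {U : Set E}
  {x₀ : E} {ρ : E → ℝ}

namespace IsAnalyticWell

theorem shear_self (hρ : IsAnalyticWell x₀ ρ) (t : ℝ) : shear ρ (t, x₀) = (t, x₀) := by
  simp [shear, hρ.apply_self]

theorem analyticAt_comp_shear {G : Type*} [NormedAddCommGroup G] [NormedSpace ℝ G]
    (hρ : IsAnalyticWell x₀ ρ) {f : ℝ × E → G} (hf : AnalyticAt ℝ f (t₀, x₀)) :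
    AnalyticAt ℝ (fun z => f (shear ρ z)) (t₀, x₀) :=
  hf.comp_of_eq (analyticAt_shear (hρ.analyticAt _)) (hρ.shear_self t₀)

theorem isUnit_one_sub_shearCoeff (hρ : IsAnalyticWell x₀ ρ) :
    IsUnit (1 - shearCoeff P ρ (t₀, x₀)) := by
  simp [shearCoeff, hρ.fderiv_eq_zero]

theorem analyticAt_one_sub_shearCoeff (hρ : IsAnalyticWell x₀ ρ) (hP : AnalyticAt ℝ P (t₀, x₀)) :
    AnalyticAt ℝ (fun z => 1 - shearCoeff P ρ z) (t₀, x₀) :=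
  analyticAt_const.sub <| analyticAt_clm_comp (hρ.analyticAt_comp_shear hP) <|
    analyticAt_clm_apply analyticAt_const ((hρ.analyticAt x₀).fderiv.comp_of_eq analyticAt_snd rfl)

theorem analyticAt_shearInverse [CompleteSpace F] (hρ : IsAnalyticWell x₀ ρ)
    (hP : AnalyticAt ℝ P (t₀, x₀)) : AnalyticAt ℝ (shearInverse P ρ) (t₀, x₀) := by
  have h := analyticAt_inverse (𝕜 := ℝ) (hρ.isUnit_one_sub_shearCoeff (P := P) (t₀ := t₀)).unit
  rw [IsUnit.unit_spec] at h
  exact h.comp_of_eq (f := fun z => 1 - shearCoeff P ρ z) (hρ.analyticAt_one_sub_shearCoeff hP) rfl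

theorem eventually_isUnit_one_sub_shearCoeff [CompleteSpace F] (hρ : IsAnalyticWell x₀ ρ)
    (hP : AnalyticAt ℝ P (t₀, x₀)) : ∀ᶠ z in 𝓝 (t₀, x₀), IsUnit (1 - shearCoeff P ρ z) :=
  (hρ.analyticAt_one_sub_shearCoeff hP).continuousAt.eventually
    (Units.isOpen.mem_nhds hρ.isUnit_one_sub_shearCoeff)

end IsAnalyticWell

theorem apply_shearDeriv_eq_of_isUnit {z : ℝ × E} {y : F} {D : (ℝ × E) →L[ℝ] F}
    (hz : IsUnit (1 - shearCoeff P ρ z))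
    (hD : D (1, 0) = P (shear ρ z) (D.comp (ContinuousLinearMap.inr ℝ ℝ E)) + B (shear ρ z) y) :
    (D.comp (shearDeriv ρ z)) (1, 0) = (shearInverse P ρ z).comp (P (shear ρ z))
        ((D.comp (shearDeriv ρ z)).comp (ContinuousLinearMap.inr ℝ ℝ E))
      + (shearInverse P ρ z).comp (B (shear ρ z)) y := by
  have htime : D.comp (shearDeriv ρ z) (1, 0) = D (1, 0) := by simp [shearDeriv]
  have hspace : (D.comp (shearDeriv ρ z)).comp (ContinuousLinearMap.inr ℝ ℝ E)
      = D.comp (ContinuousLinearMap.inr ℝ ℝ E)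
        - ContinuousLinearMap.smulRightL ℝ E F (fderiv ℝ ρ z.2) (D (1, 0)) := by
    ext v
    have : ((-(fderiv ℝ ρ z.2 v), v) : ℝ × E)
        = (0, v) - (fderiv ℝ ρ z.2 v) • ((1, 0) : ℝ × E) := by simp
    simp only [shearDeriv, ContinuousLinearMap.comp_apply, ContinuousLinearMap.inr_apply,
      ContinuousLinearMap.prod_apply, sub_apply, ContinuousLinearMap.coe_fst',
      ContinuousLinearMap.coe_snd', zero_sub, this, map_sub, map_smul]
    rfl
  have hcancel : (1 - shearCoeff P ρ z) (D (1, 0)) = P (shear ρ z)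
      ((D.comp (shearDeriv ρ z)).comp (ContinuousLinearMap.inr ℝ ℝ E)) + B (shear ρ z) y := by
    rw [hspace, map_sub, sub_add_eq_add_sub, ← hD]
    rfl
  rw [htime, ContinuousLinearMap.comp_apply (shearInverse P ρ z),
    ContinuousLinearMap.comp_apply (shearInverse P ρ z), ← map_add, ← hcancel]
  exact (congrArg (fun L : F →L[ℝ] F => L (D (1, 0))) (Ring.inverse_mul_cancel _ hz)).symm

/-- `w` is continuously differentiable on `[t₀, t₁] × U`, with derivative `w'`, solves the
evolution equation there, and vanishes at time `t₀`. -/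
structure IsNullSolutionOn (P : ℝ × E → (E →L[ℝ] F) →L[ℝ] F) (B : ℝ × E → F →L[ℝ] F) (t₀ t₁ : ℝ)
    (U : Set E) (w : ℝ × E → F) (w' : ℝ × E → (ℝ × E) →L[ℝ] F) : Prop where
  hasFDerivWithinAt : ∀ z ∈ Icc t₀ t₁ ×ˢ U, HasFDerivWithinAt w (w' z) (Icc t₀ t₁ ×ˢ U) z
  continuousOn : ContinuousOn w' (Icc t₀ t₁ ×ˢ U)
  initial : ∀ x ∈ U, w (t₀, x) = 0
  equation : ∀ z ∈ Icc t₀ t₁ ×ˢ U,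
    w' z (1, 0) = P z ((w' z).comp (ContinuousLinearMap.inr ℝ ℝ E)) + B z (w z)

/-- `w` is continuously differentiable on `(-∞, t₁) × U`, with derivative `w'`, solves the evolution
equation there, and vanishes at all times before `t₀`. -/
structure IsPastNullSolutionOn (P : ℝ × E → (E →L[ℝ] F) →L[ℝ] F) (B : ℝ × E → F →L[ℝ] F)
    (t₀ t₁ : ℝ) (U : Set E) (w : ℝ × E → F) (w' : ℝ × E → (ℝ × E) →L[ℝ] F) : Prop where
  hasFDerivAt : ∀ z ∈ Iio t₁ ×ˢ U, HasFDerivAt w (w' z) z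
  continuousOn : ContinuousOn w' (Iio t₁ ×ˢ U)
  eq_zero : ∀ z ∈ Iic t₀ ×ˢ U, w z = 0
  equation : ∀ z ∈ Iio t₁ ×ˢ U,
    w' z (1, 0) = P z ((w' z).comp (ContinuousLinearMap.inr ℝ ℝ E)) + B z (w z)

variable {w : ℝ × E → F} {w' : ℝ × E → (ℝ × E) →L[ℝ] F}

namespace IsNullSolutionOn

theorem deriv_initial (h : IsNullSolutionOn P B t₀ t₁ U w w') (hU : IsOpen U)
    (ht : t₀ < t₁) {x : E} (hx : x ∈ U) : w' (t₀, x) = 0 := by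
  have ht₀ : t₀ ∈ Icc t₀ t₁ := left_mem_Icc.2 ht.le
  have hslice : HasFDerivAt (fun x => w (t₀, x))
      ((w' (t₀, x)).comp (ContinuousLinearMap.inr ℝ ℝ E)) x :=
    HasFDerivWithinAt.hasFDerivAt ((h.hasFDerivWithinAt (t₀, x) ⟨ht₀, hx⟩).comp x
      (hasFDerivAt_prodMk_right t₀ x).hasFDerivWithinAt fun y hy => ⟨ht₀, hy⟩) (hU.mem_nhds hx)
  have hspace : (w' (t₀, x)).comp (ContinuousLinearMap.inr ℝ ℝ E) = 0 :=
    hslice.unique <| (hasFDerivAt_const (0 : F) x).congr_of_eventuallyEq <| by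
      filter_upwards [hU.mem_nhds hx] with y hy using h.initial y hy
  have htime := h.equation (t₀, x) ⟨ht₀, hx⟩
  rw [hspace, h.initial x hx, map_zero, map_zero, add_zero] at htime
  ext
  · simpa using htime
  · exact DFunLike.congr_fun hspace _

theorem hasFDerivAt_comp_clampTime (h : IsNullSolutionOn P B t₀ t₁ U w w')
    (hU : IsOpen U) (ht : t₀ < t₁) {z : ℝ × E} (hz : z ∈ Iio t₁ ×ˢ U) :
    HasFDerivAt (w ∘ clampTime t₀) (w' (clampTime t₀ z)) z := by
  have hder := h.hasFDerivWithinAt _ (clampTime_mem ht hz)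
  rcases lt_or_ge t₀ z.1 with h0 | h0
  · have hnhds : Ioo t₀ t₁ ×ˢ U ∈ 𝓝 z := (isOpen_Ioo.prod hU).mem_nhds ⟨⟨h0, hz.1⟩, hz.2⟩
    rw [clampTime_of_le h0.le] at hder ⊢
    refine (hder.hasFDerivAt
      (mem_of_superset hnhds (prod_mono Ioo_subset_Icc_self le_rfl))).congr_of_eventuallyEq ?_
    filter_upwards [hnhds] with y hy
    rw [Function.comp_apply, clampTime_of_le hy.1.1.le]
  · have hzero : w' (clampTime t₀ z) = 0 := by
      rw [clampTime_of_ge h0]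
      exact h.deriv_initial hU ht hz.2
    rw [hzero] at hder ⊢
    have hlittle := hder.isLittleO.comp_tendsto (tendsto_clampTime hU ht hz)
    refine .of_isLittleO ?_
    simp only [zero_apply, sub_zero, Function.comp_def] at hlittle ⊢
    exact hlittle.trans_isBigO (Asymptotics.isBigO_of_le _ fun y => norm_clampTime_sub_le y z)

theorem isPastNullSolutionOn (h : IsNullSolutionOn P B t₀ t₁ U w w') (hU : IsOpen U)
    (ht : t₀ < t₁) :
    IsPastNullSolutionOn P B t₀ t₁ U (w ∘ clampTime t₀) (w' ∘ clampTime t₀) where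
  hasFDerivAt _ hz := h.hasFDerivAt_comp_clampTime hU ht hz
  continuousOn z hz := (show ContinuousAt _ z from
    (h.continuousOn _ (clampTime_mem ht hz)).tendsto.comp
      (tendsto_clampTime hU ht hz)).continuousWithinAt
  eq_zero z hz := by rw [Function.comp_apply, clampTime_of_ge hz.1, h.initial _ hz.2]
  equation z hz := by
    rcases le_total t₀ z.1 with h0 | h0
    · have hmem := clampTime_mem ht hz
      rw [clampTime_of_le h0] at hmem
      simpa only [Function.comp_apply, clampTime_of_le h0] using h.equation z hmem
    · simp [clampTime_of_ge h0, h.deriv_initial hU ht hz.2, h.initial _ hz.2]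

end IsNullSolutionOn

namespace IsPastNullSolutionOn

variable {ε : ℝ}

theorem shear_mem (hρ : IsAnalyticWell x₀ ρ) (hεU : ∀ x, ρ x < ε → x ∈ U) {z : ℝ × E}
    (ht : z.1 < t₁) (hz : ρ z.2 < ε) : shear ρ z ∈ Iio t₁ ×ˢ U :=
  ⟨(sub_le_self _ (hρ.nonneg _)).trans_lt ht, hεU _ hz⟩

theorem shearedSolution_eq_zero (h : IsPastNullSolutionOn P B t₀ t₁ U w w')
    (hεU : ∀ x, ρ x < ε → x ∈ U) {z : ℝ × E} (hz : z.1 - t₀ ≤ ρ z.2) :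
    shearedSolution ρ ε w z = 0 := by
  by_cases hε : ρ z.2 < ε
  · rw [shearedSolution_of_lt hε]
    exact h.eq_zero _ ⟨sub_le_comm.1 hz, hεU _ hε⟩
  · exact if_neg hε

theorem eventually_lt (hρ : IsAnalyticWell x₀ ρ) {z : ℝ × E} (hz : ρ z.2 < ε) :
    ∀ᶠ y : ℝ × E in 𝓝 z, ρ y.2 < ε :=
  (isOpen_lt (hρ.continuous.comp continuous_snd) continuous_const).mem_nhds hz

theorem hasFDerivAt_shearedSolution (h : IsPastNullSolutionOn P B t₀ t₁ U w w')
    (hρ : IsAnalyticWell x₀ ρ) (hεU : ∀ x, ρ x < ε → x ∈ U) {z : ℝ × E} (ht : z.1 < t₁)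
    (hz : ρ z.2 < ε) :
    HasFDerivAt (shearedSolution ρ ε w) ((w' (shear ρ z)).comp (shearDeriv ρ z)) z := by
  refine ((h.hasFDerivAt _ (shear_mem hρ hεU ht hz)).comp z
    (hasFDerivAt_shear hρ.differentiable z)).congr_of_eventuallyEq ?_
  filter_upwards [eventually_lt hρ hz] with y hy using shearedSolution_of_lt hy

theorem eventuallyEq_zero_of_le (h : IsPastNullSolutionOn P B t₀ t₁ U w w')
    (hρ : IsAnalyticWell x₀ ρ) (hεU : ∀ x, ρ x < ε → x ∈ U) {z : ℝ × E} (ht : z.1 < t₀ + ε)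
    (hz : ε ≤ ρ z.2) : shearedSolution ρ ε w =ᶠ[𝓝 z] fun _ => 0 := by
  have hρc := hρ.continuous
  have hlt : z.1 - t₀ < ρ z.2 := by linarith
  filter_upwards [(isOpen_lt (f := fun z : ℝ × E => z.1 - t₀) (g := fun z : ℝ × E => ρ z.2)
    (by fun_prop) (by fun_prop)).mem_nhds hlt] with y hy using h.shearedSolution_eq_zero hεU hy.le

theorem continuousAt_fderiv_shearedSolution (h : IsPastNullSolutionOn P B t₀ t₁ U w w')
    (hU : IsOpen U) (hρ : IsAnalyticWell x₀ ρ) (hεU : ∀ x, ρ x < ε → x ∈ U) {z : ℝ × E}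
    (ht : z.1 < t₁) (hz : ρ z.2 < ε) : ContinuousAt (fderiv ℝ (shearedSolution ρ ε w)) z := by
  have hnear : ∀ᶠ y : ℝ × E in 𝓝 z, y.1 < t₁ ∧ ρ y.2 < ε :=
    (continuousAt_fst.eventually (Iio_mem_nhds ht)).and (eventually_lt hρ hz)
  have hfd : fderiv ℝ (shearedSolution ρ ε w) =ᶠ[𝓝 z]
      fun y => (w' (shear ρ y)).comp (shearDeriv ρ y) := by
    filter_upwards [hnear] with y hy using
      (h.hasFDerivAt_shearedSolution hρ hεU hy.1 hy.2).fderiv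
  have hw' : ContinuousAt w' (shear ρ z) :=
    h.continuousOn.continuousAt ((isOpen_Iio.prod hU).mem_nhds (shear_mem hρ hεU ht hz))
  exact ((hw'.comp (hasFDerivAt_shear hρ.differentiable z).continuousAt).clm_comp
    (continuous_shearDeriv hρ.continuous_fderiv).continuousAt).congr hfd.symm

theorem isC1SupportedOn_shearedSolution (h : IsPastNullSolutionOn P B t₀ t₁ U w w')
    (hU : IsOpen U) (hρ : IsAnalyticWell x₀ ρ) (hεU : ∀ x, ρ x < ε → x ∈ U) {K : Set E}
    (hεK : ∀ x, ρ x < ε → x ∈ K) {J : Set ℝ} (hJ : ∀ t ∈ J, t < t₁ ∧ t < t₀ + ε) :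
    IsC1SupportedOn J K (shearedSolution ρ ε w) where
  differentiableAt z hz := by
    rcases lt_or_ge (ρ z.2) ε with hzε | hzε
    · exact (h.hasFDerivAt_shearedSolution hρ hεU (hJ _ hz.1).1 hzε).differentiableAt
    · exact (differentiableAt_const (0 : F)).congr_of_eventuallyEq
        (h.eventuallyEq_zero_of_le hρ hεU (hJ _ hz.1).2 hzε)
  continuousOn_fderiv z hz := by
    refine ContinuousAt.continuousWithinAt ?_
    rcases lt_or_ge (ρ z.2) ε with hzε | hzε
    · exact h.continuousAt_fderiv_shearedSolution hU hρ hεU (hJ _ hz.1).1 hzε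
    · refine (continuousAt_const (y := (0 : (ℝ × E) →L[ℝ] F))).congr ?_
      filter_upwards [(h.eventuallyEq_zero_of_le hρ hεU (hJ _ hz.1).2 hzε).eventuallyEq_nhds]
        with y hy
      rw [hy.fderiv_eq, fderiv_const_apply]
  eq_zero _ _ x hx := if_neg fun hxε => hx (hεK x hxε)

theorem solvesEvolutionAt_shearedSolution (h : IsPastNullSolutionOn P B t₀ t₁ U w w')
    (hρ : IsAnalyticWell x₀ ρ) (hεU : ∀ x, ρ x < ε → x ∈ U) {z : ℝ × E} (ht₁ : z.1 < t₁)
    (ht₀ : z.1 < t₀ + ε) (hz : IsUnit (1 - shearCoeff P ρ z)) :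
    SolvesEvolutionAt (fun z => (shearInverse P ρ z).comp (P (shear ρ z)))
      (fun z => (shearInverse P ρ z).comp (B (shear ρ z))) (shearedSolution ρ ε w) z := by
  rcases lt_or_ge (ρ z.2) ε with hzε | hzε
  · rw [SolvesEvolutionAt, (h.hasFDerivAt_shearedSolution hρ hεU ht₁ hzε).fderiv,
      shearedSolution_of_lt hzε]
    exact apply_shearDeriv_eq_of_isUnit hz (h.equation _ (shear_mem hρ hεU ht₁ hzε))
  · have hzero := h.eventuallyEq_zero_of_le hρ hεU ht₀ hzε
    rw [SolvesEvolutionAt, hzero.fderiv_eq, hzero.eq_of_nhds]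
    simp

end IsPastNullSolutionOn

open IsPastNullSolutionOn in
theorem exists_forall_eq_zero_of_isNullSolutionOn [FiniteDimensional ℝ E] [CompleteSpace F]
    (hP : AnalyticAt ℝ P (t₀, x₀)) (hB : AnalyticAt ℝ B (t₀, x₀))
    (hU : IsOpen U) (hx₀ : x₀ ∈ U) (ht : t₀ < t₁) :
    ∃ δ > 0, ∃ V : Set E, IsOpen V ∧ x₀ ∈ V ∧ V ⊆ U ∧
      ∀ w w', IsNullSolutionOn P B t₀ t₁ U w w' →
        ∀ t ∈ Icc t₀ (t₀ + δ), ∀ x ∈ V, w (t, x) = 0 := by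
  obtain ⟨ρ, hρ⟩ := exists_isAnalyticWell x₀
  have hinv := hρ.analyticAt_shearInverse hP
  obtain ⟨r₀, hr₀, hcore⟩ := exists_forall_eq_zero_of_solvesEvolutionAt
    (analyticAt_clm_comp hinv (hρ.analyticAt_comp_shear hP))
    (analyticAt_clm_comp hinv (hρ.analyticAt_comp_shear hB))
  obtain ⟨r₁, hr₁, hunit⟩ := Metric.eventually_nhds_iff_ball.1
    (hρ.eventually_isUnit_one_sub_shearCoeff hP)
  set r := min r₀ r₁
  have hr : 0 < r := by positivity
  obtain ⟨δ₀, hδ₀, hδcore⟩ := hcore r hr (min_le_left _ _)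
  obtain ⟨ε, hε, hρε⟩ := hρ.exists_lt_imp_mem (U ∩ Metric.closedBall x₀ (r / 2))
    (inter_mem (hU.mem_nhds hx₀) (Metric.closedBall_mem_nhds x₀ (by positivity)))
  have hεU : ∀ x, ρ x < ε → x ∈ U := fun x hx => (hρε x hx).1
  obtain ⟨δ, hδ, hδδ₀, hδr₁, hδε, hδt₁⟩ :
      ∃ δ > 0, δ ≤ δ₀ ∧ δ ≤ r₁ ∧ δ ≤ ε ∧ δ ≤ t₁ - t₀ := by
    have : 0 < t₁ - t₀ := sub_pos.2 ht
    exact ⟨min (min δ₀ r₁) (min ε (t₁ - t₀)), by positivity, by grind, by grind, by grind,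
      by grind⟩
  refine ⟨δ / 4, by positivity, {x | ρ x < δ / 2}, isOpen_lt hρ.continuous continuous_const,
    by simp [hρ.apply_self, hδ], fun x (hx : ρ x < δ / 2) => hεU x (by linarith),
    fun w w' h t htt x (hx : ρ x < δ / 2) => ?_⟩
  have hpast := h.isPastNullSolutionOn hU ht
  have hzero := hδcore δ hδ hδδ₀ (shearedSolution ρ ε (w ∘ clampTime t₀))
    (hpast.isC1SupportedOn_shearedSolution hU hρ hεU (fun x hx => (hρε x hx).2)
      fun t ht => ⟨by linarith [ht.2], by linarith [ht.2]⟩)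
    (fun x => hpast.shearedSolution_eq_zero hεU (by simpa using hρ.nonneg x))
    (fun z hz => hpast.solvesEvolutionAt_shearedSolution hρ hεU (by linarith [hz.1.2])
      (by linarith [hz.1.2]) (hunit z ?_))
    (t + ρ x) ⟨by linarith [htt.1, hρ.nonneg x], by linarith [htt.2]⟩ x
  · rwa [shearedSolution_of_lt (by linarith), Function.comp_apply, shear, add_sub_cancel_right,
      clampTime_of_le htt.1] at hzero
  · rw [← ball_prod_same, Real.ball_eq_Ioo]
    exact ⟨Ioo_subset_Ioo (by linarith) (by linarith) hz.1,
      Metric.ball_subset_ball (min_le_right _ _) hz.2⟩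

end Holmgren

section TensorCalculus

set_option maxSynthPendingDepth 3

variable {E : Type*} [NormedAddCommGroup E] [NormedSpace ℝ E]

theorem isUnit_of_isInvertible {L : E →L[ℝ] E} (hL : L.IsInvertible) : IsUnit L := by
  obtain ⟨e, rfl⟩ := hL
  exact ⟨ContinuousLinearEquiv.toUnit e, rfl⟩

theorem update_id_comp {ι : Type*} [DecidableEq ι] (D k : E →L[ℝ] E) (i : ι) :
    (fun l => (Function.update (fun _ => ContinuousLinearMap.id ℝ E) i D l).comp k)
      = Function.update (fun _ => k) i (D.comp k) :=
  funext fun l =>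
    Function.apply_update (fun _ L => L.comp k) (fun _ => ContinuousLinearMap.id ℝ E) i D l

theorem comp_update_id {ι : Type*} [DecidableEq ι] (D k : E →L[ℝ] E) (i : ι) :
    (fun l => k.comp (Function.update (fun _ => ContinuousLinearMap.id ℝ E) i D l))
      = Function.update (fun _ => k) i (k.comp D) :=
  funext fun l =>
    Function.apply_update (fun _ L => k.comp L) (fun _ => ContinuousLinearMap.id ℝ E) i D l

variable {H : Type*} [NormedAddCommGroup H] [NormedSpace ℝ H] {z : H}

section Inverse

variable [CompleteSpace E] {J : H → E →L[ℝ] E}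

theorem analyticAt_clm_inverse (hJ : AnalyticAt ℝ J z) (hi : (J z).IsInvertible) :
    AnalyticAt ℝ (fun z => (J z).inverse) z := by
  rw [← ContinuousLinearMap.ringInverse_eq_inverse]
  obtain ⟨u, hu⟩ := isUnit_of_isInvertible hi
  exact AnalyticAt.comp_of_eq (analyticAt_inverse (𝕜 := ℝ) u) hJ hu.symm

theorem hasFDerivAt_clm_inverse {J' : H →L[ℝ] E →L[ℝ] E} (hJ : HasFDerivAt J J' z)
    (hi : (J z).IsInvertible) :
    HasFDerivAt (fun z => (J z).inverse)
      ((-ContinuousLinearMap.mulLeftRight ℝ (E →L[ℝ] E) (J z).inverse (J z).inverse).comp J')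
      z := by
  rw [← ContinuousLinearMap.ringInverse_eq_inverse]
  have hinv := hasFDerivAt_ringInverse (𝕜 := ℝ) (isUnit_of_isInvertible hi).unit
  rw [IsUnit.unit_spec, ← Ring.inverse_unit, IsUnit.unit_spec] at hinv
  exact hinv.comp z hJ

end Inverse

namespace CTensor

variable {p q : ℕ}

/-- The operators `α ↦ ((ω, v) ↦ α(ω₁ ∘ k₁, …, ω_p ∘ k_p, v))` on tensors of type `(p, q)`, as a
multilinear function of `k`. -/
def mapCovectors (p q : ℕ) (E : Type*) [NormedAddCommGroup E] [NormedSpace ℝ E] :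
    ContinuousMultilinearMap ℝ (fun _ : Fin p => E →L[ℝ] E) (CTensor p q E →L[ℝ] CTensor p q E) :=
  (ContinuousMultilinearMap.compContinuousLinearMapContinuousMultilinear ℝ
    (fun _ : Fin p => E →L[ℝ] ℝ) (fun _ : Fin p => E →L[ℝ] ℝ)
    (ContinuousMultilinearMap ℝ (fun _ : Fin q => E) ℂ)).compContinuousLinearMap
    fun _ => (ContinuousLinearMap.compL ℝ E E ℝ).flip

/-- The operators `α ↦ ((ω, v) ↦ α(ω, j₁ v₁, …, j_q v_q))` on tensors of type `(p, q)`, as a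
multilinear function of `j`. -/
def mapVectors (p q : ℕ) (E : Type*) [NormedAddCommGroup E] [NormedSpace ℝ E] :
    ContinuousMultilinearMap ℝ (fun _ : Fin q => E →L[ℝ] E) (CTensor p q E →L[ℝ] CTensor p q E) :=
  (ContinuousLinearMap.compContinuousMultilinearMapL ℝ (fun _ : Fin p => E →L[ℝ] ℝ)
    (ContinuousMultilinearMap ℝ (fun _ : Fin q => E) ℂ)
    (ContinuousMultilinearMap ℝ (fun _ : Fin q => E) ℂ)).compContinuousMultilinearMap
    (ContinuousMultilinearMap.compContinuousLinearMapContinuousMultilinear ℝ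
      (fun _ : Fin q => E) (fun _ : Fin q => E) ℂ)

theorem mapCovectors_comp (k k' : Fin p → E →L[ℝ] E) (α : CTensor p q E) :
    mapCovectors p q E k (mapCovectors p q E k' α)
      = mapCovectors p q E (fun i => (k i).comp (k' i)) α := rfl

theorem mapVectors_comp (j j' : Fin q → E →L[ℝ] E) (α : CTensor p q E) :
    mapVectors p q E j (mapVectors p q E j' α)
      = mapVectors p q E (fun i => (j' i).comp (j i)) α := rfl

theorem mapCovectors_mapVectors (k : Fin p → E →L[ℝ] E) (j : Fin q → E →L[ℝ] E)
    (α : CTensor p q E) :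
    mapCovectors p q E k (mapVectors p q E j α) = mapVectors p q E j (mapCovectors p q E k α) :=
  rfl

theorem pullback_eq (J : E →L[ℝ] E) (α : CTensor p q E) :
    pullback J α = mapCovectors p q E (fun _ => J.inverse) (mapVectors p q E (fun _ => J) α) := rfl

theorem actCovector_eq (L : E →L[ℝ] E) (i : Fin p) (α : CTensor p q E) :
    actCovector L i α
      = mapCovectors p q E (Function.update (fun _ => ContinuousLinearMap.id ℝ E) i L) α := by
  ext η v
  exact congr_arg₂ (fun η v => α η v)
    (funext fun l => by rcases eq_or_ne l i with rfl | h <;> simp [*]) rfl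

theorem actVector_eq (L : E →L[ℝ] E) (i : Fin q) (α : CTensor p q E) :
    actVector L i α
      = mapVectors p q E (Function.update (fun _ => ContinuousLinearMap.id ℝ E) i L) α := rfl

/-- The zeroth order part of the Lie derivative along a vector field with differential `D`. -/
def lieZeroth (p q : ℕ) (D : E →L[ℝ] E) : CTensor p q E →L[ℝ] CTensor p q E :=
  ∑ j, mapVectors p q E (Function.update (fun _ => ContinuousLinearMap.id ℝ E) j D)
    - ∑ i, mapCovectors p q E (Function.update (fun _ => ContinuousLinearMap.id ℝ E) i D)

theorem lieFlat_eq (X : E → E) (A : E → CTensor p q E) (y : E) :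
    lieFlat X A y = fderiv ℝ A y (X y) + lieZeroth p q (fderiv ℝ X y) (A y) := by
  simp only [lieFlat, lieZeroth, actCovector_eq, actVector_eq, sub_apply, sum_apply]
  abel

theorem lieZeroth_sub (D N : E →L[ℝ] E) (α : CTensor p q E) :
    lieZeroth p q (D - N) α = lieZeroth p q D α - lieZeroth p q N α := by
  simp only [lieZeroth, ContinuousMultilinearMap.map_update_sub, sub_apply, sum_apply,
    Finset.sum_sub_distrib]
  abel

theorem analyticAt_lieZeroth {D : H → E →L[ℝ] E} (hD : AnalyticAt ℝ D z) :
    AnalyticAt ℝ (fun z => lieZeroth p q (D z)) z := by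
  refine AnalyticAt.sub ?_ ?_
  · exact Finset.analyticAt_fun_sum _ fun j _ => analyticAt_clm_apply analyticAt_const hD
      (f := fun _ => (mapVectors p q E).toContinuousLinearMap
        (fun _ => ContinuousLinearMap.id ℝ E) j)
  · exact Finset.analyticAt_fun_sum _ fun j _ => analyticAt_clm_apply analyticAt_const hD
      (f := fun _ => (mapCovectors p q E).toContinuousLinearMap
        (fun _ => ContinuousLinearMap.id ℝ E) j)

theorem lieZeroth_pullback {J : E →L[ℝ] E} (hJ : J.IsInvertible) (D : E →L[ℝ] E)
    (α : CTensor p q E) :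
    lieZeroth p q (J.inverse.comp (D.comp J)) (pullback J α)
      = pullback J (lieZeroth p q D α) := by
  have hJD : J.comp (J.inverse.comp (D.comp J)) = D.comp J := by
    ext v; simp [hJ.self_apply_inverse]
  have hDJ : (J.inverse.comp (D.comp J)).comp J.inverse = J.inverse.comp D := by
    ext v; simp [hJ.self_apply_inverse]
  simp only [pullback_eq, lieZeroth, sub_apply, sum_apply, map_sub, map_sum]
  congr 1
  · simp only [← mapCovectors_mapVectors, mapVectors_comp, comp_update_id, update_id_comp, hJD]
  · simp only [mapCovectors_mapVectors, mapCovectors_comp, comp_update_id, update_id_comp, hDJ]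

theorem linearDeriv_mapVectors_apply {L : E →L[ℝ] E} (hL : L.IsInvertible) (N : E →L[ℝ] E)
    (α : CTensor p q E) :
    (mapVectors p q E).linearDeriv (fun _ => L) (fun _ => N) α
      = ∑ j, mapVectors p q E
          (Function.update (fun _ => ContinuousLinearMap.id ℝ E) j (L.inverse.comp N))
          (mapVectors p q E (fun _ => L) α) := by
  have hLN : L.comp (L.inverse.comp N) = N := by
    ext v; simp [hL.self_apply_inverse]
  simp only [ContinuousMultilinearMap.linearDeriv_apply, sum_apply, mapVectors_comp,
    comp_update_id, hLN]

theorem linearDeriv_mapCovectors_apply (L N : E →L[ℝ] E) (α : CTensor p q E) :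
    (mapCovectors p q E).linearDeriv (fun _ => L) (fun _ => (L.comp N).comp L) α
      = ∑ i, mapCovectors p q E
          (Function.update (fun _ => ContinuousLinearMap.id ℝ E) i (L.comp N))
          (mapCovectors p q E (fun _ => L) α) := by
  simp only [ContinuousMultilinearMap.linearDeriv_apply, sum_apply, mapCovectors_comp,
    update_id_comp]

variable [CompleteSpace E] {J : H → E →L[ℝ] E} {A : H → CTensor p q E}

theorem analyticAt_pullback (hJ : AnalyticAt ℝ J z) (hi : (J z).IsInvertible)
    (hA : AnalyticAt ℝ A z) : AnalyticAt ℝ (fun z => pullback (J z) (A z)) z := by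
  have hcov : AnalyticAt ℝ (fun z => mapCovectors p q E fun _ => (J z).inverse) z :=
    (mapCovectors p q E).analyticAt.comp_of_eq
      (AnalyticAt.pi fun _ => analyticAt_clm_inverse hJ hi) rfl
  have hvec : AnalyticAt ℝ (fun z => mapVectors p q E fun _ => J z) z :=
    (mapVectors p q E).analyticAt.comp_of_eq (AnalyticAt.pi fun _ => hJ) rfl
  exact analyticAt_clm_apply hcov (analyticAt_clm_apply hvec hA)

variable {J' : H →L[ℝ] E →L[ℝ] E} {A' : H →L[ℝ] CTensor p q E}

theorem hasFDerivAt_pullback (hJ : HasFDerivAt J J' z) (hi : (J z).IsInvertible)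
    (hA : HasFDerivAt A A' z) :
    ∃ G : H →L[ℝ] CTensor p q E, HasFDerivAt (fun z => pullback (J z) (A z)) G z ∧
      ∀ v, G v = pullback (J z) (A' v)
        + lieZeroth p q ((J z).inverse.comp (J' v)) (pullback (J z) (A z)) := by
  have hcov := ((mapCovectors p q E).hasFDerivAt fun _ => (J z).inverse).comp z
    (hasFDerivAt_pi.2 fun _ : Fin p => hasFDerivAt_clm_inverse hJ hi)
  have hvec := ((mapVectors p q E).hasFDerivAt fun _ => J z).comp z
    (hasFDerivAt_pi.2 fun _ : Fin q => hJ)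
  refine ⟨_, hcov.clm_apply (hvec.clm_apply hA), fun v => ?_⟩
  change mapCovectors p q E (fun _ => (J z).inverse) (mapVectors p q E (fun _ => J z) (A' v)
      + (mapVectors p q E).linearDeriv (fun _ => J z) (fun _ => J' v) (A z))
    + (mapCovectors p q E).linearDeriv (fun _ => (J z).inverse)
      (-fun _ => ((J z).inverse.comp (J' v)).comp (J z).inverse)
      (mapVectors p q E (fun _ => J z) (A z)) = _
  rw [linearDeriv_mapVectors_apply hi, map_neg, neg_apply,
    linearDeriv_mapCovectors_apply]
  simp only [pullback_eq, lieZeroth, map_add, map_sum, sub_apply, sum_apply,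
    mapCovectors_mapVectors]
  abel

theorem fderiv_inverse_fderiv_apply {τ X : E → E} {y : E} (hτ : AnalyticAt ℝ τ y)
    (hi : (fderiv ℝ τ y).IsInvertible) (hX : DifferentiableAt ℝ X (τ y)) :
    fderiv ℝ (fun z => (fderiv ℝ τ z).inverse (X (τ z))) y
      = (fderiv ℝ τ y).inverse.comp ((fderiv ℝ X (τ y)).comp (fderiv ℝ τ y))
        - (fderiv ℝ τ y).inverse.comp
          (fderiv ℝ (fderiv ℝ τ) y ((fderiv ℝ τ y).inverse (X (τ y)))) := by
  have hX' : HasFDerivAt (fun z => (fderiv ℝ τ z).inverse (X (τ z))) _ y :=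
    (hasFDerivAt_clm_inverse hτ.fderiv.differentiableAt.hasFDerivAt hi).clm_apply
    (hX.hasFDerivAt.comp y hτ.differentiableAt.hasFDerivAt)
  have hsymm : IsSymmSndFDerivAt ℝ τ y := hτ.contDiffAt.isSymmSndFDerivAt_of_omega
  ext v
  rw [hX'.fderiv]
  simp [ContinuousLinearMap.mulLeftRight_apply,
    hsymm v ((fderiv ℝ τ y).inverse (X (τ y))), sub_eq_add_neg]

theorem lieFlat_pullback {τ X : E → E} {A : E → CTensor p q E} {y : E}
    (hτ : AnalyticAt ℝ τ y) (hi : (fderiv ℝ τ y).IsInvertible)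
    (hX : DifferentiableAt ℝ X (τ y)) (hA : DifferentiableAt ℝ A (τ y)) :
    lieFlat (fun z => (fderiv ℝ τ z).inverse (X (τ z)))
        (fun z => pullback (fderiv ℝ τ z) (A (τ z))) y
      = pullback (fderiv ℝ τ y) (lieFlat X A (τ y)) := by
  have hAτ : HasFDerivAt (fun z => A (τ z)) ((fderiv ℝ A (τ y)).comp (fderiv ℝ τ y)) y :=
    hA.hasFDerivAt.comp y hτ.differentiableAt.hasFDerivAt
  obtain ⟨G, hG, hG_apply⟩ :=
    hasFDerivAt_pullback hτ.fderiv.differentiableAt.hasFDerivAt hi hAτ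
  -- The second derivative of `τ` enters once through `∂_X A` and once through `DX`, and cancels.
  rw [lieFlat_eq, lieFlat_eq, hG.fderiv, hG_apply, fderiv_inverse_fderiv_apply hτ hi hX,
    lieZeroth_sub, lieZeroth_pullback hi, ContinuousLinearMap.comp_apply, hi.self_apply_inverse]
  simp only [pullback_eq, map_add]
  abel

end CTensor

end TensorCalculus

section Charts

set_option maxSynthPendingDepth 3

open Filter Topology

namespace CTensor

variable {p q : ℕ} {E : Type*} [NormedAddCommGroup E] [NormedSpace ℝ E]

theorem pullback_add (J : E →L[ℝ] E) (α β : CTensor p q E) :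
    pullback J (α + β) = pullback J α + pullback J β := by
  simp only [pullback_eq, map_add]

theorem pullback_I_smul (J : E →L[ℝ] E) (α : CTensor p q E) :
    pullback J (Complex.I • α) = Complex.I • pullback J α := rfl

theorem pullback_comp (B : E →L[ℝ] E) {A : E →L[ℝ] E} (hA : A.IsInvertible)
    (α : CTensor p q E) : pullback (B.comp A) α = pullback A (pullback B α) := by
  simp only [pullback_eq, mapCovectors_mapVectors, mapCovectors_comp, mapVectors_comp,
    hA.inverse_comp_of_right]

theorem pullback_id (α : CTensor p q E) : pullback (ContinuousLinearMap.id ℝ E) α = α := by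
  rw [pullback_eq, ContinuousLinearMap.inverse_id]
  rfl

theorem hasDerivWithinAt_pullback (J : E →L[ℝ] E) {a : ℝ → CTensor p q E} {a' : CTensor p q E}
    {S : Set ℝ} {t : ℝ} (ha : HasDerivWithinAt a a' S t) :
    HasDerivWithinAt (fun s => pullback J (a s)) (pullback J a') S t :=
  ((mapCovectors p q E fun _ => J.inverse).comp
    (mapVectors p q E fun _ => J)).hasFDerivAt.comp_hasDerivWithinAt t ha

theorem lieFlat_congr {X X' : E → E} {A A' : E → CTensor p q E} {y : E} (hX : X =ᶠ[𝓝 y] X')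
    (hA : A =ᶠ[𝓝 y] A') : lieFlat X A y = lieFlat X' A' y := by
  simp only [lieFlat_eq, hX.fderiv_eq, hA.fderiv_eq, hX.eq_of_nhds, hA.eq_of_nhds]

end CTensor

variable {p q : ℕ} {E : Type*} [NormedAddCommGroup E] [NormedSpace ℝ E]
  {M : Type*} [TopologicalSpace M] [ChartedSpace E M]

/-- The differential at `x` of the chart at `c`, its source `TangentSpace 𝓘(ℝ, E) x` being
definitionally `E`. In the same way vector fields and tensor fields on `M` are written below as
functions from `M` to `E` and to `CTensor p q E`. -/
def chartDeriv (c x : M) : E →L[ℝ] E :=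
  mfderiv 𝓘(ℝ, E) 𝓘(ℝ, E) (extChartAt 𝓘(ℝ, E) c) x

/-- The differential at `y` of the inverse of the chart at `c`. -/
def chartSymmDeriv (c : M) (y : E) : E →L[ℝ] E :=
  mfderiv 𝓘(ℝ, E) 𝓘(ℝ, E) (extChartAt 𝓘(ℝ, E) c).symm y

/-- The coordinate change from the chart at `c` to the chart at `c'`. -/
def transition (E : Type*) [NormedAddCommGroup E] [NormedSpace ℝ E]
    {M : Type*} [TopologicalSpace M] [ChartedSpace E M] (c c' : M) (y : E) : E :=
  extChartAt 𝓘(ℝ, E) c' ((extChartAt 𝓘(ℝ, E) c).symm y)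

theorem tensorInChart_eq (c : M) (α : M → CTensor p q E) (y : E) :
    tensorInChart (M := M) c α y
      = CTensor.pullback (chartSymmDeriv c y) (α ((extChartAt 𝓘(ℝ, E) c).symm y)) := rfl

theorem vectorInChart_eq (c : M) (X : M → E) (y : E) :
    vectorInChart (M := M) c X y
      = (chartSymmDeriv c y).inverse (X ((extChartAt 𝓘(ℝ, E) c).symm y)) := rfl

theorem tensorInChart_realLieDerivative_eq (c : M) (X : M → E) (α : M → CTensor p q E) (y : E) :
    tensorInChart (M := M) c (realLieDerivative (M := M) X α) y
      = CTensor.pullback (chartSymmDeriv c y)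
        (CTensor.pullback (chartDeriv ((extChartAt 𝓘(ℝ, E) c).symm y)
            ((extChartAt 𝓘(ℝ, E) c).symm y))
          (CTensor.lieFlat (vectorInChart (M := M) ((extChartAt 𝓘(ℝ, E) c).symm y) X)
            (tensorInChart (M := M) ((extChartAt 𝓘(ℝ, E) c).symm y) α)
            (extChartAt 𝓘(ℝ, E) ((extChartAt 𝓘(ℝ, E) c).symm y)
              ((extChartAt 𝓘(ℝ, E) c).symm y)))) := rfl

theorem isOpen_chartPart (c : M) {U : Set M} (hU : IsOpen U) : IsOpen (chartPart E c U) :=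
  (continuousOn_extChartAt_symm c).isOpen_inter_preimage (isOpen_extChartAt_target c) hU

theorem chartPart_mono (c : M) {U V : Set M} (h : U ⊆ V) : chartPart E c U ⊆ chartPart E c V :=
  inter_subset_inter_right _ (preimage_mono h)

theorem extChartAt_mem_chartPart {c x : M} {U : Set M}
    (hx : x ∈ (extChartAt 𝓘(ℝ, E) c).source) (hU : x ∈ U) :
    extChartAt 𝓘(ℝ, E) c x ∈ chartPart E c U :=
  ⟨(extChartAt 𝓘(ℝ, E) c).map_source hx, by
    simpa only [mem_preimage, (extChartAt 𝓘(ℝ, E) c).left_inv hx] using hU⟩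

section Transition

variable {c c' : M} {y : E}

theorem transition_mem_target (hy : y ∈ chartPart E c (extChartAt 𝓘(ℝ, E) c').source) :
    transition E c c' y ∈ (extChartAt 𝓘(ℝ, E) c').target :=
  (extChartAt 𝓘(ℝ, E) c').map_source hy.2

theorem extChartAt_symm_transition (hy : y ∈ chartPart E c (extChartAt 𝓘(ℝ, E) c').source) :
    (extChartAt 𝓘(ℝ, E) c').symm (transition E c c' y) = (extChartAt 𝓘(ℝ, E) c).symm y :=
  (extChartAt 𝓘(ℝ, E) c').left_inv hy.2

theorem transition_extChartAt {x : M} (hx : x ∈ (extChartAt 𝓘(ℝ, E) c).source) :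
    transition E c c' (extChartAt 𝓘(ℝ, E) c x) = extChartAt 𝓘(ℝ, E) c' x := by
  rw [transition, (extChartAt 𝓘(ℝ, E) c).left_inv hx]

variable [IsManifold 𝓘(ℝ, E) ω M]

theorem chartSymmDeriv_comp_chartDeriv (hy : y ∈ (extChartAt 𝓘(ℝ, E) c).target) :
    (chartSymmDeriv c y).comp (chartDeriv c ((extChartAt 𝓘(ℝ, E) c).symm y))
      = ContinuousLinearMap.id ℝ E := by
  have : IsManifold 𝓘(ℝ, E) 1 M := IsManifold.of_le (n := ω) le_top
  have h := mfderivWithin_extChartAt_symm_comp_mfderiv_extChartAt hy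
  rwa [ModelWithCorners.range_eq_univ, mfderivWithin_univ] at h

theorem chartDeriv_comp_chartSymmDeriv (hy : y ∈ (extChartAt 𝓘(ℝ, E) c).target) :
    (chartDeriv c ((extChartAt 𝓘(ℝ, E) c).symm y)).comp (chartSymmDeriv c y)
      = ContinuousLinearMap.id ℝ E := by
  have : IsManifold 𝓘(ℝ, E) 1 M := IsManifold.of_le (n := ω) le_top
  have h := mfderiv_extChartAt_comp_mfderivWithin_extChartAt_symm hy
  rwa [ModelWithCorners.range_eq_univ, mfderivWithin_univ] at h

theorem isInvertible_chartSymmDeriv (hy : y ∈ (extChartAt 𝓘(ℝ, E) c).target) :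
    (chartSymmDeriv c y).IsInvertible :=
  .of_inverse (chartSymmDeriv_comp_chartDeriv hy) (chartDeriv_comp_chartSymmDeriv hy)

theorem isInvertible_chartDeriv {x : M} (hx : x ∈ (extChartAt 𝓘(ℝ, E) c).source) :
    (chartDeriv (E := E) c x).IsInvertible := by
  have hy := (extChartAt 𝓘(ℝ, E) c).map_source hx
  rw [← (extChartAt 𝓘(ℝ, E) c).left_inv hx]
  exact .of_inverse (chartDeriv_comp_chartSymmDeriv hy) (chartSymmDeriv_comp_chartDeriv hy)

theorem pullback_chartDeriv_tensorInChart (hy : y ∈ (extChartAt 𝓘(ℝ, E) c).target)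
    (α : M → CTensor p q E) :
    CTensor.pullback (chartDeriv c ((extChartAt 𝓘(ℝ, E) c).symm y))
      (tensorInChart (M := M) c α y) = α ((extChartAt 𝓘(ℝ, E) c).symm y) := by
  rw [tensorInChart_eq,
    ← CTensor.pullback_comp _ (isInvertible_chartDeriv ((extChartAt 𝓘(ℝ, E) c).map_target hy)),
    chartSymmDeriv_comp_chartDeriv hy, CTensor.pullback_id]

theorem analyticAt_transition [CompleteSpace E]
    (hy : y ∈ chartPart E c (extChartAt 𝓘(ℝ, E) c').source) :
    AnalyticAt ℝ (transition E c c') y := by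
  have hsymm : ContMDiffAt 𝓘(ℝ, E) 𝓘(ℝ, E) ω (extChartAt 𝓘(ℝ, E) c).symm y :=
    (contMDiffOn_extChartAt_symm c).contMDiffAt ((isOpen_extChartAt_target c).mem_nhds hy.1)
  have hchart : ContMDiffAt 𝓘(ℝ, E) 𝓘(ℝ, E) ω (extChartAt 𝓘(ℝ, E) c')
      ((extChartAt 𝓘(ℝ, E) c).symm y) :=
    contMDiffAt_extChartAt' (by simpa using hy.2)
  exact (hchart.comp y hsymm).contDiffAt.analyticAt

theorem fderiv_transition (hy : y ∈ chartPart E c (extChartAt 𝓘(ℝ, E) c').source) :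
    fderiv ℝ (transition E c c') y
      = (chartDeriv c' ((extChartAt 𝓘(ℝ, E) c).symm y)).comp (chartSymmDeriv c y) := by
  have : IsManifold 𝓘(ℝ, E) 1 M := IsManifold.of_le (n := ω) le_top
  have hsymm : MDifferentiableAt 𝓘(ℝ, E) 𝓘(ℝ, E) (extChartAt 𝓘(ℝ, E) c).symm y :=
    mdifferentiableOn_extChartAt_symm.mdifferentiableAt
      ((isOpen_extChartAt_target c).mem_nhds hy.1)
  have hchart : MDifferentiableAt 𝓘(ℝ, E) 𝓘(ℝ, E) (extChartAt 𝓘(ℝ, E) c')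
      ((extChartAt 𝓘(ℝ, E) c).symm y) := mdifferentiableAt_extChartAt (by simpa using hy.2)
  have hcomp := mfderiv_comp y hchart hsymm
  rwa [mfderiv_eq_fderiv] at hcomp

theorem isInvertible_fderiv_transition
    (hy : y ∈ chartPart E c (extChartAt 𝓘(ℝ, E) c').source) :
    (fderiv ℝ (transition E c c') y).IsInvertible := by
  rw [fderiv_transition hy]
  exact (isInvertible_chartDeriv hy.2).comp (isInvertible_chartSymmDeriv hy.1)

theorem chartSymmDeriv_transition (hy : y ∈ chartPart E c (extChartAt 𝓘(ℝ, E) c').source) :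
    (chartSymmDeriv c' (transition E c c' y)).comp (fderiv ℝ (transition E c c') y)
      = chartSymmDeriv c y := by
  have hid := chartSymmDeriv_comp_chartDeriv (transition_mem_target hy)
  rw [extChartAt_symm_transition hy] at hid
  rw [fderiv_transition hy, ← ContinuousLinearMap.comp_assoc, hid, ContinuousLinearMap.id_comp]

theorem tensorInChart_transition (hy : y ∈ chartPart E c (extChartAt 𝓘(ℝ, E) c').source)
    (α : M → CTensor p q E) :
    tensorInChart (M := M) c α y = CTensor.pullback (fderiv ℝ (transition E c c') y)
      (tensorInChart (M := M) c' α (transition E c c' y)) := by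
  rw [tensorInChart_eq, tensorInChart_eq, extChartAt_symm_transition hy,
    ← CTensor.pullback_comp _ (isInvertible_fderiv_transition hy), chartSymmDeriv_transition hy]

theorem vectorInChart_transition (hy : y ∈ chartPart E c (extChartAt 𝓘(ℝ, E) c').source)
    (X : M → E) :
    vectorInChart (M := M) c X y = (fderiv ℝ (transition E c c') y).inverse
      (vectorInChart (M := M) c' X (transition E c c' y)) := by
  rw [vectorInChart_eq, vectorInChart_eq, extChartAt_symm_transition hy,
    ← chartSymmDeriv_transition hy,
    (isInvertible_fderiv_transition hy).inverse_comp_of_right, ContinuousLinearMap.comp_apply]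

theorem tensorInChart_realLieDerivative [CompleteSpace E] {X : M → E} {α : M → CTensor p q E}
    (hy : y ∈ (extChartAt 𝓘(ℝ, E) c).target)
    (hX : DifferentiableAt ℝ (vectorInChart (M := M) c X) y)
    (hα : DifferentiableAt ℝ (tensorInChart (M := M) c α) y) :
    tensorInChart (M := M) c (realLieDerivative (M := M) X α) y
      = CTensor.lieFlat (vectorInChart (M := M) c X) (tensorInChart (M := M) c α) y := by
  set x := (extChartAt 𝓘(ℝ, E) c).symm y with hxdef
  have hxc : x ∈ (extChartAt 𝓘(ℝ, E) c).source := (extChartAt 𝓘(ℝ, E) c).map_target hy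
  have hxx : x ∈ (extChartAt 𝓘(ℝ, E) x).source := mem_extChartAt_source x
  have hz : extChartAt 𝓘(ℝ, E) x x ∈ chartPart E x (extChartAt 𝓘(ℝ, E) c).source :=
    extChartAt_mem_chartPart hxx hxc
  have hzy : transition E x c (extChartAt 𝓘(ℝ, E) x x) = y := by
    rw [transition_extChartAt hxx, hxdef, (extChartAt 𝓘(ℝ, E) c).right_inv hy]
  have hnear : ∀ᶠ w in 𝓝 (extChartAt 𝓘(ℝ, E) x x),
      w ∈ chartPart E x (extChartAt 𝓘(ℝ, E) c).source :=
    (isOpen_chartPart x (isOpen_extChartAt_source c)).mem_nhds hz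
  have hflat : CTensor.lieFlat (vectorInChart (M := M) x X) (tensorInChart (M := M) x α)
      (extChartAt 𝓘(ℝ, E) x x) = CTensor.pullback
        (fderiv ℝ (transition E x c) (extChartAt 𝓘(ℝ, E) x x))
        (CTensor.lieFlat (vectorInChart (M := M) c X) (tensorInChart (M := M) c α) y) := by
    rw [CTensor.lieFlat_congr (hnear.mono fun w hw => vectorInChart_transition hw X)
        (hnear.mono fun w hw => tensorInChart_transition hw α),
      CTensor.lieFlat_pullback (analyticAt_transition hz) (isInvertible_fderiv_transition hz)
        (by rwa [hzy]) (by rwa [hzy]), hzy]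
  have hid := chartSymmDeriv_comp_chartDeriv ((extChartAt 𝓘(ℝ, E) x).map_source hxx)
  rw [(extChartAt 𝓘(ℝ, E) x).left_inv hxx] at hid
  rw [tensorInChart_realLieDerivative_eq, ← hxdef, hflat,
    ← CTensor.pullback_comp _ (isInvertible_chartDeriv hxx), fderiv_transition hz,
    (extChartAt 𝓘(ℝ, E) x).left_inv hxx, ContinuousLinearMap.comp_assoc, hid,
    ContinuousLinearMap.comp_id, ← CTensor.pullback_comp _ (isInvertible_chartSymmDeriv hy),
    chartDeriv_comp_chartSymmDeriv hy, CTensor.pullback_id]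

end Transition

end Charts

section TransportEquation

set_option maxSynthPendingDepth 3

open Filter Topology

variable {p q : ℕ} {E : Type*} [NormedAddCommGroup E] [NormedSpace ℝ E]

/-- The first order part of the complex Lie derivative along the path of complex vector fields with
real and imaginary part `h = (Re Z, Im Z)`. -/
def lieFirstOrder (p q : ℕ) (h : ℝ × E → E × E) (z : ℝ × E) :
    (E →L[ℝ] CTensor p q E) →L[ℝ] CTensor p q E :=
  ContinuousLinearMap.apply ℝ (CTensor p q E) (h z).1
    + Complex.I • ContinuousLinearMap.apply ℝ (CTensor p q E) (h z).2

/-- The zeroth order part of the complex Lie derivative along the path of complex vector fields with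
real and imaginary part `h = (Re Z, Im Z)`. -/
def lieZerothOrder (p q : ℕ) (h : ℝ × E → E × E) (z : ℝ × E) :
    CTensor p q E →L[ℝ] CTensor p q E :=
  CTensor.lieZeroth p q (fderiv ℝ (fun y => (h (z.1, y)).1) z.2)
    + Complex.I • CTensor.lieZeroth p q (fderiv ℝ (fun y => (h (z.1, y)).2) z.2)

section Analytic

variable {h : ℝ × E → E × E} {z : ℝ × E}

theorem analyticAt_lieFirstOrder (hh : AnalyticAt ℝ h z) :
    AnalyticAt ℝ (lieFirstOrder p q h) z := by
  have happly {v : ℝ × E → E} (hv : AnalyticAt ℝ v z) :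
      AnalyticAt ℝ (fun z => ContinuousLinearMap.apply ℝ (CTensor p q E) (v z)) z :=
    analyticAt_clm_apply analyticAt_const hv
  exact (happly (analyticAt_fst.comp_of_eq hh rfl)).add
    (analyticAt_const.fun_smul (happly (analyticAt_snd.comp_of_eq hh rfl)))

theorem analyticAt_fderiv_slice {F : Type*} [NormedAddCommGroup F] [NormedSpace ℝ F]
    [CompleteSpace F] {f : ℝ × E → F} (hf : AnalyticAt ℝ f z) :
    AnalyticAt ℝ (fun z : ℝ × E => fderiv ℝ (fun y => f (z.1, y)) z.2) z := by
  have hcomp : AnalyticAt ℝ (fun z => (fderiv ℝ f z).comp (ContinuousLinearMap.inr ℝ ℝ E)) z :=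
    analyticAt_clm_comp hf.fderiv analyticAt_const
  refine hcomp.congr ?_
  filter_upwards [hf.eventually_analyticAt] with w hw
  exact (hw.differentiableAt.hasFDerivAt.comp w.2 (hasFDerivAt_prodMk_right w.1 w.2)).fderiv.symm

theorem analyticAt_lieZerothOrder [CompleteSpace E] (hh : AnalyticAt ℝ h z) :
    AnalyticAt ℝ (lieZerothOrder p q h) z :=
  (CTensor.analyticAt_lieZeroth
    (analyticAt_fderiv_slice (f := fun z => (h z).1) (analyticAt_fst.comp_of_eq hh rfl))).add
    (analyticAt_const.fun_smul (CTensor.analyticAt_lieZeroth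
      (analyticAt_fderiv_slice (f := fun z => (h z).2) (analyticAt_snd.comp_of_eq hh rfl))))

theorem lieFlat_add_I_smul_lieFlat {X Y : E → E} {t : ℝ} {y : E}
    (hXY : (fun z => (X z, Y z)) =ᶠ[𝓝 y] fun z => h (t, z)) (A : E → CTensor p q E) :
    CTensor.lieFlat X A y + Complex.I • CTensor.lieFlat Y A y
      = lieFirstOrder p q h (t, y) (fderiv ℝ A y) + lieZerothOrder p q h (t, y) (A y) := by
  have hX : X =ᶠ[𝓝 y] fun z => (h (t, z)).1 := hXY.mono fun z hz => congrArg Prod.fst hz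
  have hY : Y =ᶠ[𝓝 y] fun z => (h (t, z)).2 := hXY.mono fun z hz => congrArg Prod.snd hz
  simp only [CTensor.lieFlat_eq, hX.fderiv_eq, hY.fderiv_eq, hX.eq_of_nhds, hY.eq_of_nhds,
    lieFirstOrder, lieZerothOrder, add_apply, smul_apply, ContinuousLinearMap.apply_apply,
    smul_add]
  abel

end Analytic

variable {M : Type*} [TopologicalSpace M] [ChartedSpace E M]

/-- The path `Z` of complex vector fields on `[0, T) × W` extends to one that is jointly real
analytic on `[0, T] × W`. -/
def IsAnalyticVectorPathOn (Z : ℝ → M → ℂ ⊗[ℝ] E) (T : ℝ) (W : Set M) : Prop :=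
  ∀ c : M, ∃ g : ℝ × E → E × E, AnalyticOn ℝ g (Icc 0 T ×ˢ chartPart E c W) ∧
    ∀ t ∈ Ico 0 T, ∀ y ∈ chartPart E c W, complexVectorInChart (M := M) c (Z t) y = g (t, y)

namespace IsAnalyticVectorPathOn

variable [CompleteSpace E] {Z : ℝ → M → ℂ ⊗[ℝ] E} {T : ℝ} {W : Set M} {c : M} {t : ℝ} {y : E}

theorem exists_analyticAt (hZ : IsAnalyticVectorPathOn Z T W) (ht : t ∈ Ico 0 T)
    (hy : y ∈ chartPart E c W) : ∃ h : ℝ × E → E × E, AnalyticAt ℝ h (t, y) ∧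
      ∀ s ∈ Ico 0 T, ∀ z ∈ chartPart E c W, complexVectorInChart (M := M) c (Z s) z = h (s, z) := by
  obtain ⟨g, hg, hgZ⟩ := hZ c
  obtain ⟨h, -, hgh, hh⟩ := (hg (t, y) ⟨Ico_subset_Icc_self ht, hy⟩).exists_analyticAt
  refine ⟨h, hh, fun s hs z hz => ?_⟩
  rw [hgZ s hs z hz]
  exact hgh (mem_insert_of_mem _ ⟨Ico_subset_Icc_self hs, hz⟩)

theorem differentiableAt (hZ : IsAnalyticVectorPathOn Z T W) (hW : IsOpen W) (ht : t ∈ Ico 0 T)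
    (hy : y ∈ chartPart E c W) :
    DifferentiableAt ℝ (complexVectorInChart (M := M) c (Z t)) y := by
  obtain ⟨h, hh, hhZ⟩ := hZ.exists_analyticAt ht hy
  refine (hh.differentiableAt.comp y
    (hasFDerivAt_prodMk_right t y).differentiableAt).congr_of_eventuallyEq ?_
  filter_upwards [(isOpen_chartPart c hW).mem_nhds hy] with z hz
  exact hhZ t ht z hz

end IsAnalyticVectorPathOn

theorem tensorInChart_complexLieDerivative_eq (Z : M → ℂ ⊗[ℝ] E) (α : M → CTensor p q E) (c : M)
    (y : E) :
    tensorInChart (M := M) c (complexLieDerivative (M := M) Z α) y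
      = tensorInChart (M := M) c
          (realLieDerivative (M := M) (fun x => complexifiedRe (Z x)) α) y
        + Complex.I • tensorInChart (M := M) c
          (realLieDerivative (M := M) (fun x => complexifiedIm (Z x)) α) y := by
  let lie (X : M → E) : CTensor p q E :=
    realLieDerivative (M := M) X α ((extChartAt 𝓘(ℝ, E) c).symm y)
  exact (CTensor.pullback_add (chartSymmDeriv c y) (lie fun x => complexifiedRe (Z x))
      (Complex.I • lie fun x => complexifiedIm (Z x))).trans
    (congrArg (CTensor.pullback (chartSymmDeriv c y) (lie fun x => complexifiedRe (Z x)) + ·)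
      (CTensor.pullback_I_smul (chartSymmDeriv c y) (lie fun x => complexifiedIm (Z x))))

variable [IsManifold 𝓘(ℝ, E) ω M]

theorem tensorInChart_complexLieDerivative [CompleteSpace E] {Z : M → ℂ ⊗[ℝ] E}
    {α : M → CTensor p q E} {c : M} {y : E} {h : ℝ × E → E × E} {t : ℝ}
    (hy : y ∈ (extChartAt 𝓘(ℝ, E) c).target)
    (hZ : DifferentiableAt ℝ (complexVectorInChart (M := M) c Z) y)
    (hZh : complexVectorInChart (M := M) c Z =ᶠ[𝓝 y] fun z => h (t, z))
    (hα : DifferentiableAt ℝ (tensorInChart (M := M) c α) y) :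
    tensorInChart (M := M) c (complexLieDerivative (M := M) Z α) y
      = lieFirstOrder p q h (t, y) (fderiv ℝ (tensorInChart (M := M) c α) y)
        + lieZerothOrder p q h (t, y) (tensorInChart (M := M) c α y) := by
  rw [← lieFlat_add_I_smul_lieFlat hZh]
  refine (tensorInChart_complexLieDerivative_eq Z α c y).trans ?_
  exact congrArg₂ (fun a b : CTensor p q E => a + Complex.I • b)
    (tensorInChart_realLieDerivative hy hZ.fst hα) (tensorInChart_realLieDerivative hy hZ.snd hα)

theorem hasDerivWithinAt_iff_tensorInChart {β : ℝ → M → CTensor p q E} {β' : M → CTensor p q E}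
    {c : M} {y : E} {S : Set ℝ} {t : ℝ} (hy : y ∈ (extChartAt 𝓘(ℝ, E) c).target) :
    HasDerivWithinAt (fun s => β s ((extChartAt 𝓘(ℝ, E) c).symm y))
        (β' ((extChartAt 𝓘(ℝ, E) c).symm y)) S t ↔
      HasDerivWithinAt (fun s => tensorInChart (M := M) c (β s) y)
        (tensorInChart (M := M) c β' y) S t := by
  refine ⟨CTensor.hasDerivWithinAt_pullback (chartSymmDeriv c y), fun h => ?_⟩
  have hback := CTensor.hasDerivWithinAt_pullback
    (chartDeriv c ((extChartAt 𝓘(ℝ, E) c).symm y)) h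
  simpa only [pullback_chartDeriv_tensorInChart hy] using hback

/-- The path `β` of tensor fields read in the chart at `c`, as a function of time and space. -/
def tensorPathInChart (c : M) (β : ℝ → M → CTensor p q E) (z : ℝ × E) : CTensor p q E :=
  tensorInChart (M := M) c (β z.1) z.2

theorem transport_equation_iff_tensorPathInChart [CompleteSpace E] {Z : ℝ → M → ℂ ⊗[ℝ] E}
    {T : ℝ} {W : Set M} (hZ : IsAnalyticVectorPathOn Z T W) (hW : IsOpen W)
    {β : ℝ → M → CTensor p q E} {c : M} {h : ℝ × E → E × E}
    (hh : ∀ s ∈ Ico 0 T, ∀ z ∈ chartPart E c W, complexVectorInChart (M := M) c (Z s) z = h (s, z))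
    {t : ℝ} (ht : t ∈ Ico 0 T) {y : E} (hy : y ∈ chartPart E c W) {A : E →L[ℝ] CTensor p q E}
    (hA : HasFDerivAt (tensorInChart (M := M) c (β t)) A y) (S : Set ℝ) :
    HasDerivWithinAt (fun s => β s ((extChartAt 𝓘(ℝ, E) c).symm y))
        (complexLieDerivative (M := M) (Z t) (β t) ((extChartAt 𝓘(ℝ, E) c).symm y) : CTensor p q E)
        S t ↔
      HasDerivWithinAt (fun s => tensorPathInChart c β (s, y))
        (lieFirstOrder p q h (t, y) A + lieZerothOrder p q h (t, y) (tensorPathInChart c β (t, y)))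
        S t := by
  have hZh : complexVectorInChart (M := M) c (Z t) =ᶠ[𝓝 y] fun z => h (t, z) := by
    filter_upwards [(isOpen_chartPart c hW).mem_nhds hy] with z hz
    exact hh t ht z hz
  have hlie := tensorInChart_complexLieDerivative (α := β t) hy.1
    (hZ.differentiableAt hW ht hy) hZh hA.differentiableAt
  rw [hA.fderiv] at hlie
  exact (hasDerivWithinAt_iff_tensorInChart hy.1).trans (by rw [hlie]; rfl)

end TransportEquation

section CauchyKovalevskaya

open Filter Topology

variable {E : Type*} [NormedAddCommGroup E] [NormedSpace ℝ E] {F : Type*} [NormedAddCommGroup F]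
  [NormedSpace ℝ F]

theorem exists_analyticAt_solvesEvolutionAt [CompleteSpace F]
    {P : ℝ × E → (E →L[ℝ] F) →L[ℝ] F} {B : ℝ × E → F →L[ℝ] F} {f : E → F} {t₀ : ℝ} {x₀ : E}
    (hP : AnalyticAt ℝ P (t₀, x₀)) (hB : AnalyticAt ℝ B (t₀, x₀)) (hf : AnalyticAt ℝ f x₀) :
    ∃ u : ℝ × E → F, ∀ᶠ z in 𝓝 (t₀, x₀),
      AnalyticAt ℝ u z ∧ SolvesEvolutionAt P B u z ∧ u (t₀, z.2) = f z.2 := by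
  obtain ⟨r₀, hr₀, R₀, -, hsolve⟩ := exists_solvesEvolutionAt hP hB
  obtain ⟨r₁, hr₁, R₁, hR₁, K, hK, hfK⟩ := exists_isMajorizedOn_ball_of_analyticAt hf
  have hr : 0 < min r₀ r₁ := lt_min hr₀ hr₁
  obtain ⟨δ, hδ, hδsolve⟩ := hsolve _ hr (min_le_left _ _) _ (le_max_left R₀ R₁)
  have hfr := hfK.mono_set (Metric.ball_subset_ball (min_le_right r₀ r₁))
  have ht₀ : t₀ ∈ Ioo (t₀ - δ) (t₀ + δ) := ⟨by linarith, by linarith⟩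
  obtain ⟨u, hu, hu₀, hueq⟩ := hδsolve f K hK.le
    (hfr.mono_geom hK.le hR₁.le le_rfl (le_max_right _ _)) t₀ ht₀
  refine ⟨u, ?_⟩
  filter_upwards [(isOpen_Ioo.prod Metric.isOpen_ball).mem_nhds ⟨ht₀, Metric.mem_ball_self hr⟩]
    with z hz
  exact ⟨hu z hz, hueq z hz, hu₀ z.2 hz.2⟩

end CauchyKovalevskaya

section LocalUniqueness

set_option maxSynthPendingDepth 3

open Filter Topology

variable {E : Type*} [NormedAddCommGroup E] [NormedSpace ℝ E]

section Slices

variable {F : Type*} [NormedAddCommGroup F] [NormedSpace ℝ F] {w : ℝ × E → F}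
  {w' : ℝ × E →L[ℝ] F} {I : Set ℝ} {S : Set E} {t : ℝ} {y : E}

theorem hasDerivWithinAt_slice (hw : HasFDerivWithinAt w w' (I ×ˢ S) (t, y)) (hy : y ∈ S) :
    HasDerivWithinAt (fun s => w (s, y)) (w' (1, 0)) I t := by
  have hslice : HasDerivWithinAt (fun s : ℝ => (s, y)) ((1 : ℝ), (0 : E)) I t :=
    ((hasDerivAt_id t).prodMk (hasDerivAt_const t y)).hasDerivWithinAt
  exact HasFDerivWithinAt.comp_hasDerivWithinAt t hw hslice fun s hs => ⟨hs, hy⟩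

theorem hasFDerivAt_slice (hw : HasFDerivWithinAt w w' (I ×ˢ S) (t, y)) (ht : t ∈ I)
    (hS : S ∈ 𝓝 y) :
    HasFDerivAt (fun z => w (t, z)) (w'.comp (ContinuousLinearMap.inr ℝ ℝ E)) y :=
  (HasFDerivWithinAt.comp y hw (hasFDerivAt_prodMk_right t y).hasFDerivWithinAt
    fun _ hz => ⟨ht, hz⟩).hasFDerivAt hS

end Slices

variable {p q : ℕ} {M : Type*} [TopologicalSpace M] [ChartedSpace E M]
  {Z : ℝ → M → ℂ ⊗[ℝ] E} {T T' t₀ t₁ : ℝ} {W U : Set M} {α : M → CTensor p q E}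
  {β γ : ℝ → M → CTensor p q E}

namespace IsTransportOn

theorem hasDerivWithinAt (hβ : IsTransportOn (M := M) Z α U T β) {t : ℝ} (ht : t ∈ Icc 0 T)
    {x : M} (hx : x ∈ U) :
    HasDerivWithinAt (fun s => β s x) (complexLieDerivative (M := M) (Z t) (β t) x : CTensor p q E)
      (Icc 0 T) t :=
  hβ.equation t ht x hx

theorem mono (hβ : IsTransportOn (M := M) Z α U T β) {V : Set M} (hV : V ⊆ U) (hT : T' ≤ T) :
    IsTransportOn (M := M) Z α V T' β where
  contDiffOn c := (hβ.contDiffOn c).mono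
    (prod_mono (Icc_subset_Icc le_rfl hT) (chartPart_mono c hV))
  initial x hx := hβ.initial x (hV hx)
  equation _ ht _ hx := HasDerivWithinAt.mono (F := CTensor p q E)
    (hβ.hasDerivWithinAt ⟨ht.1, ht.2.trans hT⟩ (hV hx))
    (Icc_subset_Icc le_rfl hT)

variable {c : M}

theorem contDiffOn_tensorPathInChart (hβ : IsTransportOn (M := M) Z α U T' β) (ht₀ : 0 ≤ t₀)
    (ht₁ : t₁ ≤ T') :
    ContDiffOn ℝ 1 (tensorPathInChart c β) (Icc t₀ t₁ ×ˢ chartPart E c U) :=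
  (hβ.contDiffOn c).mono (prod_mono (Icc_subset_Icc ht₀ ht₁) subset_rfl)

variable [IsManifold 𝓘(ℝ, E) ω M] {h : ℝ × E → E × E}

theorem fderivWithin_equation [CompleteSpace E] (hβ : IsTransportOn (M := M) Z α U T' β)
    (hZ : IsAnalyticVectorPathOn Z T W) (hW : IsOpen W) (hU : IsOpen U) (hUW : U ⊆ W)
    (hh : ∀ s ∈ Ico 0 T, ∀ z ∈ chartPart E c W, complexVectorInChart (M := M) c (Z s) z = h (s, z))
    (ht₀ : 0 ≤ t₀) (ht : t₀ < t₁) (ht₁ : t₁ < T) (ht₁' : t₁ ≤ T') {z : ℝ × E}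
    (hz : z ∈ Icc t₀ t₁ ×ˢ chartPart E c U) :
    fderivWithin ℝ (tensorPathInChart c β) (Icc t₀ t₁ ×ˢ chartPart E c U) z (1, 0)
      = lieFirstOrder p q h z
          ((fderivWithin ℝ (tensorPathInChart c β) (Icc t₀ t₁ ×ˢ chartPart E c U) z).comp
            (ContinuousLinearMap.inr ℝ ℝ E))
        + lieZerothOrder p q h z (tensorPathInChart c β z) := by
  obtain ⟨t, y⟩ := z
  obtain ⟨htI, hy⟩ := hz
  have hβ' := ((hβ.contDiffOn_tensorPathInChart ht₀ ht₁').differentiableOn one_ne_zero (t, y)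
    ⟨htI, hy⟩).hasFDerivWithinAt
  have hspace := hasFDerivAt_slice hβ' htI ((isOpen_chartPart c hU).mem_nhds hy)
  have hequation := ((hβ.hasDerivWithinAt ⟨ht₀.trans htI.1, htI.2.trans ht₁'⟩ hy.2).mono
    (Icc_subset_Icc ht₀ ht₁'))
  exact (uniqueDiffOn_Icc ht t htI).eq_deriv _ (hasDerivWithinAt_slice hβ' hy)
    ((transport_equation_iff_tensorPathInChart hZ hW hh ⟨ht₀.trans htI.1, htI.2.trans_lt ht₁⟩
      (chartPart_mono c hUW hy) hspace _).1 hequation)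

theorem isNullSolutionOn_sub [CompleteSpace E] (hβ : IsTransportOn (M := M) Z α U T' β)
    (hγ : IsTransportOn (M := M) Z α U T' γ) (hZ : IsAnalyticVectorPathOn Z T W) (hW : IsOpen W)
    (hU : IsOpen U) (hUW : U ⊆ W)
    (hh : ∀ s ∈ Ico 0 T, ∀ z ∈ chartPart E c W, complexVectorInChart (M := M) c (Z s) z = h (s, z))
    (ht₀ : 0 ≤ t₀) (ht : t₀ < t₁) (ht₁ : t₁ < T) (ht₁' : t₁ ≤ T')
    (hβγ : ∀ x ∈ U, β t₀ x = γ t₀ x) :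
    IsNullSolutionOn (lieFirstOrder p q h) (lieZerothOrder p q h) t₀ t₁ (chartPart E c U)
      (fun z => tensorPathInChart c β z - tensorPathInChart c γ z)
      (fun z => fderivWithin ℝ (tensorPathInChart c β) (Icc t₀ t₁ ×ˢ chartPart E c U) z
        - fderivWithin ℝ (tensorPathInChart c γ) (Icc t₀ t₁ ×ˢ chartPart E c U) z) := by
  have hβC := hβ.contDiffOn_tensorPathInChart (c := c) ht₀ ht₁'
  have hγC := hγ.contDiffOn_tensorPathInChart (c := c) ht₀ ht₁'
  have hS : UniqueDiffOn ℝ (Icc t₀ t₁ ×ˢ chartPart E c U) :=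
    (uniqueDiffOn_Icc ht).prod (isOpen_chartPart c hU).uniqueDiffOn
  refine ⟨fun z hz => ?_, ?_, fun y hy => ?_, fun z hz => ?_⟩
  · exact (hβC.differentiableOn one_ne_zero z hz).hasFDerivWithinAt.sub
      (hγC.differentiableOn one_ne_zero z hz).hasFDerivWithinAt
  · exact (hβC.continuousOn_fderivWithin hS le_rfl).sub (hγC.continuousOn_fderivWithin hS le_rfl)
  · simp only [tensorPathInChart, tensorInChart_eq, hβγ _ hy.2, sub_self]
  · rw [sub_apply, hβ.fderivWithin_equation hZ hW hU hUW hh ht₀ ht ht₁ ht₁' hz,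
      hγ.fderivWithin_equation hZ hW hU hUW hh ht₀ ht ht₁ ht₁' hz, ContinuousLinearMap.sub_comp,
      map_sub, map_sub]
    abel

end IsTransportOn

theorem isOpen_source_inter_preimage {c : M} {V : Set E} (hV : IsOpen V) :
    IsOpen ((extChartAt 𝓘(ℝ, E) c).source ∩ extChartAt 𝓘(ℝ, E) c ⁻¹' V) :=
  (continuousOn_extChartAt c).isOpen_inter_preimage (isOpen_extChartAt_source c) hV

theorem source_inter_preimage_subset {c : M} {V : Set E} (hV : V ⊆ chartPart E c U) :
    (extChartAt 𝓘(ℝ, E) c).source ∩ extChartAt 𝓘(ℝ, E) c ⁻¹' V ⊆ U := fun x ⟨hx, hxV⟩ => by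
  simpa only [mem_preimage, (extChartAt 𝓘(ℝ, E) c).left_inv hx] using (hV hxV).2

variable [IsManifold 𝓘(ℝ, E) ω M]

theorem eq_of_tensorInChart_eq {c x : M} {α β : M → CTensor p q E}
    (hx : x ∈ (extChartAt 𝓘(ℝ, E) c).source)
    (h : tensorInChart (M := M) c α (extChartAt 𝓘(ℝ, E) c x)
      = tensorInChart (M := M) c β (extChartAt 𝓘(ℝ, E) c x)) : α x = β x := by
  have hy := (extChartAt 𝓘(ℝ, E) c).map_source hx
  have hαβ := (pullback_chartDeriv_tensorInChart hy α).symm.trans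
    ((congrArg _ h).trans (pullback_chartDeriv_tensorInChart hy β))
  rwa [(extChartAt 𝓘(ℝ, E) c).left_inv hx] at hαβ

theorem exists_eqOn_of_isTransportOn [FiniteDimensional ℝ E] (hZ : IsAnalyticVectorPathOn Z T W)
    (hW : IsOpen W) (hU : IsOpen U) (hUW : U ⊆ W) {x₀ : M} (hx₀ : x₀ ∈ U) (ht₀ : 0 ≤ t₀)
    (ht₀T : t₀ < T) (ht₀T' : t₀ < T') :
    ∃ δ > 0, ∃ V, IsOpen V ∧ x₀ ∈ V ∧ V ⊆ U ∧ t₀ + δ ≤ T' ∧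
      ∀ β γ : ℝ → M → CTensor p q E, IsTransportOn (M := M) Z α U T' β →
        IsTransportOn (M := M) Z α U T' γ → (∀ x ∈ U, β t₀ x = γ t₀ x) →
        ∀ t ∈ Icc t₀ (t₀ + δ), ∀ x ∈ V, β t x = γ t x := by
  have : CompleteSpace E := FiniteDimensional.complete ℝ E
  have hx₀c : x₀ ∈ (extChartAt 𝓘(ℝ, E) x₀).source := mem_extChartAt_source x₀
  have hy₀ : extChartAt 𝓘(ℝ, E) x₀ x₀ ∈ chartPart E x₀ U := extChartAt_mem_chartPart hx₀c hx₀
  obtain ⟨h, hh, hhZ⟩ := hZ.exists_analyticAt (t := t₀) ⟨ht₀, ht₀T⟩ (chartPart_mono x₀ hUW hy₀)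
  obtain ⟨t₁, ht₁, ht₁'⟩ := exists_between (lt_min ht₀T ht₀T')
  obtain ⟨ht₁T, ht₁T'⟩ := lt_min_iff.1 ht₁'
  obtain ⟨δ, hδ, V, hV, hyV, hVU, hzero⟩ := exists_forall_eq_zero_of_isNullSolutionOn
    (analyticAt_lieFirstOrder (p := p) (q := q) hh) (analyticAt_lieZerothOrder hh)
    (isOpen_chartPart x₀ hU) hy₀ ht₁
  refine ⟨min δ (T' - t₀), lt_min hδ (sub_pos.2 ht₀T'),
    (extChartAt 𝓘(ℝ, E) x₀).source ∩ extChartAt 𝓘(ℝ, E) x₀ ⁻¹' V, isOpen_source_inter_preimage hV,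
    ⟨hx₀c, hyV⟩, source_inter_preimage_subset hVU, by linarith [min_le_right δ (T' - t₀)],
    fun β γ hβ hγ hβγ t ht x hx => eq_of_tensorInChart_eq hx.1 (sub_eq_zero.1 ?_)⟩
  exact hzero _ _ (hβ.isNullSolutionOn_sub hγ hZ hW hU hUW hhZ ht₀ ht₁ ht₁T ht₁T'.le hβγ) t
    ⟨ht.1, by linarith [ht.2, min_le_left δ (T' - t₀)]⟩ _ hx.2

end LocalUniqueness

section LocalExistence

set_option maxSynthPendingDepth 3

open Filter Topology

variable {p q : ℕ} {E : Type*} [NormedAddCommGroup E] [NormedSpace ℝ E]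
  {M : Type*} [TopologicalSpace M] [ChartedSpace E M]

/-- The path `β` of tensor fields is jointly real analytic on `[0, T] × U`. -/
def IsAnalyticTensorPathOn (β : ℝ → M → CTensor p q E) (U : Set M) (T : ℝ) : Prop :=
  ∀ c : M, AnalyticOn ℝ (tensorPathInChart c β) (Icc 0 T ×ˢ chartPart E c U)

/-- The tensor field on the domain of the chart at `c` whose expression in that chart is `b`. -/
def tensorOfChart (c : M) (b : E → CTensor p q E) (x : M) : CTensor p q E :=
  CTensor.pullback (chartDeriv c x) (b (extChartAt 𝓘(ℝ, E) c x))

variable [IsManifold 𝓘(ℝ, E) ω M] {c : M} {U W : Set M} {u : ℝ × E → CTensor p q E}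

theorem tensorInChart_tensorOfChart {y : E} (hy : y ∈ (extChartAt 𝓘(ℝ, E) c).target)
    (b : E → CTensor p q E) : tensorInChart (M := M) c (tensorOfChart c b) y = b y := by
  rw [tensorInChart_eq, tensorOfChart, ← CTensor.pullback_comp _ (isInvertible_chartSymmDeriv hy),
    chartDeriv_comp_chartSymmDeriv hy, CTensor.pullback_id, (extChartAt 𝓘(ℝ, E) c).right_inv hy]

theorem analyticOnNhd_tensorPathInChart_tensorOfChart [CompleteSpace E] {I : Set ℝ}
    (hU : U ⊆ (extChartAt 𝓘(ℝ, E) c).source) (hu : AnalyticOnNhd ℝ u (I ×ˢ chartPart E c U))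
    (c' : M) :
    AnalyticOnNhd ℝ (tensorPathInChart c' fun t => tensorOfChart (M := M) c fun y => u (t, y))
      (I ×ˢ chartPart E c' U) := by
  rintro ⟨t, y⟩ ⟨ht, hy⟩
  have hyc : y ∈ chartPart E c' (extChartAt 𝓘(ℝ, E) c).source := chartPart_mono c' hU hy
  have hτy : transition E c' c y ∈ chartPart E c U :=
    ⟨transition_mem_target hyc, by
      simpa only [mem_preimage, extChartAt_symm_transition hyc] using hy.2⟩
  have hτ := analyticAt_transition hyc
  have hu' : AnalyticAt ℝ (fun z : ℝ × E => u (z.1, transition E c' c z.2)) (t, y) :=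
    (hu (t, transition E c' c y) ⟨ht, hτy⟩).comp_of_eq
      (analyticAt_fst.prod (hτ.comp_of_eq analyticAt_snd rfl)) rfl
  refine (CTensor.analyticAt_pullback (hτ.fderiv.comp_of_eq analyticAt_snd rfl)
    (isInvertible_fderiv_transition hyc) hu').congr ?_
  have hopen := isOpen_chartPart (E := E) c' (isOpen_extChartAt_source (I := 𝓘(ℝ, E)) c)
  filter_upwards [(hopen.preimage continuous_snd).mem_nhds hyc] with z hz
  exact ((tensorInChart_transition hz (tensorOfChart c fun y => u (z.1, y))).trans
    (congrArg _ (tensorInChart_tensorOfChart (transition_mem_target hz) _))).symm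

section Transport

variable [CompleteSpace E] {Z : ℝ → M → ℂ ⊗[ℝ] E} {T T₀ : ℝ} {h : ℝ × E → E × E}

theorem hasDerivWithinAt_of_solvesEvolutionAt (hZ : IsAnalyticVectorPathOn Z T W) (hW : IsOpen W)
    (hU : IsOpen U) (hUW : U ⊆ W)
    (hh : ∀ s ∈ Ico 0 T, ∀ z ∈ chartPart E c W, complexVectorInChart (M := M) c (Z s) z = h (s, z))
    {t : ℝ} (ht : t ∈ Ico 0 T) {y : E} (hy : y ∈ chartPart E c U)
    (hu : DifferentiableAt ℝ u (t, y))
    (hueq : SolvesEvolutionAt (lieFirstOrder p q h) (lieZerothOrder p q h) u (t, y))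
    {β : ℝ → M → CTensor p q E}
    (hβ : ∀ s, ∀ z ∈ chartPart E c U, tensorPathInChart c β (s, z) = u (s, z)) (S : Set ℝ) :
    HasDerivWithinAt (fun s => β s ((extChartAt 𝓘(ℝ, E) c).symm y))
      (complexLieDerivative (M := M) (Z t) (β t) ((extChartAt 𝓘(ℝ, E) c).symm y) : CTensor p q E)
      S t := by
  have hut := hu.hasFDerivAt.hasFDerivWithinAt (s := univ ×ˢ univ)
  have hspace : HasFDerivAt (tensorInChart (M := M) c (β t))
      ((fderiv ℝ u (t, y)).comp (ContinuousLinearMap.inr ℝ ℝ E)) y :=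
    (hasFDerivAt_slice hut (mem_univ t) univ_mem).congr_of_eventuallyEq <| by
      filter_upwards [(isOpen_chartPart c hU).mem_nhds hy] with z hz using hβ t z hz
  have htime := hasDerivWithinAt_slice hut (mem_univ y)
  rw [hueq, ← hβ t y hy] at htime
  exact (transport_equation_iff_tensorPathInChart hZ hW hh ht (chartPart_mono c hUW hy) hspace S).2
    ((htime.mono (subset_univ S)).congr_of_eventuallyEq
      (.of_forall fun s => hβ s y hy) (hβ t y hy))

theorem isTransportOn_of_solvesEvolutionAt (hZ : IsAnalyticVectorPathOn Z T W) (hW : IsOpen W)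
    (hU : IsOpen U) (hUW : U ⊆ W) (hUc : U ⊆ (extChartAt 𝓘(ℝ, E) c).source)
    (hh : ∀ s ∈ Ico 0 T, ∀ z ∈ chartPart E c W, complexVectorInChart (M := M) c (Z s) z = h (s, z))
    (hT₀ : T₀ < T) (hu : AnalyticOnNhd ℝ u (Icc 0 T₀ ×ˢ chartPart E c U))
    (hueq : ∀ z ∈ Icc 0 T₀ ×ˢ chartPart E c U,
      SolvesEvolutionAt (lieFirstOrder p q h) (lieZerothOrder p q h) u z)
    {α : M → CTensor p q E} (hu₀ : ∀ y ∈ chartPart E c U, u (0, y) = tensorInChart (M := M) c α y)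
    {β : ℝ → M → CTensor p q E} (hβa : IsAnalyticTensorPathOn β U T₀)
    (hβ : ∀ s, ∀ z ∈ chartPart E c U, tensorPathInChart c β (s, z) = u (s, z)) :
    IsTransportOn (M := M) Z α U T₀ β where
  contDiffOn c' := (hβa c').contDiffOn_of_completeSpace
  initial x hx := by
    have hy := extChartAt_mem_chartPart (hUc hx) hx
    exact eq_of_tensorInChart_eq (hUc hx) ((hβ 0 _ hy).trans (hu₀ _ hy))
  equation t ht x hx := by
    obtain ⟨y, hy, rfl⟩ : ∃ y ∈ chartPart E c U, (extChartAt 𝓘(ℝ, E) c).symm y = x :=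
      ⟨_, extChartAt_mem_chartPart (hUc hx) hx, (extChartAt 𝓘(ℝ, E) c).left_inv (hUc hx)⟩
    exact hasDerivWithinAt_of_solvesEvolutionAt hZ hW hU hUW hh ⟨ht.1, ht.2.trans_lt hT₀⟩ hy
      (hu (t, y) ⟨ht, hy⟩).differentiableAt (hueq (t, y) ⟨ht, hy⟩) hβ (Icc 0 T₀)

end Transport

theorem exists_isTransportOn [FiniteDimensional ℝ E] {Z : ℝ → M → ℂ ⊗[ℝ] E} {T : ℝ}
    (hZ : IsAnalyticVectorPathOn Z T W) (hT : 0 < T) (hW : IsOpen W) {α : M → CTensor p q E}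
    (hα : IsAnalyticTensorOn (M := M) α W) {x₀ : M} (hx₀ : x₀ ∈ W) :
    ∃ U, IsOpen U ∧ x₀ ∈ U ∧ U ⊆ W ∧ ∃ T₀ > 0, T₀ < T ∧ ∃ β : ℝ → M → CTensor p q E,
      IsTransportOn (M := M) Z α U T₀ β ∧ IsAnalyticTensorPathOn β U T₀ := by
  have : CompleteSpace E := FiniteDimensional.complete ℝ E
  have hx₀c : x₀ ∈ (extChartAt 𝓘(ℝ, E) x₀).source := mem_extChartAt_source x₀
  have hy₀ := extChartAt_mem_chartPart hx₀c hx₀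
  have hWo := isOpen_chartPart (E := E) x₀ hW
  obtain ⟨h, hh, hhZ⟩ := hZ.exists_analyticAt (t := 0) ⟨le_rfl, hT⟩ hy₀
  obtain ⟨u, hu⟩ := exists_analyticAt_solvesEvolutionAt
    (analyticAt_lieFirstOrder (p := p) (q := q) hh) (analyticAt_lieZerothOrder hh)
    (hWo.analyticOn_iff_analyticOnNhd.1 (hα x₀) _ hy₀)
  have hnear := hu.and ((hWo.preimage continuous_snd).mem_nhds hy₀)
  rw [nhds_prod_eq, eventually_prod_iff] at hnear
  obtain ⟨I, hI, S, hS, hIS⟩ := hnear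
  obtain ⟨δ, hδ, hδI⟩ := Metric.eventually_nhds_iff.1 hI
  obtain ⟨V, hVS, hV, hyV⟩ := eventually_nhds_iff.1 hS
  obtain ⟨T₀, hT₀, hT₀'⟩ := exists_between (lt_min hδ hT)
  obtain ⟨hT₀δ, hT₀T⟩ := lt_min_iff.1 hT₀'
  have hT₀I {t : ℝ} (ht : t ∈ Icc 0 T₀) : I t := hδI <| by
    rw [Real.dist_eq, sub_zero, abs_of_nonneg ht.1]
    exact ht.2.trans_lt hT₀δ
  have hVW : V ⊆ chartPart E x₀ W := fun y hy => (hIS (hT₀I ⟨le_rfl, hT₀.le⟩) (hVS y hy)).2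
  set U := (extChartAt 𝓘(ℝ, E) x₀).source ∩ extChartAt 𝓘(ℝ, E) x₀ ⁻¹' V
  have hUV : chartPart E x₀ U ⊆ V := fun y hy => by
    simpa only [mem_preimage, (extChartAt 𝓘(ℝ, E) x₀).right_inv hy.1] using hy.2.2
  have huU (z : ℝ × E) (hz : z ∈ Icc 0 T₀ ×ˢ chartPart E x₀ U) :=
    (hIS (hT₀I hz.1) (hVS _ (hUV hz.2))).1
  have hβa : IsAnalyticTensorPathOn (fun t => tensorOfChart (M := M) x₀ fun y => u (t, y)) U T₀ :=
    fun c => (analyticOnNhd_tensorPathInChart_tensorOfChart inter_subset_left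
      (fun z hz => (huU z hz).1) c).analyticOn
  refine ⟨U, isOpen_source_inter_preimage hV, ⟨hx₀c, hyV⟩, source_inter_preimage_subset hVW,
    T₀, hT₀, hT₀T, fun t => tensorOfChart x₀ fun y => u (t, y), ?_, hβa⟩
  exact isTransportOn_of_solvesEvolutionAt hZ hW (isOpen_source_inter_preimage hV)
      (source_inter_preimage_subset hVW) inter_subset_left hhZ hT₀T (fun z hz => (huU z hz).1)
      (fun z hz => (huU z hz).2.1) (fun y hy => (huU (0, y) ⟨⟨le_rfl, hT₀.le⟩, hy⟩).2.2) hβa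
      fun s y hy => tensorInChart_tensorOfChart hy.1 _

end LocalExistence

section RealAnalyticity

open Filter Topology

variable {E : Type*} [NormedAddCommGroup E] [NormedSpace ℝ E] {F : Type*} [NormedAddCommGroup F]
  [NormedSpace ℝ F]

theorem analyticOn_slice_left {f : ℝ × E → F} {I : Set ℝ} {S : Set E} {y : E}
    (hf : AnalyticOn ℝ f (I ×ˢ S)) (hy : y ∈ S) : AnalyticOn ℝ (fun t => f (t, y)) I :=
  show AnalyticOn ℝ (f ∘ fun t => (t, y)) I from
    hf.comp (analyticOn_id.prod analyticOn_const) fun _ ht => mk_mem_prod ht hy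

theorem analyticOn_slice_right {f : ℝ × E → F} {I : Set ℝ} {S : Set E} {t : ℝ}
    (hf : AnalyticOn ℝ f (I ×ˢ S)) (ht : t ∈ I) : AnalyticOn ℝ (fun y => f (t, y)) S :=
  show AnalyticOn ℝ (f ∘ fun y => (t, y)) S from
    hf.comp (analyticOn_const.prod analyticOn_id) fun _ hy => mk_mem_prod ht hy

theorem eqOn_Ioo_of_eventuallyEq_nhdsGT {f g : ℝ → F} {a b : ℝ} (hf : AnalyticOn ℝ f (Ioo a b))
    (hg : AnalyticOn ℝ g (Ioo a b)) (hfg : f =ᶠ[𝓝[>] a] g) : EqOn f g (Ioo a b) := by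
  intro t ht
  obtain ⟨c, hc, hEq⟩ := mem_nhdsGT_iff_exists_Ioo_subset.1 hfg
  obtain ⟨t₀, hat₀, ht₀⟩ := exists_between (lt_min (ht.1.trans ht.2) hc)
  obtain ⟨ht₀b, ht₀c⟩ := lt_min_iff.1 ht₀
  exact (isOpen_Ioo.analyticOn_iff_analyticOnNhd.1 hf).eqOn_of_preconnected_of_eventuallyEq
    (isOpen_Ioo.analyticOn_iff_analyticOnNhd.1 hg) isPreconnected_Ioo ⟨hat₀, ht₀b⟩
    (mem_of_superset (Ioo_mem_nhds hat₀ ht₀c) hEq) ht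

theorem exists_mem_Ico_castSucc_succ {N : ℕ} {s : Fin (N + 1) → ℝ} {t : ℝ}
    (ht : t ∈ Ico (s 0) (s (Fin.last N))) : ∃ i : Fin N, t ∈ Ico (s i.castSucc) (s i.succ) := by
  obtain ⟨j, hj, hmin⟩ := (wellFounded_lt (α := Fin (N + 1))).has_min {j | t < s j} ⟨_, ht.2⟩
  obtain ⟨i, rfl⟩ := Fin.exists_succ_eq.2 (show j ≠ 0 by rintro rfl; exact ht.1.not_gt hj)
  exact ⟨i, not_lt.1 fun h => hmin _ h Fin.castSucc_lt_succ, hj⟩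

end RealAnalyticity

section GlobalTheory

set_option maxSynthPendingDepth 3

open Filter Topology

theorem exists_pos_forall_exists_mem {M : Type*} [TopologicalSpace M] [CompactSpace M] {ι : Type*}
    {V : ι → Set M} (hV : ∀ i, IsOpen (V i)) (hcover : ∀ x, ∃ i, x ∈ V i) {δ : ι → ℝ}
    (hδ : ∀ i, 0 < δ i) : ∃ ε > 0, ∀ x, ∃ i, x ∈ V i ∧ ε ≤ δ i := by
  obtain ⟨F, hF⟩ := isCompact_univ.elim_finite_subcover V hV fun x _ => mem_iUnion.2 (hcover x)
  have hsmall : ∀ᶠ ε in 𝓝[>] (0 : ℝ), ∀ i ∈ F, ε ≤ δ i :=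
    (eventually_all_finset F).2 fun i _ => mem_of_superset (Ioc_mem_nhdsGT (hδ i)) fun _ h => h.2
  obtain ⟨ε, hεδ, hε⟩ := (hsmall.and self_mem_nhdsWithin).exists
  refine ⟨ε, hε, fun x => ?_⟩
  obtain ⟨i, hi, hxi⟩ := mem_iUnion₂.1 (hF (mem_univ x))
  exact ⟨i, hxi, hεδ i hi⟩

variable {p q : ℕ} {E : Type*} [NormedAddCommGroup E] [NormedSpace ℝ E]
  {M : Type*} [TopologicalSpace M] [ChartedSpace E M]
  {Z : ℝ → M → ℂ ⊗[ℝ] E} {T T' T₀ : ℝ} {U U' V W : Set M} {α : M → CTensor p q E}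
  {β γ : ℝ → M → CTensor p q E}

theorem IsPiecewiseAnalyticOn.exists_isAnalyticVectorPathOn
    (hZ : IsPiecewiseAnalyticOn (fun c t => complexVectorInChart (M := M) c (Z t)) T W)
    (hT : 0 < T) : ∃ T₁ > 0, T₁ ≤ T ∧ IsAnalyticVectorPathOn Z T₁ W := by
  obtain ⟨N, s, hs, hs0, hsT, hg⟩ := hZ
  obtain _ | N := N
  · exact absurd (hs0.symm.trans hsT) hT.ne
  refine ⟨s (Fin.succ 0), hs0 ▸ hs (Fin.succ_pos 0), hsT ▸ hs.monotone (Fin.le_last _),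
    fun c => ?_⟩
  have h := hg 0 c
  rwa [Fin.castSucc_zero, hs0] at h

theorem prod_chartPart_mem_nhdsWithin (hV : IsOpen V) {c : M} {I : Set ℝ} {z : ℝ × E}
    (hz : z.2 ∈ chartPart E c V) (U : Set M) :
    I ×ˢ chartPart E c V ∈ 𝓝[I ×ˢ chartPart E c U] z := by
  rw [← z.eta, nhdsWithin_prod_eq]
  exact prod_mem_prod self_mem_nhdsWithin
    (mem_nhdsWithin_of_mem_nhds ((isOpen_chartPart c hV).mem_nhds hz))

theorem tensorPathInChart_eqOn {I : Set ℝ} (h : ∀ t ∈ I, ∀ x ∈ U, β t x = γ t x) (c : M) :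
    EqOn (tensorPathInChart c β) (tensorPathInChart c γ) (I ×ˢ chartPart E c U) :=
  fun z hz => congrArg _ (h z.1 hz.1 _ hz.2.2)

namespace IsAnalyticTensorPathOn

theorem mono (h : IsAnalyticTensorPathOn β U T) (hU : U' ⊆ U) (hT : T' ≤ T) :
    IsAnalyticTensorPathOn β U' T' := fun c =>
  (h c).mono (prod_mono (Icc_subset_Icc_right hT) (chartPart_mono c hU))

theorem isPiecewiseAnalyticOn (h : IsAnalyticTensorPathOn β U T) (hT : 0 < T) :
    IsPiecewiseAnalyticOn (fun c t => tensorInChart (M := M) c (β t)) T U := by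
  refine ⟨1, ![0, T], ?_, rfl, rfl, fun i c => ⟨tensorPathInChart c β, ?_, fun t _ y _ => rfl⟩⟩
  · rw [Fin.strictMono_iff_lt_succ]
    intro i
    fin_cases i
    exact hT
  · fin_cases i
    exact h c

theorem isAnalyticTensorOn {t : ℝ} (h : IsAnalyticTensorPathOn β U T) (ht : t ∈ Icc 0 T) :
    IsAnalyticTensorOn (M := M) (β t) U := fun c =>
  analyticOn_slice_right (h c) ht

theorem of_locally (h : ∀ x ∈ U, ∃ V, IsOpen V ∧ x ∈ V ∧ ∃ γ : ℝ → M → CTensor p q E,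
      IsAnalyticTensorPathOn γ V T ∧ ∀ t ∈ Icc 0 T, ∀ x ∈ V, β t x = γ t x) :
    IsAnalyticTensorPathOn β U T := by
  intro c z hz
  obtain ⟨V, hV, hxV, γ, hγ, hβγ⟩ := h _ hz.2.2
  have hzV : z.2 ∈ chartPart E c V := ⟨hz.2.1, hxV⟩
  exact ((hγ c).congr (tensorPathInChart_eqOn hβγ c) z ⟨hz.1, hzV⟩).mono_of_mem_nhdsWithin
    (prod_chartPart_mem_nhdsWithin hV hzV U)

end IsAnalyticTensorPathOn

section Congruence

variable {α' : M → CTensor p q E}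

theorem tensorInChart_eventuallyEq (hU : IsOpen U) (h : ∀ x ∈ U, α x = α' x) {c : M} {y : E}
    (hy : y ∈ chartPart E c U) :
    tensorInChart (M := M) c α =ᶠ[𝓝 y] tensorInChart (M := M) c α' := by
  filter_upwards [(isOpen_chartPart c hU).mem_nhds hy] with z hz
  rw [tensorInChart_eq, tensorInChart_eq, h _ hz.2]

theorem realLieDerivative_congr (hU : IsOpen U) (h : ∀ x ∈ U, α x = α' x) (X : M → E) {x : M}
    (hx : x ∈ U) :
    (realLieDerivative (M := M) X α x : CTensor p q E) = realLieDerivative (M := M) X α' x :=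
  congrArg (CTensor.pullback _) <| CTensor.lieFlat_congr (.refl _ (vectorInChart (M := M) x X))
    (tensorInChart_eventuallyEq hU h (extChartAt_mem_chartPart (mem_extChartAt_source x) hx))

theorem complexLieDerivative_congr (hU : IsOpen U) (h : ∀ x ∈ U, α x = α' x) (Z : M → ℂ ⊗[ℝ] E)
    {x : M} (hx : x ∈ U) :
    (complexLieDerivative (M := M) Z α x : CTensor p q E)
      = complexLieDerivative (M := M) Z α' x :=
  congrArg₂ (fun A B : CTensor p q E => A + Complex.I • B)
    (realLieDerivative_congr hU h (fun x => complexifiedRe (Z x)) hx)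
    (realLieDerivative_congr hU h (fun x => complexifiedIm (Z x)) hx)

end Congruence

namespace IsTransportOn

theorem continuousOn (hβ : IsTransportOn (M := M) Z α U T β) {x : M} (hx : x ∈ U) :
    ContinuousOn (fun t => β t x) (Icc 0 T) :=
  fun _ ht => (hβ.hasDerivWithinAt ht hx).continuousWithinAt

theorem eqOn_of_forall_exists_gt (hβ : IsTransportOn (M := M) Z α U T β)
    (hγ : IsTransportOn (M := M) Z α U T γ)
    (hstep : ∀ t ∈ Ico 0 T, (∀ x ∈ U, β t x = γ t x) →
      ∃ t' > t, ∀ s ∈ Ioo t t', ∀ x ∈ U, β s x = γ s x) :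
    ∀ t ∈ Icc 0 T, ∀ x ∈ U, β t x = γ t x := by
  have hinter : {t | ∀ x ∈ U, β t x = γ t x} ∩ Icc 0 T
      = Icc 0 T ∩ ⋂ x ∈ U, (Icc 0 T ∩ (fun t => β t x - γ t x) ⁻¹' {0}) := by
    ext t
    simp only [mem_inter_iff, mem_ofPred_eq, mem_iInter, mem_preimage, mem_singleton_iff,
      sub_eq_zero]
    exact ⟨fun h => ⟨h.2, fun x hx => ⟨h.2, h.1 x hx⟩⟩, fun h => ⟨fun x hx => (h.2 x hx).2, h.1⟩⟩
  have hclosed : IsClosed ({t | ∀ x ∈ U, β t x = γ t x} ∩ Icc 0 T) :=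
    hinter ▸ isClosed_Icc.inter (isClosed_biInter fun x hx =>
      ((hβ.continuousOn hx).sub (hγ.continuousOn hx)).preimage_isClosed_of_isClosed
        isClosed_Icc isClosed_singleton)
  refine fun t ht => hclosed.Icc_subset_of_forall_mem_nhdsWithin
    (fun x hx => (hβ.initial x hx).trans (hγ.initial x hx).symm) (fun t ht => ?_) ht
  obtain ⟨t', ht', h⟩ := hstep t ht.2 ht.1
  exact mem_of_superset (Ioo_mem_nhdsGT ht') h

theorem of_locally (h : ∀ x ∈ U, ∃ V, IsOpen V ∧ x ∈ V ∧ ∃ γ : ℝ → M → CTensor p q E,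
      IsTransportOn (M := M) Z α V T γ ∧ ∀ t ∈ Icc 0 T, ∀ x ∈ V, β t x = γ t x)
    (h₀ : ∀ x ∈ U, β 0 x = α x) : IsTransportOn (M := M) Z α U T β where
  contDiffOn c z hz := by
    obtain ⟨V, hV, hxV, γ, hγ, hβγ⟩ := h _ hz.2.2
    have hzV : z.2 ∈ chartPart E c V := ⟨hz.2.1, hxV⟩
    exact ((hγ.contDiffOn c).congr (tensorPathInChart_eqOn hβγ c) z
      ⟨hz.1, hzV⟩).mono_of_mem_nhdsWithin (prod_chartPart_mem_nhdsWithin hV hzV U)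
  initial := h₀
  equation t ht x hx := by
    obtain ⟨V, hV, hxV, γ, hγ, hβγ⟩ := h x hx
    exact ((hγ.hasDerivWithinAt ht hxV).congr_deriv
      (complexLieDerivative_congr hV (fun z hz => (hβγ t ht z hz).symm) (Z t) hxV)).congr
      (fun s hs => hβγ s hs x hxV) (hβγ t ht x hxV)

variable [IsManifold 𝓘(ℝ, E) ω M] [FiniteDimensional ℝ E]

theorem eqOn_of_isPiecewiseAnalyticOn (hβ : IsTransportOn (M := M) Z α U T₀ β)
    (hγ : IsTransportOn (M := M) Z α U T₀ γ) (hβa : IsAnalyticTensorPathOn β U T₀)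
    (hγa : IsPiecewiseAnalyticOn (fun c t => tensorInChart (M := M) c (γ t)) T₀ U)
    (hZ : IsAnalyticVectorPathOn Z T W) (hW : IsOpen W) (hU : IsOpen U) (hUW : U ⊆ W)
    (hT₀ : T₀ < T) : ∀ t ∈ Icc 0 T₀, ∀ x ∈ U, β t x = γ t x := by
  refine hβ.eqOn_of_forall_exists_gt hγ fun t ht hβγ => ?_
  obtain ⟨N, s, hs, hs0, hsT, hg⟩ := hγa
  obtain ⟨i, hi⟩ := exists_mem_Ico_castSucc_succ (s := s) (t := t) (hs0.symm ▸ hsT.symm ▸ ht)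
  have hiT : s i.succ ≤ T₀ := hsT ▸ hs.monotone (Fin.le_last _)
  refine ⟨s i.succ, hi.2, fun r hr x hx => ?_⟩
  have hxs : x ∈ (extChartAt 𝓘(ℝ, E) x).source := mem_extChartAt_source x
  have hy := extChartAt_mem_chartPart hxs hx
  obtain ⟨g, hga, hγg⟩ := hg i x
  obtain ⟨δ, hδ, V, -, hxV, -, -, hV⟩ := exists_eqOn_of_isTransportOn (p := p) (q := q) (α := α)
    hZ hW hU hUW hx ht.1 (ht.2.trans hT₀) ht.2
  have hβan : AnalyticOn ℝ (fun r => tensorPathInChart x β (r, extChartAt 𝓘(ℝ, E) x x))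
      (Ioo t (s i.succ)) :=
    (analyticOn_slice_left (hβa x) hy).mono fun r hr => ⟨ht.1.trans hr.1.le, hr.2.le.trans hiT⟩
  have hgan : AnalyticOn ℝ (fun r => g (r, extChartAt 𝓘(ℝ, E) x x)) (Ioo t (s i.succ)) :=
    (analyticOn_slice_left hga hy).mono fun r hr => ⟨hi.1.trans hr.1.le, hr.2.le⟩
  refine eq_of_tensorInChart_eq hxs <|
    (eqOn_Ioo_of_eventuallyEq_nhdsGT hβan hgan ?_ hr).trans
      (hγg r ⟨hi.1.trans hr.1.le, hr.2⟩ _ hy).symm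
  filter_upwards [Ioo_mem_nhdsGT hi.2, Ioo_mem_nhdsGT (lt_add_of_pos_right t hδ)] with r hri hrδ
  refine .trans ?_ (hγg r ⟨hi.1.trans hri.1.le, hri.2⟩ _ hy)
  exact tensorPathInChart_eqOn (I := Icc t (t + δ)) (hV β γ hβ hγ hβγ) x
    ⟨⟨hrδ.1.le, hrδ.2.le⟩, extChartAt_mem_chartPart hxs hxV⟩

theorem exists_eqOn_inter (hβ : IsTransportOn (M := M) Z α U T₀ β)
    (hZ : IsAnalyticVectorPathOn Z T W) (hT : 0 < T) (hW : IsOpen W) (hU : IsOpen U) (hUW : U ⊆ W)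
    (hT₀ : 0 < T₀) (hU' : IsOpen U') (hT' : 0 < T') {x₀ : M} (hx₀ : x₀ ∈ U) (hx₀' : x₀ ∈ U') :
    ∃ (V : Set M) (T'' : ℝ), IsOpen V ∧ x₀ ∈ V ∧ V ⊆ U ∩ U' ∧ 0 < T'' ∧ T'' ≤ T₀ ∧ T'' ≤ T' ∧
      ∀ γ : ℝ → M → CTensor p q E, IsTransportOn (M := M) Z α U' T' γ →
        ∀ t ∈ Icc 0 T'', ∀ x ∈ V, γ t x = β t x := by
  obtain ⟨δ, hδ, V, hV, hxV, hVU, hδT, hVeq⟩ := exists_eqOn_of_isTransportOn (p := p) (q := q)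
    (α := α) hZ hW (hU.inter hU') (inter_subset_left.trans hUW) ⟨hx₀, hx₀'⟩ le_rfl hT
    (lt_min hT₀ hT')
  rw [zero_add] at hδT hVeq
  refine ⟨V, δ, hV, hxV, hVU, hδ, hδT.trans (min_le_left _ _), hδT.trans (min_le_right _ _),
    fun γ hγ => hVeq γ β (hγ.mono inter_subset_right (min_le_right _ _))
      (hβ.mono inter_subset_left (min_le_left _ _)) fun x hx => ?_⟩
  exact (hγ.initial x hx.2).trans (hβ.initial x hx.1).symm

variable [CompactSpace M]

theorem eqOn_of_compactSpace (hβ : IsTransportOn (M := M) Z α univ T₀ β)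
    (hγ : IsTransportOn (M := M) Z α univ T₀ γ)
    (hZ : IsAnalyticVectorPathOn Z T (univ : Set M)) (hT₀ : T₀ < T) :
    ∀ t ∈ Icc 0 T₀, ∀ x, β t x = γ t x := by
  refine fun t ht x => hβ.eqOn_of_forall_exists_gt hγ (fun t ht hβγ => ?_) t ht x (mem_univ x)
  choose δ hδ V hV hxV _ _ hVeq using fun x : M => exists_eqOn_of_isTransportOn (p := p)
    (q := q) (α := α) hZ isOpen_univ isOpen_univ subset_rfl (mem_univ x) ht.1 (ht.2.trans hT₀) ht.2
  obtain ⟨ε, hε, hcover⟩ := exists_pos_forall_exists_mem hV (fun x => ⟨x, hxV x⟩) hδ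
  refine ⟨t + ε, lt_add_of_pos_right t hε, fun s hs x _ => ?_⟩
  obtain ⟨z, hxz, hεz⟩ := hcover x
  exact hVeq z β γ hβ hγ hβγ s ⟨hs.1.le, hs.2.le.trans (by gcongr)⟩ x hxz

end IsTransportOn

theorem exists_isTransportOn_univ [IsManifold 𝓘(ℝ, E) ω M] [FiniteDimensional ℝ E] [CompactSpace M]
    (hZ : IsAnalyticVectorPathOn Z T (univ : Set M)) (hT : 0 < T)
    (hα : IsAnalyticTensorOn (M := M) α univ) :
    ∃ T₀ > 0, T₀ < T ∧ ∃ β : ℝ → M → CTensor p q E, IsTransportOn (M := M) Z α univ T₀ β ∧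
      IsAnalyticTensorPathOn β univ T₀ := by
  choose U hU hxU _ τ hτ _ b hb hba using fun x : M =>
    exists_isTransportOn hZ hT isOpen_univ hα (mem_univ x)
  obtain ⟨ε, hε, hcover⟩ := exists_pos_forall_exists_mem hU (fun x => ⟨x, hxU x⟩) hτ
  obtain ⟨T₀, hT₀, hT₀'⟩ := exists_between (lt_min hε hT)
  obtain ⟨hT₀ε, hT₀T⟩ := lt_min_iff.1 hT₀'
  choose j hxj hj using hcover
  have hτj (x : M) : T₀ ≤ τ (j x) := hT₀ε.le.trans (hj x)
  have hagree (z : M) : ∀ t ∈ Icc 0 T₀, ∀ x ∈ U (j z), b (j x) t x = b (j z) t x := by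
    intro t ht x hx
    exact IsTransportOn.eqOn_of_isPiecewiseAnalyticOn
      ((hb _).mono inter_subset_left (hτj x)) ((hb _).mono inter_subset_right (hτj z))
      ((hba _).mono inter_subset_left (hτj x))
      (((hba _).mono inter_subset_right (hτj z)).isPiecewiseAnalyticOn hT₀) hZ isOpen_univ
      ((hU (j x)).inter (hU (j z))) (subset_univ _) hT₀T t ht x ⟨hxj x, hx⟩
  refine ⟨T₀, hT₀, hT₀T, fun t x => b (j x) t x, .of_locally (fun x _ => ?_)
    fun x _ => (hb _).initial x (hxj x), .of_locally fun x _ => ?_⟩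
  · exact ⟨U (j x), hU _, hxj x, b (j x), (hb _).mono subset_rfl (hτj x), hagree x⟩
  · exact ⟨U (j x), hU _, hxj x, b (j x), (hba _).mono subset_rfl (hτj x), hagree x⟩

end GlobalTheory

end

theorem mainTheorem8_general
    {E : Type*} [NormedAddCommGroup E] [NormedSpace ℝ E] [FiniteDimensional ℝ E]
    {M : Type*} [TopologicalSpace M] [ChartedSpace E M] [IsManifold 𝓘(ℝ, E) ω M]
    (p q : ℕ) (T : ℝ) (hT : 0 < T) (W : Set M) (hW : IsOpen W)
    (Z : ℝ → (x : M) → ℂ ⊗[ℝ] TangentSpace 𝓘(ℝ, E) x)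
    (hZ : IsPiecewiseAnalyticOn (fun c t => complexVectorInChart c (Z t)) T W)
    (α : (x : M) → CTensor p q (TangentSpace 𝓘(ℝ, E) x))
    (hα : IsAnalyticTensorOn α W) :
    (∀ x₀ ∈ W, ∃ (U : Set M) (T₀ : ℝ)
        (β : ℝ → (x : M) → CTensor p q (TangentSpace 𝓘(ℝ, E) x)),
      IsOpen U ∧ x₀ ∈ U ∧ U ⊆ W ∧ 0 < T₀ ∧ T₀ ≤ T ∧
      IsTransportOn Z α U T₀ β ∧
      IsPiecewiseAnalyticOn (fun c t => tensorInChart c (β t)) T₀ U ∧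
      (∀ t ∈ Icc 0 T₀, IsAnalyticTensorOn (β t) U) ∧
      (∀ γ : ℝ → (x : M) → CTensor p q (TangentSpace 𝓘(ℝ, E) x),
        IsTransportOn Z α U T₀ γ →
        IsPiecewiseAnalyticOn (fun c t => tensorInChart c (γ t)) T₀ U →
        ∀ t ∈ Icc 0 T₀, ∀ x ∈ U, γ t x = β t x) ∧
      (∀ (U' : Set M) (T' : ℝ), IsOpen U' → x₀ ∈ U' → U' ⊆ W → 0 < T' → T' ≤ T →
        ∃ (V : Set M) (T'' : ℝ), IsOpen V ∧ x₀ ∈ V ∧ V ⊆ U ∩ U' ∧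
          0 < T'' ∧ T'' ≤ T₀ ∧ T'' ≤ T' ∧
          ∀ γ : ℝ → (x : M) → CTensor p q (TangentSpace 𝓘(ℝ, E) x),
            IsTransportOn Z α U' T' γ →
            ∀ t ∈ Icc 0 T'', ∀ x ∈ V, γ t x = β t x)) ∧
    (CompactSpace M → W = univ →
      ∃ (T₀ : ℝ) (β : ℝ → (x : M) → CTensor p q (TangentSpace 𝓘(ℝ, E) x)),
        0 < T₀ ∧ T₀ ≤ T ∧
        IsTransportOn Z α univ T₀ β ∧
        IsPiecewiseAnalyticOn (fun c t => tensorInChart c (β t)) T₀ univ ∧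
        (∀ t ∈ Icc 0 T₀, IsAnalyticTensorOn (β t) univ) ∧
        ∀ T' : ℝ, 0 < T' → T' ≤ T₀ →
          ∀ γ : ℝ → (x : M) → CTensor p q (TangentSpace 𝓘(ℝ, E) x),
            IsTransportOn Z α univ T' γ →
            ∀ t ∈ Icc 0 T', ∀ x, γ t x = β t x) := by
  obtain ⟨T₁, hT₁, hT₁T, hZ⟩ := hZ.exists_isAnalyticVectorPathOn hT
  refine ⟨fun x₀ hx₀ => ?_, ?_⟩
  · obtain ⟨U, hU, hxU, hUW, T₀, hT₀, hT₀T₁, β, hβ, hβa⟩ :=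
      exists_isTransportOn hZ hT₁ hW hα hx₀
    refine ⟨U, T₀, β, hU, hxU, hUW, hT₀, hT₀T₁.le.trans hT₁T, hβ, hβa.isPiecewiseAnalyticOn hT₀,
      fun t ht => hβa.isAnalyticTensorOn ht, fun γ hγ hγa t ht x hx => ?_,
      fun U' T' hU' hxU' _ hT' _ => ?_⟩
    · exact (hβ.eqOn_of_isPiecewiseAnalyticOn hγ hβa hγa hZ hW hU hUW hT₀T₁ t ht x hx).symm
    · exact hβ.exists_eqOn_inter hZ hT₁ hW hU hUW hT₀ hU' hT' hxU hxU'
  · rintro _ rfl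
    obtain ⟨T₀, hT₀, hT₀T₁, β, hβ, hβa⟩ := exists_isTransportOn_univ hZ hT₁ hα
    refine ⟨T₀, β, hT₀, hT₀T₁.le.trans hT₁T, hβ, hβa.isPiecewiseAnalyticOn hT₀,
      fun t ht => hβa.isAnalyticTensorOn ht, fun T' _ hT' γ hγ => ?_⟩
    exact hγ.eqOn_of_compactSpace (hβ.mono subset_rfl hT') hZ (hT'.trans_lt hT₀T₁)

theorem mainTheorem8
    {E : Type*} [NormedAddCommGroup E] [NormedSpace ℝ E] [FiniteDimensional ℝ E]
    {M : Type*} [TopologicalSpace M] [T2Space M] [SecondCountableTopology M]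
    [ChartedSpace E M] [IsManifold 𝓘(ℝ, E) ω M]
    (p q : ℕ) (T : ℝ) (hT : 0 < T) (W : Set M) (hW : IsOpen W)
    (Z : ℝ → (x : M) → ℂ ⊗[ℝ] TangentSpace 𝓘(ℝ, E) x)
    (hZ : IsPiecewiseAnalyticOn (fun c t => complexVectorInChart c (Z t)) T W)
    (α : (x : M) → CTensor p q (TangentSpace 𝓘(ℝ, E) x))
    (hα : IsAnalyticTensorOn α W) :
    -- local existence and uniqueness
    (∀ x₀ ∈ W, ∃ (U : Set M) (T₀ : ℝ)
        (β : ℝ → (x : M) → CTensor p q (TangentSpace 𝓘(ℝ, E) x)),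
      IsOpen U ∧ x₀ ∈ U ∧ U ⊆ W ∧ 0 < T₀ ∧ T₀ ≤ T ∧
      IsTransportOn Z α U T₀ β ∧
      IsPiecewiseAnalyticOn (fun c t => tensorInChart c (β t)) T₀ U ∧
      (∀ t ∈ Icc 0 T₀, IsAnalyticTensorOn (β t) U) ∧
      -- uniqueness on `[0, T₀] × U` among piecewise analytic solutions
      (∀ γ : ℝ → (x : M) → CTensor p q (TangentSpace 𝓘(ℝ, E) x),
        IsTransportOn Z α U T₀ γ →
        IsPiecewiseAnalyticOn (fun c t => tensorInChart c (γ t)) T₀ U →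
        ∀ t ∈ Icc 0 T₀, ∀ x ∈ U, γ t x = β t x) ∧
      -- uniqueness near `(0, x₀)` among all `C¹` solutions
      (∀ (U' : Set M) (T' : ℝ), IsOpen U' → x₀ ∈ U' → U' ⊆ W → 0 < T' → T' ≤ T →
        ∃ (V : Set M) (T'' : ℝ), IsOpen V ∧ x₀ ∈ V ∧ V ⊆ U ∩ U' ∧
          0 < T'' ∧ T'' ≤ T₀ ∧ T'' ≤ T' ∧
          ∀ γ : ℝ → (x : M) → CTensor p q (TangentSpace 𝓘(ℝ, E) x),
            IsTransportOn Z α U' T' γ →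
            ∀ t ∈ Icc 0 T'', ∀ x ∈ V, γ t x = β t x)) ∧
    -- on a compact manifold the solution is defined, and unique, on the whole manifold
    (CompactSpace M → W = univ →
      ∃ (T₀ : ℝ) (β : ℝ → (x : M) → CTensor p q (TangentSpace 𝓘(ℝ, E) x)),
        0 < T₀ ∧ T₀ ≤ T ∧
        IsTransportOn Z α univ T₀ β ∧
        IsPiecewiseAnalyticOn (fun c t => tensorInChart c (β t)) T₀ univ ∧
        (∀ t ∈ Icc 0 T₀, IsAnalyticTensorOn (β t) univ) ∧
        ∀ T' : ℝ, 0 < T' → T' ≤ T₀ →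
          ∀ γ : ℝ → (x : M) → CTensor p q (TangentSpace 𝓘(ℝ, E) x),
            IsTransportOn Z α univ T' γ →
            ∀ t ∈ Icc 0 T', ∀ x, γ t x = β t x) :=
  mainTheorem8_general p q T hT W hW Z hZ α hα
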